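/- **Model.** Time is slotted, $t=0,1,2,\dots$. A source sends status updates over two channels. Channel 1 (transmission time one slot) is ON ($l_1(t)=1$) or OFF ($l_1(t)=0$) in slot $t$; $(l_1(t))$ is a Markov chain in which ON is followed by ON with probability $q$ and OFF is followed by OFF with probability $p$, where $0<p,q<1$. Channel 2 is reliable and has transmission time $d\ge 2$ slots ($d$ an integer); $l_2(t)\in\{0,\dots,d-1\}$ is the remaining transmission time of its current packet ($0$ = idle). The state in slot $t$ is $(\Delta(t),l_1(t-1),l_2(t))$, where $\Delta(t)\ge 1$ is the age of information. The decision $u(t)\in\{1,2,\mathrm{none}\}$ is a function of the present and past states, and $u(t)=\mathrm{none}$ whenever $l_2(t)\ge1$; such policies $\pi$ are called admissible. The age evolves by $\Delta(t+1)=1$ if $u(t)=1$ and $l_1(t)=1$; $\Delta(t+1)=d$ if $l_2(t)=1$; $\Delta(t+1)=\Delta(t)+1$ otherwise; and $l_2(t+1)=l_2(t)-1$ if $l_2(t)\ge1$, $l_2(t+1)=d-1$ if $l_2(t)=0$ and $u(t)=2$, and $l_2(t+1)=0$ otherwise. Let $$\bar\Delta_{\rm opt}=\inf_{\pi\ \mathrm{admissible}}\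 \limsup_{T\to\infty}\frac1T\sum_{t=1}^T\mathbb E[\Delta_\pi(t)].$$ A policy is optimal if it is admissible and attains $\bar\Delta_{\rm opt}$. A stationary policy is given by $\mu(\delta,l_1,0)\in\{1,2\}$, the decision in state $(\delta,l_1,0)$. **Regions.** With $F=\frac1{1-p}-d$, $G=1-dq$, $H=\frac{1-q}{1-p}-d+1$, let $B_1=\{F\le0,H\le0\}$, $B_2=\{F>0,G\le0\}$, $B_3=\{F>0,G>0\}$, $B_4=\{F\le 0,H>0\}$. **Closed forms.** Let $\begin{bmatrix}a'&b'\\a&b\end{bmatrix}=\begin{bmatrix}q&1-q\\1-p&p\end{bmatrix}^d$, $S=\sum_{i=d}^{2d-1}i$, and $$\bar\Delta=\frac{(1-q)(2-p)+(1-p)^2}{(2-q-p)(1-p)},\qquad f_0'=\sum_{i=1}^di+\frac{a'}{b'}S+\sum_{i=d}^\infty ip^{i-d},\qquad g_0'=\frac d{b'}+\frac1{1-p},$$ $$f_0=q\sum_{i=1}^di+(1-q)\sum_{i=d+1}^{2d}i+\frac{b'q+b(1-q)}aS+d,\qquad g_0=\frac{b'q+b(1-q)}a\,d+d+1.$$ With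 $c_1(s)=1-bp^{s-d}-(1-q)ap^{s-d-1}$, $c_2=\frac b{aq}$, $c_4(s)=\frac{a'+(a-a')p^{s-d}}{b'}$, put $$f_1(s)=c_1(s)\Big(\tfrac p{1-q}+\sum_{i=2}^dip^{i-1}\Big)+dp^{s-1}+\sum_{i=d+1}^{s-1}ip^{i-1}+\sum_{i=s}^{s+d-1}ip^{s-1},$$ $$g_1(s)=c_1(s)\Big(\tfrac p{1-q}+\sum_{i=2}^dp^{i-1}\Big)+p^{s-1}+\sum_{i=d+1}^{s-1}p^{i-1}+dp^{s-1},$$ $$f_2(s)=\tfrac p{1-q}+\sum_{i=2}^sip^{i-1}+\sum_{i=s+1}^{s+d-1}ip^{s-1}+c_2Sp^{s-1}+\Big((1-q)\sum_{i=d+1}^{2d}i+d\Big)\tfrac{p^{s-1}}q,$$ $$g_2(s)=\tfrac p{1-q}+\sum_{i=2}^sp^{i-1}+(d-1)p^{s-1}+c_2dp^{s-1}+\big(d(1-q)+1\big)\tfrac{p^{s-1}}q,$$ $$f_3(s)=(1-p^{s-d})\Big(\tfrac p{1-q}+\sum_{i=2}^{d-1}ip^{i-1}\Big)+\sum_{i=d}^sip^{i-1}+\tfrac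 a{b'}p^{s-1}S+\sum_{i=s+1}^{s+d-1}ip^{s-1},$$ $$g_3(s)=(1-p^{s-d})\Big(\tfrac p{1-q}+\sum_{i=2}^{d-1}p^{i-1}\Big)+\sum_{i=d}^sp^{i-1}+\tfrac a{b'}p^{s-1}d+(d-1)p^{s-1},$$ $$f_4(s)=(1-p^{s-d})\sum_{i=1}^di+c_4(s)S+\sum_{i=s+1}^{s+d-1}ip^{s-d}+\sum_{i=d}^sip^{i-d},$$ $$g_4(s)=(1-p^{s-d})d+c_4(s)d+(d-1)p^{s-d}+\sum_{i=d}^sp^{i-d}.$$ With $e=d\big(p-\tfrac{(1-p)(d-1)}2\big)$ and $\kappa=(1-p)p^{-d}(bp+(1-q)a)$, put $$l_1=\kappa\Big(\tfrac p{1-q}+\sum_{i=2}^dip^{i-1}\Big)+e-d(1-p),\qquad o_1=\kappa\Big(\tfrac p{1-q}+\sum_{i=2}^dp^{i-1}\Big)+p-(1-p)d,$$ $$l_2=-c_2(1-p)S-\Big((1-q)\sum_{i=d+1}^{2d}i+d\Big)\tfrac{1-p}q+e,\qquad o_2=p-(1-p)\tfrac{d(1-q)+1}q-(1-p)(d-1+dc_2),$$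 $$l_3=\tfrac{1-p}{p^{d-1}}\Big(\tfrac p{1-q}+\sum_{i=2}^{d-1}ip^{i-1}\Big)-(1-p)\tfrac a{b'}S+e,$$ $$o_3=\tfrac{1-p}{p^{d-1}}\Big(\tfrac p{1-q}+\sum_{i=2}^{d-1}p^{i-1}\Big)+p-(1-p)\big(d-1+\tfrac{da}{b'}\big),$$ $$l_4=(1-p)\sum_{i=1}^di-(1-p)\tfrac{a-a'}{b'}S+e,\qquad o_4=(1-p)d-(1-p)\tfrac{a-a'}{b'}d+p-(1-p)(d-1).$$ Let $x_i(\beta)=\Big\lceil\frac{-(l_i-\beta o_i)}{1-d(1-p)}\Big\rceil$, $s_1(\beta)=\max\{x_1(\beta),d+1\}$, $s_2(\beta)=\max\{\min\{x_2(\beta),d\},2\}$, $s_i(\beta)=\max\{x_i(\beta),d\}$ for $i=3,4$, and $h_i(\beta)=f_i(s_i(\beta))-\beta g_i(s_i(\beta))$. **Theorem.** Let $0<p,q<1$ and $d\ge2$. For every initial state $(\Delta(0),l_1(-1),l_2(0))\in\{1,2,\dots\}\times\{0,1\}\times\{0,\dots,d-1\}$ the following holds. (a) If $(p,q,d)\in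 B_1$, then $\mu(\delta,0,0)=\mu(\delta,1,0)=1$ for all $\delta\ge1$ is an optimal policy, and $\bar\Delta_{\rm opt}=\bar\Delta$. (b) If $(p,q,d)\in B_2$, then for $i=1,2$ the function $h_i$ has a unique root $\beta_i$ in $[0,\infty)$, and it is found by bisection: starting from $[0,L]$ with any $L\ge\beta_i$ and repeatedly replacing the interval by its left half if $h_i<0$ at the midpoint and by its right half otherwise, the interval after $n$ steps contains $\beta_i$ and has length $L/2^n$. Moreover $$\bar\Delta_{\rm opt}=\min\Big\{\beta_1,\beta_2,\frac{f_0}{g_0},\frac32d-\frac12\Big\},$$ and the policy $\mu(\delta,0,0)=1$ if $\delta<\lambda_0$, $=2$ if $\delta\ge\lambda_0$; $\mu(\delta,1,0)=2$ if $\delta<\lambda_1$, $=1$ if $\delta\ge\lambda_1$, is optimal in each of the following cases: $\bar\Delta_{\rm opt}=\beta_1$, $\lambda_0=s_1(\beta_1)$, $\lambda_1=1$; $\bar\Delta_{\rm opt}=\beta_2$, $\lambda_0=s_2(\beta_2)$, $\lambda_1=1$; $\bar\Delta_{\rm opt}=f_0/g_0$, $\lambda_0=1$, any $\lambda_1\in\{2,\dots,d\}$;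 $\bar\Delta_{\rm opt}=\frac32d-\frac12$, $\lambda_0=1$, any $\lambda_1\ge d+1$. (c) If $(p,q,d)\in B_3$, then for $i=1,2,3,4$ the function $h_i$ has a unique root $\beta_i$ in $[0,\infty)$, found by bisection as in (b). Moreover $$\bar\Delta_{\rm opt}=\min\Big\{\beta_1,\beta_2,\beta_3,\beta_4,\frac32d-\frac12\Big\},$$ and the policy $\mu(\delta,l,0)=1$ if $\delta<\lambda_l$, $=2$ if $\delta\ge\lambda_l$ ($l=0,1$) is optimal in each of the following cases: $\bar\Delta_{\rm opt}=\beta_i$, $\lambda_0=s_i(\beta_i)$, any $\lambda_1\ge d+1$ ($i=1,2$); $\bar\Delta_{\rm opt}=\beta_3$, $\lambda_0=s_3(\beta_3)$, any $\lambda_1\in\{2,\dots,d\}$; $\bar\Delta_{\rm opt}=\beta_4$, $\lambda_0=s_4(\beta_4)$, $\lambda_1=1$; $\bar\Delta_{\rm opt}=\frac32d-\frac12$, $\lambda_0=1$, any $\lambda_1\in\{1,\dots,d\}$. (d) If $(p,q,d)\in B_4$, then $\bar\Delta_{\rm opt}=\min\{\bar\Delta,f_0'/g_0'\}$. If $\bar\Delta_{\rm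 opt}=\bar\Delta$, the policy $\mu(\delta,0,0)=\mu(\delta,1,0)=1$ for all $\delta\ge 1$ is optimal; if $\bar\Delta_{\rm opt}=f_0'/g_0'$, the policy $\mu(\delta,0,0)=1$, $\mu(\delta,1,0)=2$ for all $\delta\ge 1$ is optimal. -/

import Mathlib

namespace HybridAoI

/-! ### The scheduling model -/

/-- Scheduling decisions: send a fresh packet on Channel 1, on Channel 2, or send nothing. -/
inductive Action where
  | ch1
  | ch2
  | none
  deriving DecidableEq

/-- System state at the beginning of slot `t`: the age `Δ(t)`, the ON/OFF state `l₁(t-1)` of Channel 1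
in the previous slot (`true` = ON), and the remaining transmission time `l₂(t)` of Channel 2
(`0` = idle). -/
structure State where
  age : ℕ
  l1 : Bool
  l2 : ℕ

/-- The state space `{1,2,…} × {0,1} × {0,…,d-1}`. -/
def State.Valid (d : ℕ) (s : State) : Prop :=
  1 ≤ s.age ∧ s.l2 < d

/-- The state at the beginning of the next slot, when the decision is `u` and the state of Channel 1
during the current slot is `x`. -/
def next (d : ℕ) (s : State) (u : Action) (x : Bool) : State where
  age := if u = Action.ch1 ∧ x = true then 1 else if s.l2 = 1 then d else s.age + 1
  l1 := x
  l2 := if s.l2 = 0 then (if u = Action.ch2 then d - 1 else 0) else s.l2 - 1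

/-- A scheduling policy: the decision is a function of the past states (most recent first) and of the
current state, that is, of all the information available at the scheduler. -/
abbrev Policy := List State → State → Action

/-- Nothing may be sent while Channel 2 is busy. -/
def Admissible (π : Policy) : Prop :=
  ∀ (past : List State) (s : State), 1 ≤ s.l2 → π past s = Action.none

/-- The past states and the current state that result from the initial state `s₀` when the
successive states of Channel 1 are those in the list. -/
def run (d : ℕ) (π : Policy) (s₀ : State) (w : List Bool) : List State × State :=
  w.foldl (fun h x => (h.2 :: h.1, next d h.2 (π h.1 h.2) x)) ([], s₀)

noncomputable section

/-- Transition probabilities of Channel 1. -/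
def chanProb (p q : ℝ) : Bool → Bool → ℝ
  | true, true => q
  | true, false => 1 - q
  | false, true => 1 - p
  | false, false => p

/-- Probability that Channel 1 goes successively through the states in the list, given that it was
in state `l` in the slot before. -/
def pathProb (p q : ℝ) : Bool → List Bool → ℝ
  | _, [] => 1
  | l, x :: w => chanProb p q l x * pathProb p q x w

/-- `𝔼[Δ_π(t)]`: the age in slot `t` is a function of the states of Channel 1 in the
slots `0,…,t-1`. -/
def expAge (p q : ℝ) (d : ℕ) (π : Policy) (s₀ : State) (t : ℕ) : ℝ :=
  ∑ w : Fin t → Bool,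
    pathProb p q s₀.l1 (List.ofFn w) * ((run d π s₀ (List.ofFn w)).2.age : ℝ)

/-- The expected time-average age of a policy (possibly `∞`). -/
def avgAge (p q : ℝ) (d : ℕ) (s₀ : State) (π : Policy) : EReal :=
  Filter.limsup
    (fun T : ℕ => (((1 / (T : ℝ)) * ∑ t ∈ Finset.Icc 1 T, expAge p q d π s₀ t : ℝ) : EReal))
    Filter.atTop

/-- The optimal objective value: the infimum over all admissible policies. -/
def optAge (p q : ℝ) (d : ℕ) (s₀ : State) : EReal :=
  ⨅ (π : Policy) (_ : Admissible π), avgAge p q d s₀ π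

def IsOptimal (p q : ℝ) (d : ℕ) (s₀ : State) (π : Policy) : Prop :=
  Admissible π ∧ avgAge p q d s₀ π = optAge p q d s₀

/-- The stationary policy that applies `μ₀ δ` in the states `(δ,0,0)` and `μ₁ δ` in the
states `(δ,1,0)`. -/
def stationary (μ₀ μ₁ : ℕ → Action) : Policy := fun _ s =>
  if s.l2 = 0 then (if s.l1 = true then μ₁ s.age else μ₀ s.age) else Action.none

/-- Channel 1 below the threshold, Channel 2 from the threshold on. -/
def nondecr (thr : ℕ) : ℕ → Action := fun δ => if δ < thr then Action.ch1 else Action.ch2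

/-- Channel 2 below the threshold, Channel 1 from the threshold on. -/
def nonincr (thr : ℕ) : ℕ → Action := fun δ => if δ < thr then Action.ch2 else Action.ch1

/-! ### The four regions of channel parameters -/

def F (p : ℝ) (d : ℕ) : ℝ := 1 / (1 - p) - d
def G (q : ℝ) (d : ℕ) : ℝ := 1 - d * q
def H (p q : ℝ) (d : ℕ) : ℝ := (1 - q) / (1 - p) - d + 1

def B₁ : Set (ℝ × ℝ × ℕ) := {x | F x.1 x.2.2 ≤ 0 ∧ H x.1 x.2.1 x.2.2 ≤ 0}
def B₂ : Set (ℝ × ℝ × ℕ) := {x | 0 < F x.1 x.2.2 ∧ G x.2.1 x.2.2 ≤ 0}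
def B₃ : Set (ℝ × ℝ × ℕ) := {x | 0 < F x.1 x.2.2 ∧ 0 < G x.2.1 x.2.2}
def B₄ : Set (ℝ × ℝ × ℕ) := {x | F x.1 x.2.2 ≤ 0 ∧ 0 < H x.1 x.2.1 x.2.2}

/-! ### The closed-form expressions -/

/-- `d`-step transition matrix of Channel 1; the first index is ON, the second is OFF. -/
def stepMatrix (p q : ℝ) (d : ℕ) : Matrix (Fin 2) (Fin 2) ℝ := !![q, 1 - q; 1 - p, p] ^ d

def a' (p q : ℝ) (d : ℕ) : ℝ := stepMatrix p q d 0 0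
def b' (p q : ℝ) (d : ℕ) : ℝ := stepMatrix p q d 0 1
def a (p q : ℝ) (d : ℕ) : ℝ := stepMatrix p q d 1 0
def b (p q : ℝ) (d : ℕ) : ℝ := stepMatrix p q d 1 1

/-- Average age of always using Channel 1. -/
def barAge (p q : ℝ) : ℝ :=
  ((1 - q) * (2 - p) + (1 - p) ^ 2) / ((2 - q - p) * (1 - p))

def f₀ (p q : ℝ) (d : ℕ) : ℝ :=
  q * ∑ i ∈ Finset.Icc 1 d, (i : ℝ) + (1 - q) * ∑ i ∈ Finset.Icc (d + 1) (2 * d), (i : ℝ)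
    + (b' p q d * q + b p q d * (1 - q)) / a p q d * ∑ i ∈ Finset.Ico d (2 * d), (i : ℝ) + d

def g₀ (p q : ℝ) (d : ℕ) : ℝ :=
  (b' p q d * q + b p q d * (1 - q)) / a p q d * d + d + 1

def f₀' (p q : ℝ) (d : ℕ) : ℝ :=
  ∑ i ∈ Finset.Icc 1 d, (i : ℝ) + a' p q d / b' p q d * ∑ i ∈ Finset.Ico d (2 * d), (i : ℝ)
    + ∑' k : ℕ, ((d + k : ℕ) : ℝ) * p ^ k

def g₀' (p q : ℝ) (d : ℕ) : ℝ := d / b' p q d + 1 / (1 - p)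

/-! The functions `f₁, g₁` are used for `s ≥ d + 1`, the functions `f₂, g₂` for `2 ≤ s ≤ d`, and
`f₃, g₃, f₄, g₄` for `s ≥ d`; in these ranges no exponent below is a truncated difference. -/

def c₁ (p q : ℝ) (d s : ℕ) : ℝ :=
  1 - b p q d * p ^ (s - d) - (1 - q) * a p q d * p ^ (s - d - 1)

def f₁ (p q : ℝ) (d s : ℕ) : ℝ :=
  c₁ p q d s * (p / (1 - q) + ∑ i ∈ Finset.Icc 2 d, (i : ℝ) * p ^ (i - 1))
    + d * p ^ (s - 1) + ∑ i ∈ Finset.Ico (d + 1) s, (i : ℝ) * p ^ (i - 1)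
    + ∑ i ∈ Finset.Ico s (s + d), (i : ℝ) * p ^ (s - 1)

def g₁ (p q : ℝ) (d s : ℕ) : ℝ :=
  c₁ p q d s * (p / (1 - q) + ∑ i ∈ Finset.Icc 2 d, p ^ (i - 1))
    + p ^ (s - 1) + ∑ i ∈ Finset.Ico (d + 1) s, p ^ (i - 1) + d * p ^ (s - 1)

def l₁ (p q : ℝ) (d : ℕ) : ℝ :=
  (1 - p) * (b p q d * p + (1 - q) * a p q d) / p ^ d
      * (p / (1 - q) + ∑ i ∈ Finset.Icc 2 d, (i : ℝ) * p ^ (i - 1))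
    + d * (2 * p - 1 - (1 - p) * (d - 1) / 2)

def o₁ (p q : ℝ) (d : ℕ) : ℝ :=
  (1 - p) * (b p q d * p + (1 - q) * a p q d) / p ^ d
      * (p / (1 - q) + ∑ i ∈ Finset.Icc 2 d, p ^ (i - 1))
    + p - (1 - p) * d

def c₂ (p q : ℝ) (d : ℕ) : ℝ := b p q d / (a p q d * q)

def f₂ (p q : ℝ) (d s : ℕ) : ℝ :=
  (p / (1 - q) + ∑ i ∈ Finset.Icc 2 s, (i : ℝ) * p ^ (i - 1))
    + ∑ i ∈ Finset.Ico (s + 1) (s + d), (i : ℝ) * p ^ (s - 1)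
    + c₂ p q d * ∑ i ∈ Finset.Ico d (2 * d), (i : ℝ) * p ^ (s - 1)
    + (∑ i ∈ Finset.Icc (d + 1) (2 * d), (1 - q) * (i : ℝ) + d) * p ^ (s - 1) / q

def g₂ (p q : ℝ) (d s : ℕ) : ℝ :=
  (p / (1 - q) + ∑ i ∈ Finset.Icc 2 s, p ^ (i - 1)) + (d - 1) * p ^ (s - 1)
    + c₂ p q d * d * p ^ (s - 1) + (d * (1 - q) + 1) * p ^ (s - 1) / q

def l₂ (p q : ℝ) (d : ℕ) : ℝ :=
  -(c₂ p q d * (1 - p) * ∑ i ∈ Finset.Ico d (2 * d), (i : ℝ))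
    - (∑ i ∈ Finset.Icc (d + 1) (2 * d), (1 - q) * (i : ℝ) + d) * (1 - p) / q
    + d * (p - (1 - p) * (d - 1) / 2)

def o₂ (p q : ℝ) (d : ℕ) : ℝ :=
  p - (1 - p) * (d * (1 - q) + 1) / q - (1 - p) * (d - 1 + d * c₂ p q d)

def f₃ (p q : ℝ) (d s : ℕ) : ℝ :=
  (1 - p ^ (s - d)) * (p / (1 - q) + ∑ i ∈ Finset.Ico 2 d, (i : ℝ) * p ^ (i - 1))
    + ∑ i ∈ Finset.Icc d s, (i : ℝ) * p ^ (i - 1)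
    + a p q d / b' p q d * p ^ (s - 1) * ∑ i ∈ Finset.Ico d (2 * d), (i : ℝ)
    + ∑ i ∈ Finset.Ico (s + 1) (s + d), (i : ℝ) * p ^ (s - 1)

def g₃ (p q : ℝ) (d s : ℕ) : ℝ :=
  (1 - p ^ (s - d)) * (p / (1 - q) + ∑ i ∈ Finset.Ico 2 d, p ^ (i - 1))
    + ∑ i ∈ Finset.Icc d s, p ^ (i - 1)
    + a p q d / b' p q d * p ^ (s - 1) * d + (d - 1) * p ^ (s - 1)

def l₃ (p q : ℝ) (d : ℕ) : ℝ :=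
  (1 - p) / p ^ (d - 1) * (p / (1 - q) + ∑ i ∈ Finset.Ico 2 d, (i : ℝ) * p ^ (i - 1))
    - (1 - p) * (a p q d / b' p q d) * ∑ i ∈ Finset.Ico d (2 * d), (i : ℝ)
    + d * (p - (1 - p) * (d - 1) / 2)

def o₃ (p q : ℝ) (d : ℕ) : ℝ :=
  (1 - p) / p ^ (d - 1) * (p / (1 - q) + ∑ i ∈ Finset.Ico 2 d, p ^ (i - 1))
    + p - (1 - p) * (d - 1 + d * (a p q d / b' p q d))

def c₄ (p q : ℝ) (d s : ℕ) : ℝ :=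
  (a' p q d + (a p q d - a' p q d) * p ^ (s - d)) / b' p q d

def f₄ (p q : ℝ) (d s : ℕ) : ℝ :=
  (1 - p ^ (s - d)) * ∑ i ∈ Finset.Icc 1 d, (i : ℝ)
    + c₄ p q d s * ∑ i ∈ Finset.Ico d (2 * d), (i : ℝ)
    + ∑ i ∈ Finset.Ico (s + 1) (s + d), (i : ℝ) * p ^ (s - d)
    + ∑ i ∈ Finset.Icc d s, (i : ℝ) * p ^ (i - d)

def g₄ (p q : ℝ) (d s : ℕ) : ℝ :=
  (1 - p ^ (s - d)) * d + c₄ p q d s * d + (d - 1) * p ^ (s - d)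
    + ∑ i ∈ Finset.Icc d s, p ^ (i - d)

def l₄ (p q : ℝ) (d : ℕ) : ℝ :=
  (1 - p) * ∑ i ∈ Finset.Icc 1 d, (i : ℝ)
    - (1 - p) * ((a p q d - a' p q d) / b' p q d) * ∑ i ∈ Finset.Ico d (2 * d), (i : ℝ)
    + d * (p - (1 - p) * (d - 1) / 2)

def o₄ (p q : ℝ) (d : ℕ) : ℝ :=
  (1 - p) * d - (1 - p) * ((a p q d - a' p q d) / b' p q d) * d + p - (1 - p) * (d - 1)

/-- `⌈-k(β) / (1 - d(1-p))⌉` with `k(β) = l - β o`. -/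
def crossing (p : ℝ) (d : ℕ) (l o β : ℝ) : ℤ :=
  ⌈-(l - β * o) / (1 - d * (1 - p))⌉

def s₁ (p q : ℝ) (d : ℕ) (β : ℝ) : ℕ :=
  (max (crossing p d (l₁ p q d) (o₁ p q d) β) (d + 1)).toNat

def s₂ (p q : ℝ) (d : ℕ) (β : ℝ) : ℕ :=
  (max (min (crossing p d (l₂ p q d) (o₂ p q d) β) d) 2).toNat

def s₃ (p q : ℝ) (d : ℕ) (β : ℝ) : ℕ :=
  (max (crossing p d (l₃ p q d) (o₃ p q d) β) d).toNat

def s₄ (p q : ℝ) (d : ℕ) (β : ℝ) : ℕ :=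
  (max (crossing p d (l₄ p q d) (o₄ p q d) β) d).toNat

def h₁ (p q : ℝ) (d : ℕ) (β : ℝ) : ℝ := f₁ p q d (s₁ p q d β) - β * g₁ p q d (s₁ p q d β)
def h₂ (p q : ℝ) (d : ℕ) (β : ℝ) : ℝ := f₂ p q d (s₂ p q d β) - β * g₂ p q d (s₂ p q d β)
def h₃ (p q : ℝ) (d : ℕ) (β : ℝ) : ℝ := f₃ p q d (s₃ p q d β) - β * g₃ p q d (s₃ p q d β)
def h₄ (p q : ℝ) (d : ℕ) (β : ℝ) : ℝ := f₄ p q d (s₄ p q d β) - β * g₄ p q d (s₄ p q d β)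

/-! ### Roots and bisection -/

/-- The interval `[l, l']` after `n` steps of bisection started from `[0, L]`. -/
def bisect (h : ℝ → ℝ) (L : ℝ) : ℕ → ℝ × ℝ
  | 0 => (0, L)
  | n + 1 =>
    if h (((bisect h L n).1 + (bisect h L n).2) / 2) < 0 then
      ((bisect h L n).1, ((bisect h L n).1 + (bisect h L n).2) / 2)
    else
      (((bisect h L n).1 + (bisect h L n).2) / 2, (bisect h L n).2)

/-- `β` is the only root of `h` in `[0, ∞)`. -/
def IsTheRoot (h : ℝ → ℝ) (β : ℝ) : Prop :=
  0 ≤ β ∧ h β = 0 ∧ ∀ x : ℝ, 0 ≤ x → h x = 0 → x = β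

/-- Bisection with a large enough right end `L` brackets `β`, the bracket being halved in each step. -/
def FoundByBisection (h : ℝ → ℝ) (β : ℝ) : Prop :=
  ∀ L : ℝ, β ≤ L → ∀ n : ℕ,
    (bisect h L n).1 ≤ β ∧ β ≤ (bisect h L n).2 ∧
      (bisect h L n).2 - (bisect h L n).1 = L / 2 ^ n

end

end HybridAoI

open HybridAoI

namespace HybridAoI

noncomputable section

/-! ### Expectations along a controlled trajectory -/

/-! The proof is a verification argument. If a potential `V` satisfies `V s ≤ age - β + E V(next)`
for every allowed decision, then no admissible policy has average age below `β`
(`le_avgAge_of_subsolution`). The reverse inequality along one policy bounds its average by `β`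
(`avgAge_le_of_supersolution`). In the lower bound `V` may grow linearly in the age: an average
below `β` would force the expected age itself to grow linearly, which is absurd. It remains to
produce matching potentials.

While Channel 2 is busy nothing is decided, so there `V` is determined by the two values `x`, `y`
found at delivery, in the states `(d,0,0)` and `(d,1,0)`. Normalize the value of `(1,1,0)` to zero.
A success on Channel 1 leads to that state, a failure to an older OFF state. An OFF state thus poses
a stopping problem, how many attempts to make before turning to Channel 2 (`waitCost`, `offVal`),
and an ON state a choice between two numbers (`onVal`). What is left is a fixed-point system for
`(β, x, y)`.

This system is solved by compactness, not by computation. The triples with all inequalities in the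
subsolution direction form a compact convex set. Take one with maximal `β` and then maximal `x + y`.
Monotonicity in `x`, `y` turns the inequalities at age `d` into equalities. Slack at `(1,1,0)` could
be traded for a larger `β` by mixing in the triple of the always-Channel-2 policy, unless `β`
already equals that policy's average `3d/2 - 1/2`. This is `exists_optimality_solution`.

The solution is then matched with a threshold policy. Eliminating `x`, `y` from the evaluation
equations of such a policy shows that `f - β g` is the value of `(1,1,0)` up to an explicit factor
(the `value_f` lemmas). Only the decisions in `(1,1,0)`, `(d,1,0)` and the OFF states matter, which
is why several thresholds in the statement are arbitrary. For `F > 0` the gain from one more attempt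
changes sign once, so the OFF decision is a threshold, and the sign of `G` decides which ON
decisions can occur together (`optimality_cases_of_G_pos`, `optimality_cases_of_G_nonpos`). For `F ≤
0` every relevant OFF state uses Channel 1 (`offVal_eq_tryCost`), and the sign of `H` decides the ON
decisions.

Finally, for `F > 0` the sequence `s ↦ f s - β g s` is unimodal and the rounded threshold is its
minimizer. So each `h` is a minimum of decreasing affine functions of `β`. It is concave and
strictly decreasing, and its only root is at most the root belonging to any fixed threshold. -/

theorem run_concat (d : ℕ) (π : Policy) (s₀ : State) (w : List Bool) (x : Bool) :
    run d π s₀ (w ++ [x]) =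
      ((run d π s₀ w).2 :: (run d π s₀ w).1,
        next d (run d π s₀ w).2 (π (run d π s₀ w).1 (run d π s₀ w).2) x) := by
  simp [run, List.foldl_append]

theorem State.Valid.next {d : ℕ} (hd : 2 ≤ d) {s : State} (hs : s.Valid d) (u : Action)
    (x : Bool) : (HybridAoI.next d s u x).Valid d := by
  obtain ⟨h1, h2⟩ := hs
  constructor
  · simp only [HybridAoI.next]
    split_ifs <;> omega
  · simp only [HybridAoI.next]
    split_ifs <;> omega

theorem run_valid {d : ℕ} (hd : 2 ≤ d) (π : Policy) {s₀ : State} (hs₀ : s₀.Valid d)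
    (w : List Bool) : (run d π s₀ w).2.Valid d := by
  induction w using List.reverseRecOn with
  | nil => simpa [run] using hs₀
  | append_singleton w x ih =>
    rw [run_concat]
    exact ih.next hd _ _

/-- `pathProb` consumes the list from the front while `run` extends it at the back. The two fit
together because the `l1` component of the current state records the last channel state. -/
theorem pathProb_concat (p q : ℝ) (d : ℕ) (π : Policy) (s₀ : State) (w : List Bool) (x : Bool) :
    pathProb p q s₀.l1 (w ++ [x]) =
      pathProb p q s₀.l1 w * chanProb p q (run d π s₀ w).2.l1 x := by
  have key : ∀ (w : List Bool) (l : Bool), pathProb p q l (w ++ [x]) =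
      pathProb p q l w * chanProb p q (w.getLastD l) x := by
    intro w
    induction w with
    | nil => intro l; simp [pathProb]
    | cons y w ih =>
      intro l
      simp only [List.cons_append, pathProb, ih, List.getLastD_cons, mul_assoc]
  have hl : ∀ w : List Bool, (run d π s₀ w).2.l1 = w.getLastD s₀.l1 := by
    intro w
    induction w using List.reverseRecOn with
    | nil => simp [run]
    | append_singleton w x ih => rw [run_concat]; simp [next]
  rw [key, hl]

theorem chanProb_nonneg {p q : ℝ} (hp : 0 < p) (hp1 : p < 1) (hq : 0 < q) (hq1 : q < 1)
    (l x : Bool) : 0 ≤ chanProb p q l x := by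
  cases l <;> cases x <;> simp only [chanProb] <;> linarith

theorem pathProb_nonneg {p q : ℝ} (hp : 0 < p) (hp1 : p < 1) (hq : 0 < q) (hq1 : q < 1)
    (w : List Bool) : ∀ l : Bool, 0 ≤ pathProb p q l w := by
  induction w with
  | nil => intro l; simp [pathProb]
  | cons x w ih => intro l; exact mul_nonneg (chanProb_nonneg hp hp1 hq hq1 l x) (ih x)

/-- Expectation, in slot `t`, of a function of the past states and the current state. -/
def expect (p q : ℝ) (d : ℕ) (π : Policy) (s₀ : State) (t : ℕ)
    (f : List State × State → ℝ) : ℝ :=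
  ∑ w : Fin t → Bool, pathProb p q s₀.l1 (List.ofFn w) * f (run d π s₀ (List.ofFn w))

/-- One-step transition of a function of the current state. -/
def stepMean (p q : ℝ) (d : ℕ) (V : State → ℝ) (s : State) (u : Action) : ℝ :=
  chanProb p q s.l1 true * V (next d s u true) + chanProb p q s.l1 false * V (next d s u false)

/-! ### Verification by sub- and supersolutions. -/

section Expect

variable {p q : ℝ} {d : ℕ} {π : Policy} {s₀ : State}

/-- Conditioning on all but the last channel state: the decision in slot `t` depends only on the
first `t` of them, so averaging over the last one gives `stepMean`. -/
theorem expect_succ (t : ℕ) (V : State → ℝ) :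
    expect p q d π s₀ (t + 1) (fun h => V h.2) =
      expect p q d π s₀ t (fun h => stepMean p q d V h.2 (π h.1 h.2)) := by
  unfold expect
  rw [← (Fin.snocEquiv (fun _ : Fin (t + 1) => Bool)).sum_comp, Fintype.sum_prod_type_right]
  refine Finset.sum_congr rfl fun w _ => ?_
  have hof : ∀ x : Bool, List.ofFn (Fin.snocEquiv (fun _ : Fin (t + 1) => Bool) (x, w)) =
      List.ofFn w ++ [x] := by
    intro x
    rw [List.ofFn_succ', List.concat_eq_append]
    simp [Fin.snocEquiv]
  simp only [hof, Fintype.sum_bool, pathProb_concat p q d π, run_concat, stepMean]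
  ring

theorem expect_add (t : ℕ) (f g : List State × State → ℝ) :
    expect p q d π s₀ t (fun h => f h + g h) =
      expect p q d π s₀ t f + expect p q d π s₀ t g := by
  simp [expect, mul_add, Finset.sum_add_distrib]

theorem expect_const_mul (t : ℕ) (c : ℝ) (f : List State × State → ℝ) :
    expect p q d π s₀ t (fun h => c * f h) = c * expect p q d π s₀ t f := by
  simp only [expect, Finset.mul_sum]
  exact Finset.sum_congr rfl fun w _ => by ring

theorem expect_const (t : ℕ) (c : ℝ) : expect p q d π s₀ t (fun _ => c) = c := by
  induction t with
  | zero => simp [expect, pathProb]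
  | succ t ih =>
    have := expect_succ (p := p) (q := q) (d := d) (π := π) (s₀ := s₀) t (fun _ => c)
    rw [this]
    have hs : ∀ (s : State) (u : Action), stepMean p q d (fun _ => c) s u = c := by
      intro s u
      unfold stepMean
      cases s.l1 <;> simp only [chanProb] <;> ring
    simpa only [hs] using ih

theorem expect_mono (hp : 0 < p) (hp1 : p < 1) (hq : 0 < q) (hq1 : q < 1) (hd : 2 ≤ d)
    (hs₀ : s₀.Valid d) (t : ℕ) {f g : List State × State → ℝ}
    (hfg : ∀ h : List State × State, h.2.Valid d → f h ≤ g h) :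
    expect p q d π s₀ t f ≤ expect p q d π s₀ t g :=
  Finset.sum_le_sum fun _ _ => mul_le_mul_of_nonneg_left
    (hfg _ (run_valid hd π hs₀ _)) (pathProb_nonneg hp hp1 hq hq1 _ _)

theorem expAge_eq_expect (t : ℕ) :
    expAge p q d π s₀ t = expect p q d π s₀ t (fun h => (h.2.age : ℝ)) := rfl

/-- A function that satisfies the optimality inequality along the policy bounds the accumulated
age from below. -/
theorem sum_expAge_ge (hp : 0 < p) (hp1 : p < 1) (hq : 0 < q) (hq1 : q < 1) (hd : 2 ≤ d)
    (hs₀ : s₀.Valid d) (hπ : Admissible π) {β : ℝ} {V : State → ℝ}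
    (hV : ∀ s : State, s.Valid d → ∀ u : Action, (1 ≤ s.l2 → u = Action.none) →
      V s ≤ s.age - β + stepMean p q d V s u) (T : ℕ) :
    expect p q d π s₀ 1 (fun h => V h.2) + T * β ≤
      ∑ t ∈ Finset.Icc 1 T, expAge p q d π s₀ t + expect p q d π s₀ (T + 1) (fun h => V h.2) := by
  induction T with
  | zero => simp
  | succ T ih =>
    have h1 : expect p q d π s₀ (T + 1) (fun h => V h.2) ≤
        expAge p q d π s₀ (T + 1) - β + expect p q d π s₀ (T + 1 + 1) (fun h => V h.2) := by
      rw [expect_succ (T + 1) V, expAge_eq_expect]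
      have := expect_mono (π := π) hp hp1 hq hq1 hd hs₀ (T + 1)
        (f := fun h => V h.2)
        (g := fun h => (((h.2.age : ℝ)) + -β) + stepMean p q d V h.2 (π h.1 h.2))
        (fun h hh => by
          have := hV h.2 hh (π h.1 h.2) (fun hl => hπ h.1 h.2 hl)
          linarith)
      rw [expect_add, expect_add, expect_const] at this
      linarith
    rw [Finset.sum_Icc_succ_top (by omega)]
    push_cast
    linarith

/-- The telescoping of `sum_expAge_ge` with reversed signs. The inequality is needed only for the
decisions the policy actually takes. -/
theorem sum_expAge_le (hp : 0 < p) (hp1 : p < 1) (hq : 0 < q) (hq1 : q < 1) (hd : 2 ≤ d)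
    (hs₀ : s₀.Valid d) {β : ℝ} {V : State → ℝ}
    (hV : ∀ (past : List State) (s : State), s.Valid d →
      s.age - β + stepMean p q d V s (π past s) ≤ V s) (T : ℕ) :
    ∑ t ∈ Finset.Icc 1 T, expAge p q d π s₀ t + expect p q d π s₀ (T + 1) (fun h => V h.2) ≤
      expect p q d π s₀ 1 (fun h => V h.2) + T * β := by
  induction T with
  | zero => simp
  | succ T ih =>
    have h1 : expAge p q d π s₀ (T + 1) - β + expect p q d π s₀ (T + 1 + 1) (fun h => V h.2) ≤
        expect p q d π s₀ (T + 1) (fun h => V h.2) := by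
      rw [expect_succ (T + 1) V, expAge_eq_expect]
      have := expect_mono (π := π) hp hp1 hq hq1 hd hs₀ (T + 1)
        (g := fun h => V h.2)
        (f := fun h => (((h.2.age : ℝ)) + -β) + stepMean p q d V h.2 (π h.1 h.2))
        (fun h hh => by
          have := hV h.1 h.2 hh
          linarith)
      rw [expect_add, expect_add, expect_const] at this
      linarith
    rw [Finset.sum_Icc_succ_top (by omega)]
    push_cast
    linarith

theorem expAge_nonneg (hp : 0 < p) (hp1 : p < 1) (hq : 0 < q) (hq1 : q < 1) (t : ℕ) :
    0 ≤ expAge p q d π s₀ t :=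
  Finset.sum_nonneg fun _ _ => mul_nonneg (pathProb_nonneg hp hp1 hq hq1 _ _) (Nat.cast_nonneg _)

/-- Verification of an upper bound for the average age of a policy. -/
theorem avgAge_le_of_supersolution (hp : 0 < p) (hp1 : p < 1) (hq : 0 < q) (hq1 : q < 1)
    (hd : 2 ≤ d) (hs₀ : s₀.Valid d) {β C : ℝ} {V : State → ℝ}
    (hV : ∀ (past : List State) (s : State), s.Valid d →
      s.age - β + stepMean p q d V s (π past s) ≤ V s)
    (hC : ∀ s : State, s.Valid d → -C ≤ V s) : avgAge p q d s₀ π ≤ ((β : ℝ) : EReal) := by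
  set v := expect p q d π s₀ 1 (fun h => V h.2) with hv
  have hlim : Filter.Tendsto (fun T : ℕ => ((β + (v + C) * (1 / (T : ℝ)) : ℝ) : EReal))
      Filter.atTop (nhds ((β : ℝ) : EReal)) := by
    refine (continuous_coe_real_ereal.tendsto _).comp ?_
    have := (tendsto_one_div_atTop_nhds_zero_nat (𝕜 := ℝ)).const_mul (v + C)
    simpa using this.const_add β
  unfold avgAge
  rw [← hlim.limsup_eq]
  refine Filter.limsup_le_limsup ?_
  filter_upwards [Filter.eventually_ge_atTop 1] with T hT
  rw [EReal.coe_le_coe_iff]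
  have hT' : (0 : ℝ) < T := by exact_mod_cast hT
  have h1 := sum_expAge_le (π := π) hp hp1 hq hq1 hd hs₀ hV T
  have h2 := expect_mono (π := π) hp hp1 hq hq1 hd hs₀ (T + 1) (f := fun _ => -C)
    (g := fun h => V h.2) (fun h hh => hC h.2 hh)
  rw [expect_const] at h2
  have h3 : ∑ t ∈ Finset.Icc 1 T, expAge p q d π s₀ t ≤ v + C + T * β := by linarith
  calc (1 / (T : ℝ)) * ∑ t ∈ Finset.Icc 1 T, expAge p q d π s₀ t
      ≤ (1 / (T : ℝ)) * (v + C + T * β) := by gcongr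
    _ = β + (v + C) * (1 / (T : ℝ)) := by field_simp; ring

/-- Verification of a lower bound for the average age of all admissible policies. -/
theorem le_avgAge_of_subsolution (hp : 0 < p) (hp1 : p < 1) (hq : 0 < q) (hq1 : q < 1)
    (hd : 2 ≤ d) (hs₀ : s₀.Valid d) (hπ : Admissible π) {β C : ℝ} {V : State → ℝ}
    (hV : ∀ s : State, s.Valid d → ∀ u : Action, (1 ≤ s.l2 → u = Action.none) →
      V s ≤ s.age - β + stepMean p q d V s u)
    (hC0 : 0 < C) (hC : ∀ s : State, s.Valid d → V s ≤ C * (s.age + 1)) :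
    ((β : ℝ) : EReal) ≤ avgAge p q d s₀ π := by
  by_contra hlt
  rw [not_le] at hlt
  obtain ⟨β', h1, h2⟩ := EReal.lt_iff_exists_real_btwn.mp hlt
  rw [EReal.coe_lt_coe_iff] at h2
  have hev := Filter.eventually_lt_of_limsup_lt h1
  obtain ⟨T₀, hT₀⟩ := Filter.eventually_atTop.mp hev
  set A : ℕ → ℝ := fun T => ∑ t ∈ Finset.Icc 1 T, expAge p q d π s₀ t with hA
  set v := expect p q d π s₀ 1 (fun h => V h.2) with hv
  have hub : ∀ T, T₀ ≤ T → 1 ≤ T → A T ≤ T * β' := by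
    intro T hT hT1
    have := hT₀ T hT
    rw [EReal.coe_lt_coe_iff] at this
    have hT' : (0 : ℝ) < T := by exact_mod_cast hT1
    rw [one_div, inv_mul_lt_iff₀ hT'] at this
    exact this.le
  -- The telescoped deficit `T (β - β')` must be absorbed by the final potential, which is at most
  -- `C (age + 1)`. Hence the expected age grows linearly.
  have hage : ∀ T, T₀ ≤ T → 1 ≤ T → (v + T * (β - β')) / C - 1 ≤ expAge p q d π s₀ (T + 1) := by
    intro T hT hT1
    have h3 := sum_expAge_ge (π := π) hp hp1 hq hq1 hd hs₀ hπ hV T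
    have h4 := expect_mono (π := π) hp hp1 hq hq1 hd hs₀ (T + 1) (f := fun h => V h.2)
      (g := fun h => C * ((h.2.age : ℝ) + 1)) (fun h hh => hC h.2 hh)
    rw [expect_const_mul, expect_add, expect_const, ← expAge_eq_expect] at h4
    have h5 := hub T hT hT1
    have : v + T * (β - β') ≤ C * (expAge p q d π s₀ (T + 1) + 1) := by
      simp only [hA] at h5; linarith
    rw [sub_le_iff_le_add, div_le_iff₀ hC0]
    linarith
  -- the age of the second half alone exceeds the bound on the total
  obtain ⟨N, hN⟩ := exists_nat_gt ((C * (2 * β' + 1) + |v|) / (β - β'))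
  set T := max (max N T₀) 1 with hTdef
  have hT1 : 1 ≤ T := le_max_right _ _
  have hTT : T₀ ≤ T := (le_max_right _ _).trans (le_max_left _ _)
  have hTN : (N : ℝ) ≤ T := by exact_mod_cast (le_max_left _ _).trans (le_max_left _ _)
  have hlow : ∀ t ∈ Finset.Ico (T + 1) (2 * T + 1), 2 * β' < expAge p q d π s₀ t := by
    intro t ht
    rw [Finset.mem_Ico] at ht
    obtain ⟨m, rfl⟩ : ∃ m, t = m + 1 := ⟨t - 1, by omega⟩
    refine lt_of_lt_of_le ?_ (hage m (by omega) (by omega))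
    rw [lt_sub_iff_add_lt, lt_div_iff₀ hC0]
    have h6 : (C * (2 * β' + 1) + |v|) < (β - β') * m := by
      have : (T : ℝ) ≤ m := by exact_mod_cast (by omega : T ≤ m)
      have h7 := hN.trans_le (hTN.trans this)
      rw [div_lt_iff₀ (by linarith)] at h7
      linarith
    have := neg_abs_le v
    nlinarith
  have hsplit : A (2 * T) = A T + ∑ t ∈ Finset.Ico (T + 1) (2 * T + 1), expAge p q d π s₀ t := by
    simp only [hA, ← Finset.Ico_add_one_right_eq_Icc]
    rw [Finset.sum_Ico_consecutive _ (by omega) (by omega)]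
  have hnn : 0 ≤ A T := Finset.sum_nonneg fun t _ => expAge_nonneg hp hp1 hq hq1 t
  have hsum : (T : ℝ) * (2 * β') < ∑ t ∈ Finset.Ico (T + 1) (2 * T + 1), expAge p q d π s₀ t := by
    have := Finset.sum_lt_sum_of_nonempty (s := Finset.Ico (T + 1) (2 * T + 1))
      (by simp; omega) hlow
    rw [Finset.sum_const, Nat.card_Ico, nsmul_eq_mul] at this
    have hc : ((2 * T + 1 - (T + 1) : ℕ) : ℝ) = T := by
      congr 1; omega
    rwa [hc] at this
  have := hub (2 * T) (by omega) (by omega)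
  push_cast at this
  linarith

end Expect

/-! ### The problem embedded at the slots where Channel 2 is idle

`x`, `y` stand for the relative values of the states `(d,0,0)`, `(d,1,0)`, and the relative value of
`(1,1,0)` is normalized to `0`. -/

/-- `1 + ρ + ⋯ + ρ^(k-1)`, where `ρ = p + q - 1` is the second eigenvalue of Channel 1. -/
def geo (p q : ℝ) (k : ℕ) : ℝ := ∑ i ∈ Finset.range k, (p + q - 1) ^ i

/-- Mean of a function of Channel 1 with values `y` at ON, `x` at OFF, `k` slots after state `l`. -/
def mix (p q x y : ℝ) (k : ℕ) (l : Bool) : ℝ :=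
  if l = true then y - (1 - q) * geo p q k * (y - x) else x + (1 - p) * geo p q k * (y - x)

/-- Relative cost of using Channel 1 from an OFF state of age `n` until it succeeds. -/
def tryCost (p β n : ℝ) : ℝ := (n - 1 + 1 / (1 - p) - β) / (1 - p)

/-- Relative cost of one use of Channel 2 at age `n`, with continuation value `K`. -/
def relCost (d : ℕ) (β K n : ℝ) : ℝ := d * n + d * (d - 1) / 2 - d * β + K

/-- Relative cost of at most `k` attempts on Channel 1, followed by a use of Channel 2, from an OFF
state of age `n`. -/
def waitCost (p : ℝ) (d : ℕ) (β K : ℝ) (k : ℕ) (n : ℝ) : ℝ :=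
  tryCost p β n + p ^ k * (relCost d β K (n + k) - tryCost p β (n + k))

theorem geo_succ (p q : ℝ) (k : ℕ) : geo p q (k + 1) = 1 + (p + q - 1) * geo p q k := by
  rw [geo, geo, geom_sum_succ]; ring

theorem geo_mul (p q : ℝ) (k : ℕ) : geo p q k * (2 - p - q) = 1 - (p + q - 1) ^ k := by
  have := geom_sum_mul (p + q - 1) k
  rw [geo]; linarith

theorem mix_zero (p q x y : ℝ) (l : Bool) : mix p q x y 0 l = if l = true then y else x := by
  simp [mix, geo]

/-- First-step analysis of Channel 1. Together with `mix_zero` it identifies the expression in `geo`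
as a `k`-step mean. -/
theorem mix_succ (p q x y : ℝ) (k : ℕ) (l : Bool) :
    mix p q x y (k + 1) l =
      chanProb p q l true * mix p q x y k true + chanProb p q l false * mix p q x y k false := by
  cases l <;> simp [mix, chanProb, geo_succ] <;> ring

/-- Only the failure branch appears, because a success leads to the state of value `0`. -/
theorem tryCost_step {p : ℝ} (hp1 : p < 1) (β n : ℝ) :
    tryCost p β n = n - β + p * tryCost p β (n + 1) := by
  have : 1 - p ≠ 0 := by linarith
  unfold tryCost
  field_simp
  ring

theorem waitCost_zero (p : ℝ) (d : ℕ) (β K n : ℝ) :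
    waitCost p d β K 0 n = relCost d β K n := by
  simp [waitCost]

theorem waitCost_succ {p : ℝ} (hp1 : p < 1) (d : ℕ) (β K : ℝ) (k : ℕ) (n : ℝ) :
    waitCost p d β K (k + 1) n = n - β + p * waitCost p d β K k (n + 1) := by
  unfold waitCost
  rw [tryCost_step hp1 β n]
  push_cast
  rw [show n + 1 + (k : ℝ) = n + ((k : ℝ) + 1) by ring]
  ring

/-- The candidate value function with values `V₀`, `V₁` in the idle states. -/
def idleExt (p q β x y : ℝ) (V₀ V₁ : ℕ → ℝ) (s : State) : ℝ :=
  if s.l2 = 0 then (if s.l1 = true then V₁ s.age else V₀ s.age)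
  else s.l2 * s.age + s.l2 * (s.l2 - 1) / 2 - s.l2 * β + mix p q x y s.l2 s.l1

/-! ### Lifting potentials from the idle states to all states. -/

section

variable {p q β x y : ℝ} {d : ℕ} {V₀ V₁ : ℕ → ℝ}

theorem stepMean_idle_ch1 (n : ℕ) (l : Bool) :
    stepMean p q d (idleExt p q β x y V₀ V₁) ⟨n, l, 0⟩ Action.ch1 =
      chanProb p q l true * V₁ 1 + chanProb p q l false * V₀ (n + 1) := by
  simp [stepMean, next, idleExt]

theorem stepMean_idle_none (n : ℕ) (l : Bool) :
    stepMean p q d (idleExt p q β x y V₀ V₁) ⟨n, l, 0⟩ Action.none =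
      chanProb p q l true * V₁ (n + 1) + chanProb p q l false * V₀ (n + 1) := by
  simp [stepMean, next, idleExt]

theorem chanProb_true_add_false (p q : ℝ) (l : Bool) :
    chanProb p q l true + chanProb p q l false = 1 := by
  cases l <;> simp [chanProb]

/-- The ages `n, …, n + d - 1` are paid during the transmission, after which the delivery value is
averaged over `d` steps of Channel 1. -/
theorem idle_ch2_eq (hd : 2 ≤ d) (n : ℕ) (l : Bool) :
    n - β + stepMean p q d (idleExt p q β x y V₀ V₁) ⟨n, l, 0⟩ Action.ch2 =
      relCost d β (mix p q x y d l) n := by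
  obtain ⟨k, rfl⟩ : ∃ k, d = k + 2 := ⟨d - 2, by omega⟩
  have h1 := mix_succ p q x y (k + 1) l
  have h2 := chanProb_true_add_false p q l
  simp only [stepMean, next, idleExt, relCost, if_true, if_false, reduceCtorEq, false_and,
    Nat.add_eq_zero_iff, and_false, show (0 : ℕ) ≠ 1 by omega,
    show k + 2 - 1 = k + 1 by omega, one_ne_zero]
  rw [show k + 2 = k + 1 + 1 by ring, h1]
  push_cast
  linear_combination (((k : ℝ) + 1) * (n + 1) + (k + 1) * (k + 1 - 1) / 2 - (k + 1) * β) * h2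

/-- The busy values solve the Bellman equation exactly. The only defect arises at delivery, where
the true idle values replace `x` and `y`. -/
theorem busy_eq {n k : ℕ} (l : Bool) (hk : 1 ≤ k) (u : Action) (hu : u = Action.none) :
    n - β + stepMean p q d (idleExt p q β x y V₀ V₁) ⟨n, l, k⟩ u =
      idleExt p q β x y V₀ V₁ ⟨n, l, k⟩ + if k = 1 then
        chanProb p q l true * (V₁ d - y) + chanProb p q l false * (V₀ d - x) else 0 := by
  subst hu
  have h2 := chanProb_true_add_false p q l
  rcases Nat.lt_or_ge k 2 with h | h
  · obtain rfl : k = 1 := by omega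
    have h1 := mix_succ p q x y 0 l
    simp only [mix_zero, if_true, Bool.false_eq_true, if_false] at h1
    simp [stepMean, next, idleExt, h1]
    ring
  · obtain ⟨m, rfl⟩ : ∃ m, k = m + 2 := ⟨k - 2, by omega⟩
    have h1 := mix_succ p q x y (m + 1) l
    simp only [stepMean, next, idleExt, if_false, reduceCtorEq, false_and,
      Nat.add_eq_zero_iff, and_false,
      show m + 2 - 1 = m + 1 by omega, show m + 2 ≠ 1 by omega, one_ne_zero,
      show (2 : ℕ) ≠ 0 by omega]
    rw [show m + 2 = m + 1 + 1 by ring, h1]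
    push_cast
    linear_combination (((m : ℝ) + 1) * (n + 1) + (m + 1) * (m + 1 - 1) / 2 - (m + 1) * β) * h2

/-- Lower bound for all admissible policies from a subsolution of the embedded problem. -/
theorem le_optAge_of_embedded (hp : 0 < p) (hp1 : p < 1) (hq : 0 < q) (hq1 : q < 1)
    (hd : 2 ≤ d) {s₀ : State} (hs₀ : s₀.Valid d)
    (h0 : ∀ n : ℕ, 1 ≤ n → V₀ n ≤ n - β + p * V₀ (n + 1))
    (h0' : ∀ n : ℕ, 1 ≤ n → V₀ n ≤ relCost d β (mix p q x y d false) n)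
    (h1 : ∀ n : ℕ, 1 ≤ n → V₁ n ≤ n - β + (1 - q) * V₀ (n + 1))
    (h1' : ∀ n : ℕ, 1 ≤ n → V₁ n ≤ relCost d β (mix p q x y d true) n)
    (hz : 0 ≤ V₁ 1) (hmono : ∀ n : ℕ, 1 ≤ n → V₁ 1 ≤ V₁ n)
    (hx : x ≤ V₀ d) (hy : y ≤ V₁ d) :
    ((β : ℝ) : EReal) ≤ optAge p q d s₀ := by
  refine le_iInf₂ fun π hπ => ?_
  set M := |x| + |y| + ∑ k ∈ Finset.range (d + 1), (|mix p q x y k true| + |mix p q x y k false|)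
    with hM
  have hmixle : ∀ k ≤ d, ∀ l, mix p q x y k l ≤ M := by
    intro k hk l
    have h2 : |mix p q x y k true| + |mix p q x y k false| ≤
        ∑ k ∈ Finset.range (d + 1), (|mix p q x y k true| + |mix p q x y k false|) :=
      Finset.single_le_sum (f := fun k => |mix p q x y k true| + |mix p q x y k false|)
        (fun i _ => by positivity) (Finset.mem_range.mpr (by omega))
    have h3 := abs_nonneg x
    have h4 := abs_nonneg y
    have h5 := le_abs_self (mix p q x y k l)
    have h6 := abs_nonneg (mix p q x y k true)
    have h7 := abs_nonneg (mix p q x y k false)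
    cases l <;> linarith
  have hM0 : 0 ≤ M := by positivity
  have hd0 : (2 : ℝ) ≤ d := by exact_mod_cast hd
  refine le_avgAge_of_subsolution hp hp1 hq hq1 hd hs₀ hπ (β := β)
    (C := d + d * d + d * |β| + M) (V := idleExt p q β x y V₀ V₁) ?_ (by positivity) ?_
  · rintro ⟨n, l, k⟩ ⟨hn, hk⟩ u hu
    simp only at hn hk hu
    rcases Nat.eq_zero_or_pos k with rfl | hk0
    · have hVn1 := hmono (n + 1) (by omega)
      cases u with
      | ch1 =>
        rw [stepMean_idle_ch1]
        cases l
        · have := h0 n hn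
          simp only [idleExt, chanProb, if_true, Bool.false_eq_true, if_false]
          nlinarith
        · have := h1 n hn
          simp only [idleExt, chanProb, if_true]
          nlinarith
      | ch2 =>
        rw [idle_ch2_eq hd]
        cases l
        · simpa [idleExt] using h0' n hn
        · simpa [idleExt] using h1' n hn
      -- Idling is dominated by Channel 1: in the ON branch it leads to `V₁ (n + 1) ≥ V₁ 1`, and
      -- otherwise the two actions agree.
      | none =>
        rw [stepMean_idle_none]
        cases l
        · have := h0 n hn
          simp only [idleExt, chanProb, if_true, Bool.false_eq_true, if_false]
          nlinarith
        · have := h1 n hn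
          simp only [idleExt, chanProb, if_true]
          nlinarith
    · rw [busy_eq l hk0 u (hu hk0)]
      have c1 := chanProb_nonneg hp hp1 hq hq1 l true
      have c2 := chanProb_nonneg hp hp1 hq hq1 l false
      split_ifs
      · have := mul_nonneg c1 (sub_nonneg.mpr hy)
        have := mul_nonneg c2 (sub_nonneg.mpr hx)
        linarith
      · linarith
  · rintro ⟨n, l, k⟩ ⟨hn, hk⟩
    simp only at hn hk
    have hn' : (1 : ℝ) ≤ n := by exact_mod_cast hn
    have hb := neg_abs_le β
    have hb0 := abs_nonneg β
    rcases Nat.eq_zero_or_pos k with rfl | hk0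
    -- The Channel 2 inequality alone gives the linear growth bound, since `relCost` is affine in
    -- the age.
    · have key : relCost d β (mix p q x y d l) n ≤ (d + d * d + d * |β| + M) * (n + 1) := by
        have := hmixle d le_rfl l
        unfold relCost
        nlinarith [mul_nonneg (mul_nonneg (by positivity : (0:ℝ) ≤ d) hb0) (by positivity : (0:ℝ) ≤ n),
          mul_nonneg hM0 (by positivity : (0:ℝ) ≤ n),
          mul_nonneg (by positivity : (0:ℝ) ≤ d * d) (by positivity : (0:ℝ) ≤ n),
          mul_nonneg (by linarith : (0:ℝ) ≤ d) (by linarith : 0 ≤ β + |β|)]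
      cases l
      · simpa [idleExt] using (h0' n hn).trans key
      · simpa [idleExt] using (h1' n hn).trans key
    · have := hmixle k hk.le l
      have hk' : (k : ℝ) ≤ d := by exact_mod_cast hk.le
      have hk1 : (1 : ℝ) ≤ k := by exact_mod_cast hk0
      simp only [idleExt, hk0.ne', if_false]
      have e1 : (k : ℝ) * n ≤ d * n := by gcongr
      have e2 : (k : ℝ) * (k - 1) / 2 ≤ d * d := by nlinarith
      have e3 : -(k * β) ≤ d * |β| := by
        have : (k : ℝ) * (-β) ≤ k * |β| := by gcongr; exact neg_le_abs β
        have : (k : ℝ) * |β| ≤ d * |β| := by gcongr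
        linarith
      nlinarith [mul_nonneg (mul_nonneg (by positivity : (0:ℝ) ≤ d) hb0) (by positivity : (0:ℝ) ≤ n),
          mul_nonneg hM0 (by positivity : (0:ℝ) ≤ n),
          mul_nonneg (by positivity : (0:ℝ) ≤ d * d) (by positivity : (0:ℝ) ≤ n)]

theorem admissible_stationary (μ₀ μ₁ : ℕ → Action) : Admissible (stationary μ₀ μ₁) := by
  intro past s hs
  simp [stationary, Nat.one_le_iff_ne_zero.mp hs]

/-- Upper bound for a stationary policy from a supersolution of the embedded problem. -/
theorem avgAge_stationary_le (hp : 0 < p) (hp1 : p < 1) (hq : 0 < q) (hq1 : q < 1)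
    (hd : 2 ≤ d) {s₀ : State} (hs₀ : s₀.Valid d) {μ₀ μ₁ : ℕ → Action}
    (h0 : ∀ n : ℕ, 1 ≤ n → μ₀ n = Action.ch1 ∧ n - β + p * V₀ (n + 1) ≤ V₀ n ∨
      μ₀ n = Action.ch2 ∧ relCost d β (mix p q x y d false) n ≤ V₀ n)
    (h1 : ∀ n : ℕ, 1 ≤ n → μ₁ n = Action.ch1 ∧ n - β + (1 - q) * V₀ (n + 1) ≤ V₁ n ∨
      μ₁ n = Action.ch2 ∧ relCost d β (mix p q x y d true) n ≤ V₁ n)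
    (hz : V₁ 1 ≤ 0) (hx : V₀ d ≤ x) (hy : V₁ d ≤ y) {C : ℝ}
    (hC0 : ∀ n : ℕ, -C ≤ V₀ n) (hC1 : ∀ n : ℕ, -C ≤ V₁ n) :
    avgAge p q d s₀ (stationary μ₀ μ₁) ≤ ((β : ℝ) : EReal) := by
  set M := |C| + ∑ k ∈ Finset.range (d + 1), (|mix p q x y k true| + |mix p q x y k false|)
    with hM
  have hmixle : ∀ k ≤ d, ∀ l, -M ≤ mix p q x y k l := by
    intro k hk l
    have h2 : |mix p q x y k true| + |mix p q x y k false| ≤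
        ∑ k ∈ Finset.range (d + 1), (|mix p q x y k true| + |mix p q x y k false|) :=
      Finset.single_le_sum (f := fun k => |mix p q x y k true| + |mix p q x y k false|)
        (fun i _ => by positivity) (Finset.mem_range.mpr (by omega))
    have h3 := abs_nonneg C
    have h5 := neg_abs_le (mix p q x y k l)
    have h6 := abs_nonneg (mix p q x y k true)
    have h7 := abs_nonneg (mix p q x y k false)
    cases l <;> linarith
  have hCM : C ≤ M := (le_abs_self C).trans (le_add_of_nonneg_right
    (Finset.sum_nonneg fun i _ => by positivity))
  refine avgAge_le_of_supersolution hp hp1 hq hq1 hd hs₀ (C := d * |β| + M)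
    (V := idleExt p q β x y V₀ V₁) ?_ ?_
  · rintro past ⟨n, l, k⟩ ⟨hn, hk⟩
    simp only at hn hk
    rcases Nat.eq_zero_or_pos k with rfl | hk0
    · cases l
      · rcases h0 n hn with ⟨hu, h⟩ | ⟨hu, h⟩
        · simp only [stationary, if_true, Bool.false_eq_true, if_false, hu]
          rw [stepMean_idle_ch1]
          simp only [idleExt, chanProb, if_true, Bool.false_eq_true, if_false]
          nlinarith
        · simp only [stationary, if_true, Bool.false_eq_true, if_false, hu]
          rw [idle_ch2_eq hd]
          simpa [idleExt] using h
      · rcases h1 n hn with ⟨hu, h⟩ | ⟨hu, h⟩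
        · simp only [stationary, if_true, hu]
          rw [stepMean_idle_ch1]
          simp only [idleExt, chanProb, if_true]
          nlinarith
        · simp only [stationary, if_true, hu]
          rw [idle_ch2_eq hd]
          simpa [idleExt] using h
    · rw [busy_eq l hk0 _ (admissible_stationary μ₀ μ₁ past ⟨n, l, k⟩ hk0)]
      have c1 := chanProb_nonneg hp hp1 hq hq1 l true
      have c2 := chanProb_nonneg hp hp1 hq hq1 l false
      split_ifs
      · have := mul_nonneg c1 (sub_nonneg.mpr hy)
        have := mul_nonneg c2 (sub_nonneg.mpr hx)
        linarith
      · linarith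
  · rintro ⟨n, l, k⟩ ⟨hn, hk⟩
    simp only at hn hk
    have hdb : 0 ≤ (d : ℝ) * |β| := by positivity
    rcases Nat.eq_zero_or_pos k with rfl | hk0
    · cases l
      · simp only [idleExt, if_true, Bool.false_eq_true, if_false]
        linarith [hC0 n]
      · simp only [idleExt, if_true]
        linarith [hC1 n]
    · have := hmixle k hk.le l
      have hk' : (k : ℝ) ≤ d := by exact_mod_cast hk.le
      have hk1 : (1 : ℝ) ≤ k := by exact_mod_cast hk0
      have hn' : (1 : ℝ) ≤ n := by exact_mod_cast hn
      simp only [idleExt, hk0.ne', if_false]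
      have e1 : 0 ≤ (k : ℝ) * n := by positivity
      have e2 : 0 ≤ (k : ℝ) * (k - 1) / 2 := by
        have : 0 ≤ (k : ℝ) - 1 := by linarith
        positivity
      have e3 : k * β ≤ d * |β| := by
        have : (k : ℝ) * β ≤ k * |β| := by gcongr; exact le_abs_self β
        have : (k : ℝ) * |β| ≤ d * |β| := by gcongr
        linarith
      linarith

end

/-! ### Channel 1 coefficients -/

section Coefficients

variable {p q : ℝ}

theorem abs_eig_lt_one (hp : 0 < p) (hp1 : p < 1) (hq : 0 < q) (hq1 : q < 1) :
    |p + q - 1| < 1 := by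
  rw [abs_lt]; constructor <;> linarith

theorem geo_pos (hp : 0 < p) (hp1 : p < 1) (hq : 0 < q) (hq1 : q < 1) {k : ℕ} (hk : k ≠ 0) :
    0 < geo p q k := by
  have h1 : |(p + q - 1) ^ k| < 1 := by
    rw [abs_pow]; exact pow_lt_one₀ (abs_nonneg _) (abs_eig_lt_one hp hp1 hq hq1) hk
  have h2 := geo_mul p q k
  have h3 := (abs_lt.mp h1).2
  by_contra h
  nlinarith

/-- These are the off-diagonal entries of the `k`-step matrix, `(1 - q)(1 - ρ^k)/(1 - ρ)` and its
mirror image, with `ρ = p + q - 1`. For `ρ ≥ 0` the power is nonnegative, for `ρ < 0` it is at least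
`ρ`; both bounds suffice. -/
theorem on_off_coeff_lt_one (hp : 0 < p) (hp1 : p < 1) (hq : 0 < q) (hq1 : q < 1) {k : ℕ}
    (hk : k ≠ 0) : (1 - q) * geo p q k < 1 ∧ (1 - p) * geo p q k < 1 := by
  have h1 : |(p + q - 1) ^ k| ≤ |p + q - 1| := by
    rw [abs_pow]; exact pow_le_of_le_one (abs_nonneg _) (abs_eig_lt_one hp hp1 hq hq1).le hk
  have h2 := geo_mul p q k
  have h3 := (abs_le.mp h1).1
  set g := geo p q k
  have h4 : (1 - q) * (1 - (p + q - 1) ^ k) < 2 - p - q ∧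
      (1 - p) * (1 - (p + q - 1) ^ k) < 2 - p - q := by
    rcases abs_cases (p + q - 1) with ⟨h, h'⟩ | ⟨h, h'⟩ <;> rw [h] at h3
    · have : (p + q - 1) ^ k ≥ 0 := pow_nonneg h' k
      constructor <;> nlinarith
    · constructor <;> nlinarith
  rw [← h2] at h4
  constructor <;> nlinarith [h4.1, h4.2]

end Coefficients

/-! ### Costs of waiting -/

section WaitCost

variable {p β K : ℝ} {d : ℕ}

/-- Each of the `k` terms of `1 + p + ⋯ + p^(k-1)` is at least `p^k`. This makes `waitCost` bounded
below uniformly in `k`, so that its infimum is meaningful. -/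
theorem pow_mul_le {p : ℝ} (hp : 0 < p) (hp1 : p < 1) (k : ℕ) :
    p ^ k * k * (1 - p) ≤ 1 - p ^ k := by
  induction k with
  | zero => simp
  | succ k ih =>
    have h1 : (0 : ℝ) < p ^ k := by positivity
    have h2 : 0 ≤ (k : ℝ) * p ^ k * ((1 - p) * (1 - p)) := by
      have : 0 ≤ 1 - p := by linarith
      positivity
    have h3 : 0 ≤ p ^ k * ((1 - p) * (1 - p)) := by
      have : 0 ≤ 1 - p := by linarith
      positivity
    rw [pow_succ]; push_cast
    nlinarith

theorem waitCost_eq (hp1 : p < 1) (k : ℕ) (n : ℝ) :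
    waitCost p d β K k n = (1 - p ^ k) * tryCost p β n +
      p ^ k * (relCost d β K n + k * (d - 1 / (1 - p))) := by
  have : 1 - p ≠ 0 := by linarith
  unfold waitCost tryCost relCost
  field_simp
  ring

theorem le_waitCost (hp : 0 < p) (hp1 : p < 1) (k : ℕ) (n : ℝ) :
    (1 - p ^ k) * (tryCost p β n - (1 / (1 - p)) ^ 2) + p ^ k * relCost d β K n ≤
      waitCost p d β K k n := by
  rw [waitCost_eq hp1]
  have h1 := pow_mul_le hp hp1 k
  have hr : 0 < 1 - p := by linarith
  have h2 : p ^ k * k * (1 / (1 - p)) ≤ (1 - p ^ k) * (1 / (1 - p)) ^ 2 := by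
    have : p ^ k * k * (1 / (1 - p)) = p ^ k * k * (1 - p) * (1 / (1 - p)) ^ 2 := by
      field_simp
    rw [this]; gcongr
  have h3 : 0 ≤ p ^ k * (k * (d : ℝ)) := by positivity
  nlinarith

theorem one_sub_pow_mem (hp : 0 < p) (hp1 : p < 1) (k : ℕ) :
    0 ≤ 1 - p ^ k ∧ 1 - p ^ k ≤ 1 :=
  ⟨sub_nonneg.mpr (pow_le_one₀ hp.le hp1.le), by linarith [pow_pos hp k]⟩

theorem waitCost_lower (hp : 0 < p) (hp1 : p < 1) (k : ℕ) (n : ℝ) :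
    -(|tryCost p β n - (1 / (1 - p)) ^ 2| + |relCost d β K n|) ≤ waitCost p d β K k n := by
  refine le_trans ?_ (le_waitCost hp hp1 k n)
  obtain ⟨h1, h2⟩ := one_sub_pow_mem hp hp1 k
  have h3 : 0 < p ^ k := pow_pos hp k
  have h4 := neg_abs_le (tryCost p β n - (1 / (1 - p)) ^ 2)
  have h5 := neg_abs_le (relCost d β K n)
  have h6 := abs_nonneg (tryCost p β n - (1 / (1 - p)) ^ 2)
  have h7 := abs_nonneg (relCost d β K n)
  have h8 : (1 - p ^ k) * (-|tryCost p β n - (1 / (1 - p)) ^ 2|) ≤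
    (1 - p ^ k) * (tryCost p β n - (1 / (1 - p)) ^ 2) := by gcongr
  have h9 : p ^ k * (-|relCost d β K n|) ≤ p ^ k * relCost d β K n := by gcongr
  nlinarith

/-- The slope in the age is a convex combination of `1 / (1 - p)`, the slope of trying for ever, and
`d`, the slope of Channel 2. The sign of `F` tells which is larger. -/
theorem waitCost_add (hp1 : p < 1) (k : ℕ) (n m : ℝ) :
    waitCost p d β K k (n + m) = waitCost p d β K k n +
      m * ((1 - p ^ k) * (1 / (1 - p)) + p ^ k * d) := by
  have : 1 - p ≠ 0 := by linarith
  unfold waitCost tryCost relCost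
  field_simp
  ring

theorem tendsto_waitCost (hp : 0 < p) (hp1 : p < 1) (n : ℝ) :
    Filter.Tendsto (fun k => waitCost p d β K k n) Filter.atTop (nhds (tryCost p β n)) := by
  have h1 : Filter.Tendsto (fun k : ℕ => p ^ k) Filter.atTop (nhds 0) :=
    tendsto_pow_atTop_nhds_zero_of_lt_one hp.le hp1
  have h2 : Filter.Tendsto (fun k : ℕ => (k : ℝ) * p ^ k) Filter.atTop (nhds 0) :=
    tendsto_self_mul_const_pow_of_lt_one hp.le hp1
  have h3 := (((h1.const_sub 1).mul_const (tryCost p β n)).add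
    ((h1.mul_const (relCost d β K n)).add (h2.mul_const ((d : ℝ) - 1 / (1 - p)))))
  simp only [sub_zero, one_mul, zero_mul, add_zero] at h3
  refine h3.congr fun k => ?_
  rw [waitCost_eq hp1]; ring

theorem waitCost_mono (hp : 0 < p) {K' : ℝ} (h : K ≤ K') (k : ℕ) (n : ℝ) :
    waitCost p d β K k n ≤ waitCost p d β K' k n := by
  unfold waitCost relCost
  have : 0 < p ^ k := pow_pos hp k
  nlinarith

end WaitCost

/-- Relative value of an OFF state of age `n`: the best number of attempts on Channel 1. -/
def offVal (p : ℝ) (d : ℕ) (β K n : ℝ) : ℝ := ⨅ k : ℕ, waitCost p d β K k n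

/-! ### The optimal stopping problem in the OFF states. -/

section OffVal

variable {p β K : ℝ} {d : ℕ}

theorem offVal_le (hp : 0 < p) (hp1 : p < 1) (k : ℕ) (n : ℝ) :
    offVal p d β K n ≤ waitCost p d β K k n :=
  ciInf_le ⟨_, by rintro _ ⟨k, rfl⟩; exact waitCost_lower hp hp1 k n⟩ k

theorem le_offVal {c n : ℝ} (h : ∀ k, c ≤ waitCost p d β K k n) : c ≤ offVal p d β K n :=
  le_ciInf h

theorem offVal_le_relCost (hp : 0 < p) (hp1 : p < 1) (n : ℝ) :
    offVal p d β K n ≤ relCost d β K n := by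
  simpa [waitCost_zero] using offVal_le (d := d) (β := β) (K := K) hp hp1 0 n

/-- Never giving up is the limit `k → ∞` of making `k` attempts, so it need not be listed among the
stopping rules. -/
theorem offVal_le_tryCost (hp : 0 < p) (hp1 : p < 1) (n : ℝ) :
    offVal p d β K n ≤ tryCost p β n :=
  ge_of_tendsto' (tendsto_waitCost hp hp1 n) fun k => offVal_le hp hp1 k n

theorem offVal_le_step (hp : 0 < p) (hp1 : p < 1) (n : ℝ) :
    offVal p d β K n ≤ n - β + p * offVal p d β K (n + 1) := by
  have : (offVal p d β K n - (n - β)) / p ≤ offVal p d β K (n + 1) := by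
    refine le_offVal fun k => ?_
    rw [div_le_iff₀ hp]
    have := offVal_le (d := d) (β := β) (K := K) hp hp1 (k + 1) n
    rw [waitCost_succ hp1] at this
    linarith
  rw [div_le_iff₀ hp] at this
  linarith

/-- Every stopping rule has slope at least `min (1 / (1 - p)) d`, and this passes to the infimum. It
is applied with `c = d` when `F > 0`, with `c = 1 / (1 - p)` when `F ≤ 0`, and with `c = 0` for
monotonicity. -/
theorem offVal_add_ge (hp : 0 < p) (hp1 : p < 1) {n m c : ℝ} (hm : 0 ≤ m)
    (hc : c ≤ 1 / (1 - p)) (hc' : c ≤ d) :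
    offVal p d β K n + m * c ≤ offVal p d β K (n + m) := by
  refine le_offVal fun k => ?_
  rw [waitCost_add hp1]
  have h1 := offVal_le (d := d) (β := β) (K := K) hp hp1 k n
  obtain ⟨h2, h3⟩ := one_sub_pow_mem hp hp1 k
  have h4 : 0 < p ^ k := pow_pos hp k
  have h5 : c ≤ (1 - p ^ k) * (1 / (1 - p)) + p ^ k * d := by nlinarith
  have := mul_le_mul_of_nonneg_left h5 hm
  linarith

end OffVal

/-! ### Solution of the optimality equation -/

/-- Relative value of an ON state of age `n`. -/
def onVal (p q : ℝ) (d : ℕ) (β x y n : ℝ) : ℝ :=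
  min (relCost d β (mix p q x y d true) n)
    (n - β + (1 - q) * offVal p d β (mix p q x y d false) (n + 1))

/-- `β`, `x`, `y` form a subsolution of the optimality equation. -/
structure Feasible (p q : ℝ) (d : ℕ) (β x y : ℝ) : Prop where
  one_le : 1 ≤ β
  off : ∀ k, x ≤ waitCost p d β (mix p q x y d false) k d
  on : ∀ k, y ≤ d - β + (1 - q) * waitCost p d β (mix p q x y d false) k (d + 1)
  on' : y ≤ relCost d β (mix p q x y d true) d
  start : ∀ k, 0 ≤ 1 - β + (1 - q) * waitCost p d β (mix p q x y d false) k 2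
  start' : 0 ≤ relCost d β (mix p q x y d true) 1

/-! ### The compact convex set of feasible triples and its extremal point. -/

section

variable {p q : ℝ} {d : ℕ}

theorem mix_mono (hp : 0 < p) (hp1 : p < 1) (hq : 0 < q) (hq1 : q < 1) (hd : 2 ≤ d)
    {x y x' y' : ℝ} (hx : x ≤ x') (hy : y ≤ y') (l : Bool) :
    mix p q x y d l ≤ mix p q x' y' d l := by
  obtain ⟨h1, h2⟩ := on_off_coeff_lt_one hp hp1 hq hq1 (k := d) (by omega)
  have h3 := geo_pos hp hp1 hq hq1 (k := d) (by omega)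
  have h4 : 0 < (1 - q) * geo p q d := mul_pos (by linarith) h3
  have h5 : 0 < (1 - p) * geo p q d := mul_pos (by linarith) h3
  cases l <;> simp only [mix, if_true, Bool.false_eq_true, if_false] <;> nlinarith

/-- The larger of `x`, `y` is at most the cost of one Channel 2 cycle started at age `d` plus an
average of `x` and `y`. So that cost, `d (3d/2 - 1/2 - β)`, cannot be negative. -/
theorem Feasible.le_limit (hp : 0 < p) (hp1 : p < 1) (hq : 0 < q) (hq1 : q < 1) (hd : 2 ≤ d)
    {β x y : ℝ} (h : Feasible p q d β x y) : β ≤ 3 / 2 * (d : ℝ) - 1 / 2 := by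
  have h1 := h.off 0
  have h2 := h.on'
  rw [waitCost_zero] at h1
  simp only [relCost, mix, if_true, Bool.false_eq_true, if_false] at h1 h2
  have h3 := geo_pos hp hp1 hq hq1 (k := d) (by omega)
  have h4 : 0 < (1 - q) * geo p q d := mul_pos (by linarith) h3
  have h5 : 0 < (1 - p) * geo p q d := mul_pos (by linarith) h3
  have hd' : (2 : ℝ) ≤ d := by exact_mod_cast hd
  by_contra hlt
  rw [not_le] at hlt
  have h6 : (d : ℝ) * d + d * (d - 1) / 2 - d * β < 0 := by nlinarith
  rcases le_total x y with hxy | hxy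
  · nlinarith
  · nlinarith

theorem continuous_mix {α : Type*} [TopologicalSpace α] {f g : α → ℝ} (hf : Continuous f)
    (hg : Continuous g) (k : ℕ) (l : Bool) : Continuous fun v => mix p q (f v) (g v) k l := by
  cases l <;> simp only [mix, if_true, Bool.false_eq_true, if_false] <;> fun_prop

theorem isClosed_feasible :
    IsClosed {v : ℝ × ℝ × ℝ | Feasible p q d v.1 v.2.1 v.2.2} := by
  have hK : ∀ l, Continuous fun v : ℝ × ℝ × ℝ => mix p q v.2.1 v.2.2 d l :=
    fun l => continuous_mix (by fun_prop) (by fun_prop) d l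
  have hK0 := hK false
  have hK1 := hK true
  have hW : ∀ (k : ℕ) (n : ℝ), Continuous fun v : ℝ × ℝ × ℝ =>
      waitCost p d v.1 (mix p q v.2.1 v.2.2 d false) k n := by
    intro k n
    simp only [waitCost, relCost, tryCost]
    fun_prop
  have hR : ∀ n : ℝ, Continuous fun v : ℝ × ℝ × ℝ =>
      relCost d v.1 (mix p q v.2.1 v.2.2 d true) n := by
    intro n
    simp only [relCost]
    fun_prop
  have : {v : ℝ × ℝ × ℝ | Feasible p q d v.1 v.2.1 v.2.2} =
      {v | 1 ≤ v.1} ∩ (⋂ k, {v | v.2.1 ≤ waitCost p d v.1 (mix p q v.2.1 v.2.2 d false) k d}) ∩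
      (⋂ k, {v | v.2.2 ≤ d - v.1 +
        (1 - q) * waitCost p d v.1 (mix p q v.2.1 v.2.2 d false) k (d + 1)}) ∩
      {v | v.2.2 ≤ relCost d v.1 (mix p q v.2.1 v.2.2 d true) d} ∩
      (⋂ k, {v | 0 ≤ 1 - v.1 +
        (1 - q) * waitCost p d v.1 (mix p q v.2.1 v.2.2 d false) k 2}) ∩
      {v | 0 ≤ relCost d v.1 (mix p q v.2.1 v.2.2 d true) 1} := by
    ext v
    simp only [Set.mem_inter_iff, Set.mem_iInter, Set.mem_ofPred_eq]
    constructor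
    · intro h
      exact ⟨⟨⟨⟨⟨h.1, h.2⟩, h.3⟩, h.4⟩, h.5⟩, h.6⟩
    · rintro ⟨⟨⟨⟨⟨h1, h2⟩, h3⟩, h4⟩, h5⟩, h6⟩
      exact ⟨h1, h2, h3, h4, h5, h6⟩
  rw [this]
  refine ((((IsClosed.inter ?_ ?_).inter ?_).inter ?_).inter ?_).inter ?_
  · exact isClosed_le continuous_const (by fun_prop)
  · exact isClosed_iInter fun k => isClosed_le (by fun_prop) (hW k d)
  · exact isClosed_iInter fun k => isClosed_le (by fun_prop)
      ((by fun_prop : Continuous fun v : ℝ × ℝ × ℝ => (d : ℝ) - v.1).add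
        (continuous_const.mul (hW k (d + 1))))
  · exact isClosed_le (by fun_prop) (hR d)
  · exact isClosed_iInter fun k => isClosed_le continuous_const
      ((by fun_prop : Continuous fun v : ℝ × ℝ × ℝ => 1 - v.1).add
        (continuous_const.mul (hW k 2)))
  · exact isClosed_le continuous_const (hR 1)

theorem tryCost_anti {β β' : ℝ} (hp1 : p < 1) (h : β ≤ β') (n : ℝ) :
    tryCost p β' n ≤ tryCost p β n := by
  unfold tryCost
  have : 0 < 1 - p := by linarith
  gcongr

theorem Feasible.bounded (hp : 0 < p) (hp1 : p < 1) (hq : 0 < q) (hq1 : q < 1) (hd : 2 ≤ d) :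
    ∃ R : ℝ, ∀ β x y : ℝ, Feasible p q d β x y → -R ≤ x ∧ x ≤ R ∧ -R ≤ y ∧ y ≤ R := by
  obtain ⟨h1, -⟩ := on_off_coeff_lt_one hp hp1 hq hq1 (k := d) (by omega)
  have h4 : 0 < (1 - q) * geo p q d :=
    mul_pos (by linarith) (geo_pos hp hp1 hq hq1 (k := d) (by omega))
  set g := (1 - q) * geo p q d with hg
  have hd' : (2 : ℝ) ≤ d := by exact_mod_cast hd
  set U := |tryCost p 1 d| + d + |tryCost p 1 (d + 1)| with hU
  set D : ℝ := d * (3 / 2 * (d : ℝ) - 1 / 2) with hD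
  have hU0 : 0 ≤ U := by positivity
  have hD0 : 0 ≤ D := mul_nonneg (by linarith) (by linarith)
  refine ⟨U + (D + U) / g + (D + U) / (1 - g), fun β x y h => ?_⟩
  have hβ := h.le_limit hp hp1 hq hq1 hd
  have hxU : x ≤ U := by
    have e1 : x ≤ tryCost p β d := ge_of_tendsto' (tendsto_waitCost hp hp1 _) h.off
    have e2 := tryCost_anti hp1 h.one_le d
    have := le_abs_self (tryCost p 1 d)
    have := abs_nonneg (tryCost p 1 (d + 1))
    linarith
  have hyU : y ≤ U := by
    have e1 : y ≤ d - β + (1 - q) * tryCost p β (d + 1) :=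
      ge_of_tendsto' (((tendsto_waitCost hp hp1 _).const_mul _).const_add _) h.on
    have e2 := tryCost_anti hp1 h.one_le (d + 1)
    have e3 := le_abs_self (tryCost p 1 (d + 1))
    have e4 := abs_nonneg (tryCost p 1 (d + 1))
    have e5 := abs_nonneg (tryCost p 1 d)
    have e6 : (1 - q) * tryCost p β (d + 1) ≤ (1 - q) * |tryCost p 1 (d + 1)| := by
      have : 0 ≤ 1 - q := by linarith
      gcongr; linarith
    have := h.one_le
    nlinarith
  have hlow := h.start'
  simp only [relCost, mix, if_true] at hlow
  rw [← hg] at hlow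
  have hcost : (d : ℝ) * 1 + d * (d - 1) / 2 - d * β ≤ D := by
    have := h.one_le
    nlinarith
  -- A combination of `x` and `y` with positive weights is bounded below while each is bounded above
  -- by `U`; hence each is bounded below as well.
  have hm : -D ≤ (1 - g) * y + g * x := by nlinarith
  have a1 : 0 ≤ (D + U) / g := by positivity
  have a2 : 0 ≤ (D + U) / (1 - g) := div_nonneg (by linarith) (by linarith)
  have hx : -((D + U) / g) ≤ x := by
    rw [neg_le, le_div_iff₀ h4]
    nlinarith
  have hy : -((D + U) / (1 - g)) ≤ y := by
    rw [neg_le, le_div_iff₀ (by linarith)]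
    nlinarith
  refine ⟨by linarith, by linarith, by linarith, by linarith⟩

theorem isCompact_feasible (hp : 0 < p) (hp1 : p < 1) (hq : 0 < q) (hq1 : q < 1) (hd : 2 ≤ d) :
    IsCompact {v : ℝ × ℝ × ℝ | Feasible p q d v.1 v.2.1 v.2.2} := by
  obtain ⟨R, hR⟩ := Feasible.bounded hp hp1 hq hq1 hd
  refine (isCompact_Icc (a := ((1, -R, -R) : ℝ × ℝ × ℝ))
    (b := (3 / 2 * (d : ℝ) - 1 / 2, R, R))).of_isClosed_subset isClosed_feasible ?_
  intro v hv
  obtain ⟨h1, h2, h3, h4⟩ := hR _ _ _ hv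
  exact ⟨⟨hv.one_le, h1, h3⟩, ⟨hv.le_limit hp hp1 hq hq1 hd, h2, h4⟩⟩

/-- With `β = 1` every slot has nonnegative relative cost because ages are at least one. -/
theorem feasible_one (hp : 0 < p) (hp1 : p < 1) (hq1 : q < 1) (hd : 2 ≤ d) :
    Feasible p q d 1 0 0 := by
  have hd' : (2 : ℝ) ≤ d := by exact_mod_cast hd
  have hmix : ∀ l, mix p q 0 0 d l = 0 := fun l => by simp [mix]
  have hrel : ∀ n : ℝ, 1 ≤ n → 0 ≤ relCost d 1 0 n := by
    intro n hn; unfold relCost; nlinarith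
  have hW : ∀ (k : ℕ) (n : ℝ), 1 ≤ n → 0 ≤ waitCost p d 1 0 k n := by
    intro k
    induction k with
    | zero => intro n hn; rw [waitCost_zero]; exact hrel n hn
    | succ k ih =>
      intro n hn
      rw [waitCost_succ hp1]
      have := mul_nonneg hp.le (ih (n + 1) (by linarith))
      linarith
  have hw : 0 ≤ 1 - q := by linarith
  constructor
  · exact le_rfl
  · intro k; rw [hmix]; exact hW k d (by linarith)
  · intro k; rw [hmix]
    have := mul_nonneg hw (hW k (d + 1) (by linarith))
    linarith
  · rw [hmix]; exact hrel d (by linarith)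
  · intro k; rw [hmix]
    have := mul_nonneg hw (hW k 2 (by norm_num))
    linarith
  · rw [hmix]; exact hrel 1 le_rfl

/-- Taking `offVal` and `onVal` as potentials collapses the constraints over all `k` into one
inequality each; monotonicity in the age takes care of idling. -/
theorem Feasible.le_optAge (hp : 0 < p) (hp1 : p < 1) (hq : 0 < q) (hq1 : q < 1) (hd : 2 ≤ d)
    {β x y : ℝ} (h : Feasible p q d β x y) {s₀ : State} (hs₀ : s₀.Valid d) :
    ((β : ℝ) : EReal) ≤ optAge p q d s₀ := by
  have hw : 0 ≤ 1 - q := by linarith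
  set K := mix p q x y d false with hK
  have hmul : ∀ {c n : ℝ}, (∀ k, c ≤ n - β + (1 - q) * waitCost p d β K k (n + 1)) →
      c ≤ n - β + (1 - q) * offVal p d β K (n + 1) := by
    intro c n hc
    have hw' : 0 < 1 - q := by linarith
    have : (c - (n - β)) / (1 - q) ≤ offVal p d β K (n + 1) := by
      refine le_offVal fun k => ?_
      rw [div_le_iff₀ hw']
      linarith [hc k]
    rw [div_le_iff₀ hw'] at this
    linarith
  refine le_optAge_of_embedded (β := β) (x := x) (y := y)
    (V₀ := fun n => offVal p d β K n) (V₁ := fun n => onVal p q d β x y n)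
    hp hp1 hq hq1 hd hs₀ ?_ ?_ ?_ ?_ ?_ ?_ ?_ ?_
  · intro n _
    simpa using offVal_le_step (d := d) (β := β) (K := K) hp hp1 n
  · intro n _; exact offVal_le_relCost hp hp1 n
  · intro n _
    simp only [onVal]
    push_cast
    exact min_le_right _ _
  · intro n _; exact min_le_left _ _
  · refine le_min (by simpa using h.start') ?_
    push_cast
    refine hmul fun k => ?_
    have := h.start k
    norm_num at this ⊢
    exact this
  · intro n hn
    have hn' : (1 : ℝ) ≤ n := by exact_mod_cast hn
    simp only [onVal, Nat.cast_one]
    refine min_le_min ?_ ?_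
    · unfold relCost
      have : (0 : ℝ) ≤ d := by positivity
      nlinarith
    · have e1 : offVal p d β K (1 + 1) + ((n : ℝ) - 1) * 0 ≤ offVal p d β K (1 + 1 + (n - 1)) :=
        offVal_add_ge hp hp1 (by linarith)
          (by have : 0 < 1 - p := by linarith
              positivity) (by positivity)
      rw [show (1 : ℝ) + 1 + (n - 1) = n + 1 by ring] at e1
      have := mul_le_mul_of_nonneg_left e1 hw
      linarith
  · exact le_offVal h.off
  · exact le_min h.on' (hmul h.on)

theorem mix_comb (k : ℕ) (l : Bool) (η x y x' y' : ℝ) :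
    mix p q ((1 - η) * x + η * x') ((1 - η) * y + η * y') k l =
      (1 - η) * mix p q x y k l + η * mix p q x' y' k l := by
  cases l <;> simp only [mix, if_true, Bool.false_eq_true, if_false] <;> ring

theorem relCost_comb (η β β' K K' n : ℝ) :
    relCost d ((1 - η) * β + η * β') ((1 - η) * K + η * K') n =
      (1 - η) * relCost d β K n + η * relCost d β' K' n := by
  unfold relCost; ring

/-- For a fixed number of attempts the cost is affine in `(β, K)`. This is why `Feasible` quantifies
over `k` instead of using `offVal`: the set is visibly convex. -/
theorem waitCost_comb (η β β' K K' : ℝ) (k : ℕ) (n : ℝ) :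
    waitCost p d ((1 - η) * β + η * β') ((1 - η) * K + η * K') k n =
      (1 - η) * waitCost p d β K k n + η * waitCost p d β' K' k n := by
  simp only [waitCost, relCost, tryCost]; ring

/-- Feasibility of a convex combination with the values of the policy that always uses
Channel 2. -/
theorem exists_feasible_gt (hp : 0 < p) (hp1 : p < 1) (hq : 0 < q) (hq1 : q < 1) (hd : 2 ≤ d)
    {β x y φ : ℝ} (h : Feasible p q d β x y) (hβ : β < 3 / 2 * (d : ℝ) - 1 / 2) (hφ : 0 < φ)
    (h1 : ∀ k, φ ≤ 1 - β + (1 - q) * waitCost p d β (mix p q x y d false) k 2)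
    (h2 : φ ≤ relCost d β (mix p q x y d true) 1) :
    ∃ β' x' y', β < β' ∧ Feasible p q d β' x' y' := by
  have hd' : (2 : ℝ) ≤ d := by exact_mod_cast hd
  set B : ℝ := 3 / 2 * (d : ℝ) - 1 / 2 with hB
  set E := (1 / (1 - p)) ^ 2 with hE
  -- With `x = y = -C` all mixtures equal `-C`. For `β = B` Channel 2 at age `d` is then exactly
  -- tight, and `C` is large enough for the constraints on waiting at ages `d` and `d + 1`. Only the
  -- two constraints at `(1,1,0)` may fail, by at most `M`.
  set C := |tryCost p B d - E| + |tryCost p B (d + 1) - E| + |B - d| / q with hC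
  have hC0 : 0 ≤ C := by positivity
  have hmix : ∀ l, mix p q (-C) (-C) d l = -C := by
    intro l; cases l <;> simp [mix]
  have hrel : ∀ n : ℝ, relCost d B (-C) n = d * (n - d) - C := by
    intro n; unfold relCost; rw [hB]; ring
  have g0 := abs_nonneg (tryCost p B d - E)
  have g1 := abs_nonneg (tryCost p B (d + 1) - E)
  have g2 : 0 ≤ |B - d| / q := by positivity
  have hoff : ∀ k, -C ≤ waitCost p d B (-C) k d := by
    intro k
    refine le_trans ?_ (le_waitCost hp hp1 k d)
    rw [hrel, ← hE]
    obtain ⟨e1, e2⟩ := one_sub_pow_mem hp hp1 k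
    have := neg_abs_le (tryCost p B d - E)
    have : 0 ≤ (1 - p ^ k) * (tryCost p B d - E + C) := mul_nonneg e1 (by linarith)
    nlinarith
  have hoff' : ∀ k, -C ≤ waitCost p d B (-C) k (d + 1) := by
    intro k
    refine le_trans ?_ (le_waitCost hp hp1 k _)
    rw [hrel, ← hE]
    obtain ⟨e1, e2⟩ := one_sub_pow_mem hp hp1 k
    have := neg_abs_le (tryCost p B (d + 1) - E)
    have : 0 ≤ (1 - p ^ k) * (tryCost p B (d + 1) - E + C) := mul_nonneg e1 (by linarith)
    have : 0 ≤ p ^ k * d := by positivity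
    nlinarith
  have hon : ∀ k, -C ≤ d - B + (1 - q) * waitCost p d B (-C) k (d + 1) := by
    intro k
    have e1 := mul_le_mul_of_nonneg_left (hoff' k) (by linarith : 0 ≤ 1 - q)
    have e2 : B - d ≤ q * C := by
      have : |B - d| / q ≤ C := by linarith
      rw [div_le_iff₀ hq] at this
      linarith [le_abs_self (B - d)]
    linarith
  set M := |1 - B| + (|tryCost p B 2 - E| + |relCost d B (-C) 2|) + |relCost d B (-C) 1| + 1
    with hM
  have hM0 : 0 < M := by positivity
  have hst : ∀ k, -M ≤ 1 - B + (1 - q) * waitCost p d B (-C) k 2 := by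
    intro k
    have e1 := waitCost_lower (d := d) (β := B) (K := -C) hp hp1 k 2
    rw [← hE] at e1
    have e2 := neg_abs_le (1 - B)
    have e3 := abs_nonneg (tryCost p B 2 - E)
    have e4 := abs_nonneg (relCost d B (-C) 2)
    have e5 := abs_nonneg (relCost d B (-C) 1)
    have e6 := mul_le_mul_of_nonneg_left e1 (by linarith : 0 ≤ 1 - q)
    nlinarith
  have hst' : -M ≤ relCost d B (-C) 1 := by
    have e2 := abs_nonneg (1 - B)
    have e3 := abs_nonneg (tryCost p B 2 - E)
    have e4 := abs_nonneg (relCost d B (-C) 2)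
    have e5 := neg_abs_le (relCost d B (-C) 1)
    linarith
  -- The weight that makes the gain `(1 - η) φ` pay exactly for the violation `η M`.
  set η := φ / (φ + M) with hη
  have hη0 : 0 < η := by positivity
  have hη1 : 0 < 1 - η := by
    rw [hη, sub_pos, div_lt_one (by linarith)]; linarith
  have hηM : η * M = (1 - η) * φ := by
    rw [hη]; field_simp; ring
  have comb : ∀ {u v u' v' : ℝ}, u ≤ u' → v ≤ v' →
      (1 - η) * u + η * v ≤ (1 - η) * u' + η * v' := fun h h' =>
    add_le_add (mul_le_mul_of_nonneg_left h hη1.le) (mul_le_mul_of_nonneg_left h' hη0.le)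
  refine ⟨(1 - η) * β + η * B, (1 - η) * x + η * (-C), (1 - η) * y + η * (-C),
    by nlinarith, ?_⟩
  constructor
  · have := h.one_le
    nlinarith
  · intro k
    rw [mix_comb, hmix, waitCost_comb]
    exact comb (h.off k) (hoff k)
  · intro k
    rw [mix_comb, hmix, waitCost_comb]
    refine (comb (h.on k) (hon k)).trans (le_of_eq (by ring))
  · rw [mix_comb, hmix, relCost_comb]
    exact comb h.on' (by rw [hrel]; simp)
  · intro k
    rw [mix_comb, hmix, waitCost_comb]
    refine le_trans ?_ ((comb (h1 k) (hst k)).trans (le_of_eq (by ring)))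
    nlinarith
  · rw [mix_comb, hmix, relCost_comb]
    refine le_trans ?_ (comb h2 hst')
    nlinarith

/-- The optimality equation has a solution whose `β` bounds the optimal average age from below,
unless `β` is the average age of the policy that always uses Channel 2. -/
theorem exists_optimality_solution (hp : 0 < p) (hp1 : p < 1) (hq : 0 < q) (hq1 : q < 1)
    (hd : 2 ≤ d) :
    ∃ β x y : ℝ, 1 ≤ β ∧ β ≤ 3 / 2 * (d : ℝ) - 1 / 2 ∧
      (∀ s₀ : State, s₀.Valid d → ((β : ℝ) : EReal) ≤ optAge p q d s₀) ∧
      (β < 3 / 2 * (d : ℝ) - 1 / 2 →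
        x = offVal p d β (mix p q x y d false) d ∧ y = onVal p q d β x y d ∧
          onVal p q d β x y 1 = 0) := by
  have hcpt := isCompact_feasible hp hp1 hq hq1 hd
  obtain ⟨v, hv, hvmax⟩ := hcpt.exists_isMaxOn ⟨(1, 0, 0), feasible_one hp hp1 hq1 hd⟩
    (f := fun v => v.1) (by fun_prop)
  -- Maximality of `β` alone does not force the equations at age `d`; the second maximization, of `x
  -- + y`, does.
  have hcpt' : IsCompact ({v : ℝ × ℝ × ℝ | Feasible p q d v.1 v.2.1 v.2.2} ∩ {u | u.1 = v.1}) :=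
    hcpt.inter_right (isClosed_eq (by fun_prop) (by fun_prop))
  obtain ⟨⟨β, x, y⟩, ⟨hu, hu1⟩, humax⟩ := hcpt'.exists_isMaxOn ⟨v, hv, rfl⟩
    (f := fun u => u.2.1 + u.2.2) (by fun_prop)
  simp only [Set.mem_ofPred_eq] at hu hu1
  have hmax : ∀ β' x' y', Feasible p q d β' x' y' → β' ≤ β := by
    intro β' x' y' h
    rw [hu1]
    exact hvmax (show (β', x', y') ∈ _ from h)
  have hmax' : ∀ x' y', Feasible p q d β x' y' → x' + y' ≤ x + y := by
    intro x' y' h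
    exact humax (show (β, x', y') ∈ _ from ⟨h, hu1⟩)
  have hw : 0 < 1 - q := by linarith
  have hmul : ∀ {c n K : ℝ}, (∀ k, c ≤ n - β + (1 - q) * waitCost p d β K k (n + 1)) ↔
      c ≤ n - β + (1 - q) * offVal p d β K (n + 1) := by
    intro c n K
    constructor
    · intro hc
      have : (c - (n - β)) / (1 - q) ≤ offVal p d β K (n + 1) := by
        refine le_offVal fun k => ?_
        rw [div_le_iff₀ hw]
        linarith [hc k]
      rw [div_le_iff₀ hw] at this
      linarith
    · intro hc k
      have := mul_le_mul_of_nonneg_left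
        (offVal_le (d := d) (β := β) (K := K) hp hp1 k (n + 1)) hw.le
      linarith
  -- The right-hand sides increase with `x` and `y`, so raising either one up to its own bound
  -- preserves all constraints.
  have hgrow : ∀ x' y', x ≤ x' → y ≤ y' →
      (∀ k, x' ≤ waitCost p d β (mix p q x y d false) k d) → y' ≤ onVal p q d β x y d →
      Feasible p q d β x' y' := by
    intro x' y' hx hy h1 h2
    have hK0 := mix_mono hp hp1 hq hq1 hd hx hy false
    have hK1 := mix_mono hp hp1 hq hq1 hd hx hy true
    have hW : ∀ k n, waitCost p d β (mix p q x y d false) k n ≤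
        waitCost p d β (mix p q x' y' d false) k n := fun k n => waitCost_mono hp hK0 k n
    have hR : ∀ n, relCost d β (mix p q x y d true) n ≤
        relCost d β (mix p q x' y' d true) n := fun n => by unfold relCost; linarith
    have hWq : ∀ k n, (1 - q) * waitCost p d β (mix p q x y d false) k n ≤
        (1 - q) * waitCost p d β (mix p q x' y' d false) k n := fun k n =>
      mul_le_mul_of_nonneg_left (hW k n) hw.le
    constructor
    · exact hu.one_le
    · exact fun k => (h1 k).trans (hW k d)
    · intro k
      have := hmul.mpr (h2.trans (min_le_right _ _)) k
      linarith [hWq k (d + 1)]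
    · exact (h2.trans (min_le_left _ _)).trans (hR d)
    · intro k
      linarith [hu.start k, hWq k 2]
    · exact hu.start'.trans (hR 1)
  have hx0 : x ≤ offVal p d β (mix p q x y d false) d := le_offVal hu.off
  have hy0 : y ≤ onVal p q d β x y d := le_min hu.on' (hmul.mp hu.on)
  refine ⟨β, x, y, hu.one_le, hu.le_limit hp hp1 hq hq1 hd,
    fun s₀ hs₀ => hu.le_optAge hp hp1 hq hq1 hd hs₀, fun hlt => ⟨?_, ?_, ?_⟩⟩
  · refine le_antisymm hx0 ?_
    have := hmax' _ _ (hgrow _ y hx0 le_rfl (fun k => offVal_le hp hp1 k d) hy0)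
    linarith
  · refine le_antisymm hy0 ?_
    have := hmax' _ _ (hgrow x _ le_rfl hy0 hu.off le_rfl)
    linarith
  · have hs : 0 ≤ onVal p q d β x y 1 := by
      refine le_min hu.start' (hmul.mp fun k => ?_)
      have := hu.start k
      norm_num at this ⊢
      exact this
    refine le_antisymm (not_lt.mp fun hpos => ?_) hs
    obtain ⟨β', x', y', hβ', hf⟩ := exists_feasible_gt hp hp1 hq hq1 hd hu hlt hpos
      (fun k => by
        have := hmul.mpr (min_le_right (relCost d β (mix p q x y d true) 1)
          (1 - β + (1 - q) * offVal p d β (mix p q x y d false) (1 + 1))) k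
        norm_num at this ⊢
        unfold onVal
        norm_num
        exact this) (min_le_left _ _)
    exact absurd (hmax _ _ _ hf) (not_le.mpr hβ')

end

/-! ### The closed-form expressions in terms of relative costs -/

section ClosedForms

variable {p q β : ℝ} {d : ℕ}

theorem stepMatrix_eq (p q : ℝ) (d : ℕ) :
    stepMatrix p q d = !![1 - (1 - q) * geo p q d, (1 - q) * geo p q d;
      (1 - p) * geo p q d, 1 - (1 - p) * geo p q d] := by
  induction d with
  | zero => simp [stepMatrix, geo, Matrix.one_fin_two]
  | succ d ih =>
    have : stepMatrix p q (d + 1) = !![q, 1 - q; 1 - p, p] * stepMatrix p q d := by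
      simp [stepMatrix, pow_succ']
    rw [this, ih, geo_succ, Matrix.mul_fin_two]
    congr 1
    ext i j
    fin_cases i <;> fin_cases j <;> simp <;> ring

theorem a'_eq (p q : ℝ) (d : ℕ) : a' p q d = 1 - (1 - q) * geo p q d := by
  simp [a', stepMatrix_eq]
theorem b'_eq (p q : ℝ) (d : ℕ) : b' p q d = (1 - q) * geo p q d := by
  simp [b', stepMatrix_eq]
theorem a_eq (p q : ℝ) (d : ℕ) : a p q d = (1 - p) * geo p q d := by
  simp [a, stepMatrix_eq]
theorem b_eq (p q : ℝ) (d : ℕ) : b p q d = 1 - (1 - p) * geo p q d := by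
  simp [b, stepMatrix_eq]

theorem mix_false_eq (x y : ℝ) : mix p q x y d false = b p q d * x + a p q d * y := by
  simp only [mix, a_eq, b_eq, Bool.false_eq_true, if_false]; ring

theorem mix_true_eq (x y : ℝ) : mix p q x y d true = b' p q d * x + a' p q d * y := by
  simp only [mix, a'_eq, b'_eq, if_true]; ring

theorem sum_Ico_nat_cast (m n : ℕ) :
    ∑ i ∈ Finset.Ico m (m + n), (i : ℝ) = n * m + n * (n - 1) / 2 := by
  induction n with
  | zero => simp
  | succ n ih =>
    rw [← add_assoc, Finset.sum_Ico_succ_top (by omega), ih]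
    push_cast; ring

/-- By `tryCost_step`, `p^(i-j) (i - β)` is the difference of consecutive terms `p^(i-j) tryCost p β
i`, so the sum telescopes. This removes the sums of variable length from the closed forms. -/
theorem sum_Ico_mul_pow (hp1 : p < 1) (β : ℝ) {j m n : ℕ} (hj : j ≤ m) (hmn : m ≤ n) :
    ∑ i ∈ Finset.Ico m n, (i : ℝ) * p ^ (i - j) =
      β * ∑ i ∈ Finset.Ico m n, p ^ (i - j) +
        (p ^ (m - j) * tryCost p β m - p ^ (n - j) * tryCost p β n) := by
  induction n, hmn using Nat.le_induction with
  | base => simp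
  | succ n hmn ih =>
    rw [Finset.sum_Ico_succ_top hmn, Finset.sum_Ico_succ_top hmn, ih,
      show n + 1 - j = (n - j) + 1 by omega, pow_succ, tryCost_step hp1 β n]
    push_cast; ring

theorem sum_Icc_two_mul (d : ℕ) :
    ∑ i ∈ Finset.Icc (d + 1) (2 * d), (i : ℝ) = d * (d + 1) + d * (d - 1) / 2 := by
  rw [← Finset.Ico_add_one_right_eq_Icc, show 2 * d + 1 = d + 1 + d by ring, sum_Ico_nat_cast]
  push_cast; ring

theorem sum_Ico_two_mul (d : ℕ) :
    ∑ i ∈ Finset.Ico d (2 * d), (i : ℝ) = d * d + d * (d - 1) / 2 := by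
  rw [two_mul, sum_Ico_nat_cast]

theorem sum_Icc_one (d : ℕ) : ∑ i ∈ Finset.Icc 1 d, (i : ℝ) = d + d * (d - 1) / 2 := by
  rw [← Finset.Ico_add_one_right_eq_Icc, add_comm d 1, sum_Ico_nat_cast]
  push_cast; ring

theorem f₁_sub (hp1 : p < 1) (β : ℝ) (hd : 2 ≤ d) {s : ℕ} (hs : d + 1 ≤ s) :
    f₁ p q d s - β * g₁ p q d s =
      c₁ p q d s * (p / (1 - q) * (1 - β) + (p * tryCost p β 2 - p ^ d * tryCost p β (d + 1)))
        + (d - β) * p ^ (s - 1) + p ^ d * tryCost p β (d + 1)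
        + p ^ (s - 1) * (relCost d β 0 s - tryCost p β s) := by
  simp only [f₁, g₁, ← Finset.sum_mul, sum_Ico_nat_cast, relCost]
  rw [← Finset.Ico_add_one_right_eq_Icc 2 d,
    sum_Ico_mul_pow hp1 β (by omega : 1 ≤ 2) (by omega : 2 ≤ d + 1),
    sum_Ico_mul_pow hp1 β (by omega : 1 ≤ d + 1) hs]
  simp only [Nat.add_sub_cancel, show 2 - 1 = 1 by rfl, pow_one]
  push_cast
  ring

theorem f₂_sub (hp1 : p < 1) (β : ℝ) (hd : 2 ≤ d) {s : ℕ} (hs : 2 ≤ s) :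
    f₂ p q d s - β * g₂ p q d s =
      p / (1 - q) * (1 - β) + p * tryCost p β 2
        + p ^ (s - 1) * (relCost d β 0 s - tryCost p β s + c₂ p q d * relCost d β 0 d
          + ((1 - q) * relCost d β 0 (d + 1) + (d - β)) / q) := by
  obtain ⟨e, rfl⟩ : ∃ e, d = e + 1 := ⟨d - 1, by omega⟩
  simp only [f₂, g₂, ← Finset.sum_mul, ← Finset.mul_sum, sum_Ico_two_mul, sum_Icc_two_mul, relCost]
  rw [← Finset.Ico_add_one_right_eq_Icc 2 s,
    sum_Ico_mul_pow hp1 β (by omega : 1 ≤ 2) (by omega : 2 ≤ s + 1),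
    show s + (e + 1) = s + 1 + e by ring, sum_Ico_nat_cast]
  have h1 := tryCost_step hp1 β s
  have h2 : p ^ s = p ^ (s - 1) * p := by
    rw [← pow_succ]; congr 1; omega
  simp only [Nat.add_sub_cancel, show 2 - 1 = 1 by rfl, pow_one, h2]
  push_cast
  linear_combination p ^ (s - 1) * h1

theorem f₃_sub (hp1 : p < 1) (β : ℝ) (hd : 2 ≤ d) {s : ℕ} (hs : d ≤ s) :
    f₃ p q d s - β * g₃ p q d s =
      (1 - p ^ (s - d)) *
        (p / (1 - q) * (1 - β) + (p * tryCost p β 2 - p ^ (d - 1) * tryCost p β d))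
        + p ^ (d - 1) * tryCost p β d
        + p ^ (s - 1) * (relCost d β 0 s - tryCost p β s
          + a p q d / b' p q d * relCost d β 0 d) := by
  obtain ⟨e, rfl⟩ : ∃ e, d = e + 1 := ⟨d - 1, by omega⟩
  simp only [f₃, g₃, ← Finset.sum_mul, sum_Ico_two_mul, relCost]
  rw [← Finset.Ico_add_one_right_eq_Icc (e + 1) s,
    sum_Ico_mul_pow hp1 β (by omega : 1 ≤ 2) (by omega : 2 ≤ e + 1),
    sum_Ico_mul_pow hp1 β (by omega : 1 ≤ e + 1) (by omega : e + 1 ≤ s + 1),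
    show s + (e + 1) = s + 1 + e by ring, sum_Ico_nat_cast]
  have h1 := tryCost_step hp1 β s
  have h2 : p ^ s = p ^ (s - 1) * p := by
    rw [← pow_succ]; congr 1; omega
  simp only [Nat.add_sub_cancel, show 2 - 1 = 1 by rfl, pow_one, h2]
  push_cast
  linear_combination p ^ (s - 1) * h1

theorem f₄_sub (hp1 : p < 1) (β : ℝ) (hd : 2 ≤ d) {s : ℕ} (hs : d ≤ s) :
    f₄ p q d s - β * g₄ p q d s =
      (1 - p ^ (s - d)) * relCost d β 0 1 + c₄ p q d s * relCost d β 0 d + tryCost p β d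
        + p ^ (s - d) * (relCost d β 0 s - tryCost p β s) := by
  obtain ⟨e, rfl⟩ : ∃ e, d = e + 1 := ⟨d - 1, by omega⟩
  simp only [f₄, g₄, ← Finset.sum_mul, sum_Ico_two_mul, sum_Icc_one, relCost]
  rw [← Finset.Ico_add_one_right_eq_Icc (e + 1) s,
    sum_Ico_mul_pow hp1 β le_rfl (by omega : e + 1 ≤ s + 1),
    show s + (e + 1) = s + 1 + e by ring, sum_Ico_nat_cast]
  have h1 := tryCost_step hp1 β s
  have h2 : p ^ (s + 1 - (e + 1)) = p ^ (s - (e + 1)) * p := by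
    rw [← pow_succ]; congr 1; omega
  simp only [Nat.sub_self, pow_zero, h2]
  push_cast
  linear_combination p ^ (s - (e + 1)) * h1

theorem f₀_sub (β : ℝ) :
    f₀ p q d - β * g₀ p q d =
      q * relCost d β 0 1 + (1 - q) * relCost d β 0 (d + 1)
        + (b' p q d * q + b p q d * (1 - q)) / a p q d * relCost d β 0 d + (d - β) := by
  simp only [f₀, g₀, sum_Ico_two_mul, sum_Icc_two_mul, sum_Icc_one, relCost]
  ring

theorem f₀'_sub (hp : 0 < p) (hp1 : p < 1) (hb : b' p q d ≠ 0) (β : ℝ) :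
    f₀' p q d - β * g₀' p q d =
      relCost d β 0 1 + a' p q d / b' p q d * relCost d β 0 d + tryCost p β d := by
  have hs : ∑' k : ℕ, ((d + k : ℕ) : ℝ) * p ^ k = d * (1 - p)⁻¹ + p / (1 - p) ^ 2 := by
    have hn : ‖p‖ < 1 := by rw [Real.norm_eq_abs, abs_of_pos hp]; exact hp1
    have h1 := (hasSum_geometric_of_norm_lt_one hn).mul_left (d : ℝ)
    have h2 := hasSum_coe_mul_geometric_of_norm_lt_one hn
    rw [← (h1.add h2).tsum_eq]
    congr 1
    ext k
    push_cast; ring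
  have hab : a' p q d = 1 - b' p q d := by rw [a'_eq, b'_eq]
  have hr : 1 - p ≠ 0 := by linarith
  simp only [f₀', g₀', hs, sum_Ico_two_mul, sum_Icc_one, relCost, tryCost, hab]
  field_simp
  ring

/-- The left side is the value of `(1,1,0)` when Channel 1 is always used; `barAge` is the `β` that
makes it vanish. -/
theorem barAge_sub (hp1 : p < 1) (hq1 : q < 1) (β : ℝ) :
    1 - β + (1 - q) * tryCost p β 2 = (barAge p q - β) * ((2 - q - p) / (1 - p)) := by
  have hr : 1 - p ≠ 0 := by linarith
  have hσ : 2 - q - p ≠ 0 := by linarith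
  simp only [barAge, tryCost]
  field_simp
  ring

end ClosedForms

/-! ### Relative value of the state `(1,1,0)` under the threshold policies -/

section Identities

variable {p q β x y K : ℝ} {d s : ℕ}

/-- The hypotheses evaluate the policy that uses Channel 1 in `(d,1,0)` and still waits in
`(d,0,0)`. Eliminating `x`, `y`, `K` leaves the value of `(1,1,0)`. The lemmas for `f₂`, `f₃`, `f₄`,
`f₀`, `f₀'` do the same for the other decisions at ages `1` and `d`. -/
theorem value_f₁ (hp1 : p < 1) (hq1 : q < 1) (hd : 2 ≤ d) (hs : d + 1 ≤ s)
    (hK : K = b p q d * x + a p q d * y)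
    (hx : x = waitCost p d β K (s - d) d)
    (hy : y = d - β + (1 - q) * waitCost p d β K (s - (d + 1)) (d + 1)) :
    f₁ p q d s - β * g₁ p q d s =
      c₁ p q d s * (p / (1 - q)) * (1 - β + (1 - q) * waitCost p d β K (s - 2) 2) := by
  rw [f₁_sub hp1 β hd hs]
  obtain ⟨e, rfl⟩ : ∃ e, d = e + 2 := ⟨d - 2, by omega⟩
  obtain ⟨k, rfl⟩ : ∃ k, s = e + 2 + 1 + k := ⟨s - (e + 2 + 1), by omega⟩
  have hw : 1 - q ≠ 0 := by linarith
  have hab : b p q (e + 2) = 1 - a p q (e + 2) := by rw [a_eq, b_eq]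
  have hT := tryCost_step hp1 β ((e : ℝ) + 2)
  simp only [waitCost, c₁, show e + 2 + 1 + k - (e + 2) = k + 1 by omega,
    show e + 2 + 1 + k - (e + 2 + 1) = k by omega, show e + 2 + 1 + k - 2 = e + 1 + k by omega,
    show e + 2 + 1 + k - 1 = e + 2 + k by omega, show k + 1 - 1 = k by omega] at hx hy ⊢
  push_cast at hx hy hT ⊢
  rw [show (e : ℝ) + 2 + (k + 1) = e + 2 + 1 + k by ring] at hx
  rw [show (2 : ℝ) + (e + 1 + k) = e + 2 + 1 + k by ring]
  have hR : relCost (e + 2) β K ((e : ℝ) + 2 + 1 + k) =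
      relCost (e + 2) β 0 ((e : ℝ) + 2 + 1 + k) + K := by simp [relCost]
  rw [hR] at hx hy ⊢
  set A := a p q (e + 2)
  rw [hab] at hK ⊢
  set T1 := tryCost p β ((e : ℝ) + 2)
  set T2 := tryCost p β ((e : ℝ) + 2 + 1)
  set Z := relCost (e + 2) β 0 ((e : ℝ) + 2 + 1 + k)
  set T3 := tryCost p β ((e : ℝ) + 2 + 1 + k)
  set T0 := tryCost p β 2
  rw [hx, hy] at hK
  field_simp
  linear_combination (-(p ^ (e + 2 + k)) * (1 - q)) * hK - p ^ (e + 2 + k) * (1 - A) * (1 - q) * hT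

theorem value_f₂ (hp : 0 < p) (hp1 : p < 1) (hq : 0 < q) (hq1 : q < 1) (hd : 2 ≤ d) (hs : 2 ≤ s)
    (hK : K = b p q d * x + a p q d * y)
    (hx : x = relCost d β K d)
    (hy : y = d - β + (1 - q) * relCost d β K (d + 1)) :
    f₂ p q d s - β * g₂ p q d s =
      p / (1 - q) * (1 - β + (1 - q) * waitCost p d β K (s - 2) 2) := by
  rw [f₂_sub hp1 β hd hs]
  obtain ⟨k, rfl⟩ : ∃ k, s = 2 + k := ⟨s - 2, by omega⟩
  have hw : 1 - q ≠ 0 := by linarith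
  have hab : b p q d = 1 - a p q d := by rw [a_eq, b_eq]
  have ha : a p q d ≠ 0 := by
    rw [a_eq]
    exact (mul_pos (by linarith) (geo_pos hp hp1 hq hq1 (by omega))).ne'
  simp only [waitCost, c₂, show 2 + k - 2 = k by omega, show 2 + k - 1 = k + 1 by omega]
  push_cast
  have hR : ∀ n, relCost d β K n = relCost d β 0 n + K := by simp [relCost]
  simp only [hR] at hx hy ⊢
  rw [hab] at hK ⊢
  set A := a p q d
  rw [hx, hy] at hK
  have hK' : K = (1 - A) / (A * q) * relCost d β 0 d +
      ((1 - q) * relCost d β 0 (d + 1) + (d - β)) / q := by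
    field_simp
    linear_combination hK
  rw [show relCost d β 0 (2 + (k : ℝ)) - tryCost p β (2 + k) + (1 - A) / (A * q) * relCost d β 0 d +
      ((1 - q) * relCost d β 0 (d + 1) + (d - β)) / q =
      relCost d β 0 (2 + (k : ℝ)) - tryCost p β (2 + k) + K by rw [hK']; ring]
  field_simp
  ring

theorem value_f₃ (hp : 0 < p) (hp1 : p < 1) (hq : 0 < q) (hq1 : q < 1) (hd : 2 ≤ d) (hs : d ≤ s)
    (hK : K = b p q d * x + a p q d * y)
    (hx : x = waitCost p d β K (s - d) d)
    (hy : y = relCost d β (b' p q d * x + a' p q d * y) d) :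
    f₃ p q d s - β * g₃ p q d s =
      (1 - p ^ (s - d)) * (p / (1 - q)) * (1 - β + (1 - q) * waitCost p d β K (s - 2) 2) := by
  rw [f₃_sub hp1 β hd hs]
  obtain ⟨e, rfl⟩ : ∃ e, d = e + 2 := ⟨d - 2, by omega⟩
  obtain ⟨k, rfl⟩ : ∃ k, s = e + 2 + k := ⟨s - (e + 2), by omega⟩
  have hw : 1 - q ≠ 0 := by linarith
  have hab : b p q (e + 2) = 1 - a p q (e + 2) := by rw [a_eq, b_eq]
  have hab' : a' p q (e + 2) = 1 - b' p q (e + 2) := by rw [a'_eq, b'_eq]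
  have hb' : b' p q (e + 2) ≠ 0 := by
    rw [b'_eq]
    exact (mul_pos (by linarith) (geo_pos hp hp1 hq hq1 (by omega))).ne'
  simp only [waitCost, show e + 2 + k - (e + 2) = k by omega,
    show e + 2 + k - 2 = e + k by omega, show e + 2 - 1 = e + 1 by omega,
    show e + 2 + k - 1 = e + 1 + k by omega] at hx ⊢
  push_cast at hx hy ⊢
  rw [show (2 : ℝ) + (e + k) = e + 2 + k by ring]
  have hR : ∀ K n, relCost (e + 2) β K n = relCost (e + 2) β 0 n + K := by
    intro K n; simp [relCost]
  rw [hR K] at hx ⊢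
  rw [hR] at hy
  rw [hab'] at hy
  rw [hab] at hK
  set A := a p q (e + 2)
  set B := b' p q (e + 2)
  set R := relCost (e + 2) β 0 ((e : ℝ) + 2)
  -- Using Channel 2 in `(d,1,0)` fixes the gap between `y` and `x` independently of the OFF
  -- decisions.
  have hy' : y = x + R / B := by
    field_simp
    linear_combination hy
  have hK' : K = x + A / B * R := by rw [hK, hy']; ring
  have e1 : A / B * R = K - x := by linarith
  rw [e1, hx]
  field_simp
  ring

theorem value_f₄ (hp : 0 < p) (hp1 : p < 1) (hq : 0 < q) (hq1 : q < 1) (hd : 2 ≤ d) (hs : d ≤ s)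
    (hK : K = b p q d * x + a p q d * y)
    (hx : x = waitCost p d β K (s - d) d)
    (hy : y = relCost d β (b' p q d * x + a' p q d * y) d) :
    f₄ p q d s - β * g₄ p q d s =
      (1 - p ^ (s - d)) * relCost d β (b' p q d * x + a' p q d * y) 1 := by
  rw [f₄_sub hp1 β hd hs]
  obtain ⟨k, rfl⟩ : ∃ k, s = d + k := ⟨s - d, by omega⟩
  have hab : b p q d = 1 - a p q d := by rw [a_eq, b_eq]
  have hab' : a' p q d = 1 - b' p q d := by rw [a'_eq, b'_eq]
  have hb' : b' p q d ≠ 0 := by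
    rw [b'_eq]
    exact (mul_pos (by linarith) (geo_pos hp hp1 hq hq1 (by omega))).ne'
  simp only [waitCost, c₄, show d + k - d = k by omega] at hx ⊢
  push_cast at hx hy ⊢
  have hR : ∀ K n, relCost d β K n = relCost d β 0 n + K := by
    intro K n; simp [relCost]
  rw [hR K] at hx
  rw [hR] at hy
  rw [hR (b' p q d * x + a' p q d * y)]
  rw [hab'] at hy ⊢
  rw [hab] at hK
  set A := a p q d
  set B := b' p q d
  set R := relCost d β 0 (d : ℝ)
  have hy' : y = x + R / B := by
    field_simp
    linear_combination hy
  have hK' : K = x + A / B * R := by rw [hK, hy']; ring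
  rw [hK'] at hx
  rw [hy']
  field_simp at hx ⊢
  linear_combination -hx

theorem value_f₀ (hp : 0 < p) (hp1 : p < 1) (hq : 0 < q) (hq1 : q < 1) (hd : 2 ≤ d)
    (hK : K = b p q d * x + a p q d * y)
    (hx : x = relCost d β K d)
    (hy : y = d - β + (1 - q) * relCost d β K (d + 1)) :
    f₀ p q d - β * g₀ p q d = q * relCost d β (b' p q d * x + a' p q d * y) 1 := by
  rw [f₀_sub]
  have hab : b p q d = 1 - a p q d := by rw [a_eq, b_eq]
  have hab' : a' p q d = 1 - b' p q d := by rw [a'_eq, b'_eq]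
  have ha : a p q d ≠ 0 := by
    rw [a_eq]
    exact (mul_pos (by linarith) (geo_pos hp hp1 hq hq1 (by omega))).ne'
  have hR : ∀ K n, relCost d β K n = relCost d β 0 n + K := by
    intro K n; simp [relCost]
  rw [hR K] at hx hy
  rw [hR (b' p q d * x + a' p q d * y)]
  rw [hab'] at ⊢
  rw [hab] at hK ⊢
  set A := a p q d
  set B := b' p q d
  rw [hx, hy] at hK
  have hK' : K = (1 - A) / (A * q) * relCost d β 0 d +
      ((1 - q) * relCost d β 0 (d + 1) + (d - β)) / q := by
    field_simp
    linear_combination hK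
  rw [hx, hy, hK']
  field_simp
  ring

theorem value_f₀' (hp : 0 < p) (hp1 : p < 1) (hq : 0 < q) (hq1 : q < 1) (hd : 2 ≤ d)
    (hx : x = tryCost p β d)
    (hy : y = relCost d β (b' p q d * x + a' p q d * y) d) :
    f₀' p q d - β * g₀' p q d = relCost d β (b' p q d * x + a' p q d * y) 1 := by
  have hab' : a' p q d = 1 - b' p q d := by rw [a'_eq, b'_eq]
  have hb' : b' p q d ≠ 0 := by
    rw [b'_eq]
    exact (mul_pos (by linarith) (geo_pos hp hp1 hq hq1 (by omega))).ne'
  rw [f₀'_sub hp hp1 hb']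
  have hR : ∀ K n, relCost d β K n = relCost d β 0 n + K := by
    intro K n; simp [relCost]
  rw [hR] at hy
  rw [hR (b' p q d * x + a' p q d * y)]
  rw [hab'] at hy ⊢
  have hy' : y = x + relCost d β 0 d / b' p q d := by
    field_simp
    linear_combination hy
  rw [hy', hx]
  field_simp
  ring

end Identities

/-! ### Average age of the threshold policies -/

section Policies

variable {p q β x y : ℝ} {d s : ℕ} {s₀ : State} {μ₀ μ₁ : ℕ → Action}

/-- From an ON state Channel 1 leads to `(1,1,0)` or to an OFF state, and Channel 2 to a delivery.
No ON value at another age enters, so `V₁` can be defined by the chosen action, and `μ₁` matters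
only at ages `1` and `d`. -/
theorem avgAge_le_of_offValues (hp : 0 < p) (hp1 : p < 1) (hq : 0 < q) (hq1 : q < 1)
    (hd : 2 ≤ d) (hs₀ : s₀.Valid d) {V₀ : ℕ → ℝ} {C : ℝ}
    (h0 : ∀ n : ℕ, 1 ≤ n → μ₀ n = Action.ch1 ∧ n - β + p * V₀ (n + 1) ≤ V₀ n ∨
      μ₀ n = Action.ch2 ∧ relCost d β (mix p q x y d false) n ≤ V₀ n)
    (hμ : ∀ n, μ₁ n = Action.ch1 ∨ μ₁ n = Action.ch2)
    (hz : μ₁ 1 = Action.ch1 ∧ 1 - β + (1 - q) * V₀ 2 ≤ 0 ∨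
      μ₁ 1 = Action.ch2 ∧ relCost d β (mix p q x y d true) 1 ≤ 0)
    (hx : V₀ d ≤ x)
    (hy : μ₁ d = Action.ch1 ∧ d - β + (1 - q) * V₀ (d + 1) ≤ y ∨
      μ₁ d = Action.ch2 ∧ relCost d β (mix p q x y d true) d ≤ y)
    (hC : ∀ n : ℕ, -C ≤ V₀ n) :
    avgAge p q d s₀ (stationary μ₀ μ₁) ≤ ((β : ℝ) : EReal) := by
  have hne : Action.ch2 ≠ Action.ch1 := by decide
  refine avgAge_stationary_le (x := x) (y := y) (V₀ := V₀)
    (V₁ := fun n => if μ₁ n = Action.ch1 then n - β + (1 - q) * V₀ (n + 1)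
      else relCost d β (mix p q x y d true) n)
    (C := |C| + |β| + |relCost d β (mix p q x y d true) 0|)
    hp hp1 hq hq1 hd hs₀ h0 ?_ ?_ hx ?_ ?_ ?_
  · intro n _
    rcases hμ n with h | h
    · left; simp [h]
    · right; simp [h]
  · rcases hz with ⟨h, h'⟩ | ⟨h, h'⟩
    · simpa [h] using h'
    · simpa [h] using h'
  · rcases hy with ⟨h, h'⟩ | ⟨h, h'⟩
    · simpa [h] using h'
    · simpa [h] using h'
  · intro n
    have := hC n
    have := le_abs_self C
    have := abs_nonneg β
    have := abs_nonneg (relCost d β (mix p q x y d true) 0)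
    linarith
  · intro n
    have e1 := hC (n + 1)
    have e2 := le_abs_self C
    have e3 := le_abs_self β
    have e4 := neg_abs_le (relCost d β (mix p q x y d true) 0)
    have e5 := abs_nonneg (relCost d β (mix p q x y d true) 0)
    have e6 := abs_nonneg β
    have e7 := abs_nonneg C
    have hn : (0 : ℝ) ≤ n := by positivity
    split_ifs
    · have : (1 - q) * -|C| ≤ (1 - q) * V₀ (n + 1) :=
        mul_le_mul_of_nonneg_left (by linarith) (by linarith)
      nlinarith
    · have : relCost d β (mix p q x y d true) 0 ≤ relCost d β (mix p q x y d true) n := by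
        unfold relCost
        have : (0 : ℝ) ≤ d * n := by positivity
        linarith
      linarith

theorem tryCost_mono (hp1 : p < 1) {m n : ℝ} (h : m ≤ n) : tryCost p β m ≤ tryCost p β n := by
  unfold tryCost
  have : 0 < 1 - p := by linarith
  gcongr

/-- A threshold policy in the OFF states. -/
theorem avgAge_nondecr_le (hp : 0 < p) (hp1 : p < 1) (hq : 0 < q) (hq1 : q < 1)
    (hd : 2 ≤ d) (hs₀ : s₀.Valid d) {K : ℝ} (hK : K = mix p q x y d false)
    (hμ : ∀ n, μ₁ n = Action.ch1 ∨ μ₁ n = Action.ch2)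
    (hz : μ₁ 1 = Action.ch1 ∧ 1 - β + (1 - q) * waitCost p d β K (s - 2) 2 ≤ 0 ∨
      μ₁ 1 = Action.ch2 ∧ relCost d β (mix p q x y d true) 1 ≤ 0)
    (hx : waitCost p d β K (s - d) d ≤ x)
    (hy : μ₁ d = Action.ch1 ∧ d - β + (1 - q) * waitCost p d β K (s - (d + 1)) (d + 1) ≤ y ∨
      μ₁ d = Action.ch2 ∧ relCost d β (mix p q x y d true) d ≤ y) :
    avgAge p q d s₀ (stationary (nondecr s) μ₁) ≤ ((β : ℝ) : EReal) := by
  refine avgAge_le_of_offValues (x := x) (y := y)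
    (V₀ := fun n => waitCost p d β K (s - n) n)
    (C := |tryCost p β 0 - (1 / (1 - p)) ^ 2| + |relCost d β K 0|)
    hp hp1 hq hq1 hd hs₀ ?_ hμ ?_ hx ?_ ?_
  · intro n _
    rcases Nat.lt_or_ge n s with h | h
    · left
      refine ⟨by simp [nondecr, h], le_of_eq ?_⟩
      rw [show s - n = (s - (n + 1)) + 1 by omega, waitCost_succ hp1]
      push_cast; rfl
    · right
      refine ⟨by simp [nondecr, h], le_of_eq ?_⟩
      simp only [Nat.sub_eq_zero_of_le h, waitCost_zero, hK]
  · simpa using hz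
  · simpa using hy
  · intro n
    refine le_trans ?_ (le_waitCost hp hp1 (s - n) n)
    have hn : (0 : ℝ) ≤ n := by positivity
    obtain ⟨h1, h2⟩ := one_sub_pow_mem hp hp1 (s - n)
    have h3 : 0 < p ^ (s - n) := pow_pos hp _
    have h4 := neg_abs_le (tryCost p β 0 - (1 / (1 - p)) ^ 2)
    have h5 := neg_abs_le (relCost d β K 0)
    have h6 := abs_nonneg (tryCost p β 0 - (1 / (1 - p)) ^ 2)
    have h7 := abs_nonneg (relCost d β K 0)
    have h8 := tryCost_mono (β := β) hp1 hn
    have h9 : relCost d β K 0 ≤ relCost d β K n := by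
      unfold relCost
      have : (0 : ℝ) ≤ d * n := by positivity
      linarith
    have h10 : (1 - p ^ (s - n)) * (-|tryCost p β 0 - (1 / (1 - p)) ^ 2|) ≤
      (1 - p ^ (s - n)) * (tryCost p β n - (1 / (1 - p)) ^ 2) :=
      mul_le_mul_of_nonneg_left (by linarith) h1
    have h11 : p ^ (s - n) * (-|relCost d β K 0|) ≤ p ^ (s - n) * relCost d β K n :=
      mul_le_mul_of_nonneg_left (by linarith) h3.le
    nlinarith

/-- Channel 1 in all OFF states. -/
theorem avgAge_off_ch1_le (hp : 0 < p) (hp1 : p < 1) (hq : 0 < q) (hq1 : q < 1)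
    (hd : 2 ≤ d) (hs₀ : s₀.Valid d)
    (hμ : ∀ n, μ₁ n = Action.ch1 ∨ μ₁ n = Action.ch2)
    (hz : μ₁ 1 = Action.ch1 ∧ 1 - β + (1 - q) * tryCost p β 2 ≤ 0 ∨
      μ₁ 1 = Action.ch2 ∧ relCost d β (mix p q x y d true) 1 ≤ 0)
    (hx : tryCost p β d ≤ x)
    (hy : μ₁ d = Action.ch1 ∧ d - β + (1 - q) * tryCost p β (d + 1) ≤ y ∨
      μ₁ d = Action.ch2 ∧ relCost d β (mix p q x y d true) d ≤ y) :
    avgAge p q d s₀ (stationary (fun _ => Action.ch1) μ₁) ≤ ((β : ℝ) : EReal) := by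
  refine avgAge_le_of_offValues (x := x) (y := y)
    (V₀ := fun n => tryCost p β n) (C := |tryCost p β 0|)
    hp hp1 hq hq1 hd hs₀ ?_ hμ ?_ hx ?_ ?_
  · intro n _
    left
    refine ⟨rfl, le_of_eq ?_⟩
    rw [tryCost_step hp1 β n]
    push_cast; rfl
  · simpa using hz
  · simpa using hy
  · intro n
    have hn : (0 : ℝ) ≤ n := by positivity
    linarith [neg_abs_le (tryCost p β 0), tryCost_mono (β := β) hp1 hn]

/-- `c₁` is one minus the coefficient of `K` in its own evaluation equation. That coefficient is a
power of `p` times a convex combination of `p` and `1 - q`. -/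
theorem c₁_pos (hp : 0 < p) (hp1 : p < 1) (hq : 0 < q) (hq1 : q < 1) (hd : 2 ≤ d)
    (hs : d + 1 ≤ s) : 0 < c₁ p q d s := by
  obtain ⟨k, rfl⟩ : ∃ k, s = d + 1 + k := ⟨s - (d + 1), by omega⟩
  simp only [c₁, a_eq, b_eq, show d + 1 + k - d = k + 1 by omega, show k + 1 - 1 = k by omega]
  have h1 := (on_off_coeff_lt_one hp hp1 hq hq1 (k := d) (by omega)).2
  have h2 := geo_pos hp hp1 hq hq1 (k := d) (by omega)
  have h3 : p ^ k ≤ 1 := pow_le_one₀ hp.le hp1.le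
  have h4 : 0 < p ^ k := pow_pos hp k
  have h5 : 0 < (1 - p) * geo p q d := mul_pos (by linarith) h2
  rw [pow_succ]
  set A := (1 - p) * geo p q d
  have h6 : (1 - A) * p + (1 - q) * A < 1 := by nlinarith
  have h7 : 0 < (1 - A) * p + (1 - q) * A := by nlinarith
  nlinarith

theorem avgAge_le_f₁ (hp : 0 < p) (hp1 : p < 1) (hq : 0 < q) (hq1 : q < 1)
    (hd : 2 ≤ d) (hs₀ : s₀.Valid d) (hs : d + 1 ≤ s)
    (hμ : ∀ n, μ₁ n = Action.ch1 ∨ μ₁ n = Action.ch2)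
    (h1 : μ₁ 1 = Action.ch1) (h2 : μ₁ d = Action.ch1)
    (hβ : f₁ p q d s - β * g₁ p q d s = 0) :
    avgAge p q d s₀ (stationary (nondecr s) μ₁) ≤ ((β : ℝ) : EReal) := by
  have hc := c₁_pos hp hp1 hq hq1 hd hs
  set K := (b p q d * waitCost p d β 0 (s - d) d +
    a p q d * (d - β + (1 - q) * waitCost p d β 0 (s - (d + 1)) (d + 1))) / c₁ p q d s with hKdef
  have hK' : K * c₁ p q d s = b p q d * waitCost p d β 0 (s - d) d +
    a p q d * (d - β + (1 - q) * waitCost p d β 0 (s - (d + 1)) (d + 1)) := by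
    rw [hKdef, div_mul_cancel₀ _ hc.ne']
  have hW : ∀ k n, waitCost p d β K k n = waitCost p d β 0 k n + p ^ k * K := by
    intro k n; simp only [waitCost, relCost]; ring
  have hK : K = b p q d * waitCost p d β K (s - d) d +
      a p q d * (d - β + (1 - q) * waitCost p d β K (s - (d + 1)) (d + 1)) := by
    rw [hW, hW]
    simp only [c₁, show s - d - 1 = s - (d + 1) by omega] at hK'
    linear_combination hK'
  have hv := value_f₁ hp1 hq1 hd hs hK rfl rfl
  rw [hβ] at hv
  have hcp : c₁ p q d s * (p / (1 - q)) ≠ 0 :=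
    (mul_pos hc (div_pos hp (by linarith))).ne'
  have hz := (mul_eq_zero.mp hv.symm).resolve_left hcp
  exact avgAge_nondecr_le hp hp1 hq hq1 hd hs₀ (hK.trans (mix_false_eq _ _).symm) hμ
    (Or.inl ⟨h1, hz.le⟩) le_rfl (Or.inl ⟨h2, le_rfl⟩)

theorem exists_off_ch2_on_ch1 (hp : 0 < p) (hp1 : p < 1) (hq : 0 < q) (hq1 : q < 1)
    (hd : 2 ≤ d) (β : ℝ) : ∃ K : ℝ, K = b p q d * relCost d β K d +
      a p q d * (d - β + (1 - q) * relCost d β K (d + 1)) := by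
  have ha : 0 < a p q d := by
    rw [a_eq]; exact mul_pos (by linarith) (geo_pos hp hp1 hq hq1 (by omega))
  have hab : b p q d = 1 - a p q d := by rw [a_eq, b_eq]
  refine ⟨(b p q d * relCost d β 0 d +
      a p q d * (d - β + (1 - q) * relCost d β 0 (d + 1))) / (a p q d * q), ?_⟩
  simp only [relCost, hab]
  field_simp
  ring

theorem avgAge_le_f₂ (hp : 0 < p) (hp1 : p < 1) (hq : 0 < q) (hq1 : q < 1)
    (hd : 2 ≤ d) (hs₀ : s₀.Valid d) (hs : 2 ≤ s) (hsd : s ≤ d)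
    (hμ : ∀ n, μ₁ n = Action.ch1 ∨ μ₁ n = Action.ch2)
    (h1 : μ₁ 1 = Action.ch1) (h2 : μ₁ d = Action.ch1)
    (hβ : f₂ p q d s - β * g₂ p q d s = 0) :
    avgAge p q d s₀ (stationary (nondecr s) μ₁) ≤ ((β : ℝ) : EReal) := by
  obtain ⟨K, hK⟩ := exists_off_ch2_on_ch1 hp hp1 hq hq1 hd β
  have hv := value_f₂ hp hp1 hq hq1 hd hs hK rfl rfl
  rw [hβ] at hv
  have hz := (mul_eq_zero.mp hv.symm).resolve_left (div_pos hp (by linarith)).ne'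
  refine avgAge_nondecr_le hp hp1 hq hq1 hd hs₀ (hK.trans (mix_false_eq _ _).symm) hμ
    (Or.inl ⟨h1, hz.le⟩) ?_ (Or.inl ⟨h2, ?_⟩)
  · rw [show s - d = 0 by omega, waitCost_zero]
  · rw [show s - (d + 1) = 0 by omega, waitCost_zero]

theorem avgAge_le_f₀ (hp : 0 < p) (hp1 : p < 1) (hq : 0 < q) (hq1 : q < 1)
    (hd : 2 ≤ d) (hs₀ : s₀.Valid d) (hsd : s ≤ d)
    (hμ : ∀ n, μ₁ n = Action.ch1 ∨ μ₁ n = Action.ch2)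
    (h1 : μ₁ 1 = Action.ch2) (h2 : μ₁ d = Action.ch1)
    (hβ : f₀ p q d - β * g₀ p q d = 0) :
    avgAge p q d s₀ (stationary (nondecr s) μ₁) ≤ ((β : ℝ) : EReal) := by
  obtain ⟨K, hK⟩ := exists_off_ch2_on_ch1 hp hp1 hq hq1 hd β
  have hv := value_f₀ hp hp1 hq hq1 hd hK rfl rfl
  rw [hβ, ← mix_true_eq] at hv
  have hz := (mul_eq_zero.mp hv.symm).resolve_left hq.ne'
  refine avgAge_nondecr_le hp hp1 hq hq1 hd hs₀ (hK.trans (mix_false_eq _ _).symm) hμ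
    (Or.inr ⟨h1, hz.le⟩) ?_ (Or.inl ⟨h2, ?_⟩)
  · rw [show s - d = 0 by omega, waitCost_zero]
  · rw [show s - (d + 1) = 0 by omega, waitCost_zero]

/-- The evaluation equations have determinant proportional to `1 - p^(s-d)`. They degenerate at `s =
d`, where both states of age `d` use Channel 2; hence the strict bound on `s`. -/
theorem exists_on_ch2 (hp : 0 < p) (hp1 : p < 1) (hq : 0 < q) (hq1 : q < 1)
    (hd : 2 ≤ d) (hs : d + 1 ≤ s) (β : ℝ) : ∃ K x y : ℝ, K = b p q d * x + a p q d * y ∧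
      x = waitCost p d β K (s - d) d ∧ y = relCost d β (b' p q d * x + a' p q d * y) d := by
  have hb' : 0 < b' p q d := by
    rw [b'_eq]; exact mul_pos (by linarith) (geo_pos hp hp1 hq hq1 (by omega))
  have hab : b p q d = 1 - a p q d := by rw [a_eq, b_eq]
  have hab' : a' p q d = 1 - b' p q d := by rw [a'_eq, b'_eq]
  have hP : 0 < 1 - p ^ (s - d) := by
    have := pow_lt_one₀ hp.le hp1 (show s - d ≠ 0 by omega)
    linarith
  set R := relCost d β 0 d with hR
  set P := p ^ (s - d) with hPd
  set x := (waitCost p d β 0 (s - d) d + P * (a p q d / b' p q d * R)) / (1 - P) with hx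
  have hx' : x * (1 - P) = waitCost p d β 0 (s - d) d + P * (a p q d / b' p q d * R) := by
    rw [hx, div_mul_cancel₀ _ hP.ne']
  have hW : ∀ K, waitCost p d β K (s - d) d = waitCost p d β 0 (s - d) d + P * K := by
    intro K; simp only [waitCost, relCost, hPd]; ring
  refine ⟨x + a p q d / b' p q d * R, x, x + R / b' p q d, ?_, ?_, ?_⟩
  · rw [hab]; ring
  · rw [hW]; linear_combination hx'
  · have : ∀ K, relCost d β K d = R + K := by intro K; simp [hR, relCost]
    rw [this, hab']
    field_simp
    ring

/-- After a delivery Channel 2 is chosen in either channel state, so the system returns to age `d`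
for ever. The state `(1,1,0)` is transient and its value need only be nonpositive. -/
theorem avgAge_le_limit (hp : 0 < p) (hp1 : p < 1) (hq : 0 < q) (hq1 : q < 1)
    (hd : 2 ≤ d) (hs₀ : s₀.Valid d) (hsd : s ≤ d)
    (hμ : ∀ n, μ₁ n = Action.ch1 ∨ μ₁ n = Action.ch2) (h2 : μ₁ d = Action.ch2) :
    avgAge p q d s₀ (stationary (nondecr s) μ₁) ≤
      ((3 / 2 * (d : ℝ) - 1 / 2 : ℝ) : EReal) := by
  set B : ℝ := 3 / 2 * (d : ℝ) - 1 / 2 with hB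
  set v := |waitCost p d B 0 (s - 2) 2| + |1 - B| + |relCost d B 0 1| with hv
  have hw : 0 < 1 - q := by linarith
  set P := p ^ (s - 2) with hP
  have hP0 : 0 < P := pow_pos hp _
  -- Large enough to make the value of `(1,1,0)` nonpositive, both when it uses Channel 2 at once
  -- and when Channel 2 is reached only after OFF attempts, with weight `(1 - q) P`.
  set C := v / ((1 - q) * P) + v with hC
  have g1 := abs_nonneg (waitCost p d B 0 (s - 2) 2)
  have g2 := abs_nonneg (1 - B)
  have g3 := abs_nonneg (relCost d B 0 1)
  have g4 : 0 ≤ v / ((1 - q) * P) := by positivity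
  have hCv : v ≤ C * ((1 - q) * P) := by
    have : v / ((1 - q) * P) ≤ C := by linarith
    rwa [div_le_iff₀ (by positivity)] at this
  have hmix : ∀ l, mix p q (-C) (-C) d l = -C := by
    intro l; cases l <;> simp [mix]
  have hR : ∀ n : ℝ, relCost d B (-C) n = relCost d B 0 n - C := by
    intro n; simp [relCost]; ring
  have hRd : relCost d B (-C) d ≤ -C := by
    rw [hR, relCost, hB]; apply le_of_eq; ring
  have hW : waitCost p d B (-C) (s - 2) 2 = waitCost p d B 0 (s - 2) 2 - P * C := by
    simp only [waitCost, relCost, hP]; ring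
  refine avgAge_nondecr_le (x := -C) (y := -C) hp hp1 hq hq1 hd hs₀ (hmix false).symm hμ ?_ ?_ ?_
  · rcases hμ 1 with h | h
    · left
      refine ⟨h, ?_⟩
      rw [hW]
      have e1 := le_abs_self (waitCost p d B 0 (s - 2) 2)
      have e2 := le_abs_self (1 - B)
      nlinarith
    · right
      refine ⟨h, ?_⟩
      rw [hmix, hR]
      have := le_abs_self (relCost d B 0 1)
      linarith
  · rw [show s - d = 0 by omega, waitCost_zero]
    exact hRd
  · right
    rw [hmix]
    exact ⟨h2, hRd⟩

theorem eq_limit_of_relCost (hd : 2 ≤ d) (h : relCost d β 0 d = 0) :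
    β = 3 / 2 * (d : ℝ) - 1 / 2 := by
  have hd' : (d : ℝ) ≠ 0 := by positivity
  have : (d : ℝ) * (3 / 2 * (d : ℝ) - 1 / 2 - β) = 0 := by
    rw [← h, relCost]; ring
  have := (mul_eq_zero.mp this).resolve_left hd'
  linarith

theorem avgAge_le_f₃ (hp : 0 < p) (hp1 : p < 1) (hq : 0 < q) (hq1 : q < 1)
    (hd : 2 ≤ d) (hs₀ : s₀.Valid d) (hs : d ≤ s)
    (hμ : ∀ n, μ₁ n = Action.ch1 ∨ μ₁ n = Action.ch2)
    (h1 : μ₁ 1 = Action.ch1) (h2 : μ₁ d = Action.ch2)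
    (hβ : f₃ p q d s - β * g₃ p q d s = 0) :
    avgAge p q d s₀ (stationary (nondecr s) μ₁) ≤ ((β : ℝ) : EReal) := by
  -- At `s = d` the root is the Channel 2 average itself, and the policy cycles on Channel 2 after
  -- each delivery.
  rcases hs.eq_or_lt with rfl | hs'
  · rw [f₃_sub hp1 β hd le_rfl] at hβ
    have hg := geo_pos hp hp1 hq hq1 (k := d) (by omega)
    have hc : 0 < a p q d / b' p q d := by
      rw [a_eq, b'_eq]
      exact div_pos (mul_pos (by linarith) hg) (mul_pos (by linarith) hg)
    have e1 : p ^ (d - 1) * (1 + a p q d / b' p q d) * relCost d β 0 d = 0 := by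
      simp only [Nat.sub_self, pow_zero] at hβ
      linear_combination hβ
    have e2 := (mul_eq_zero.mp e1).resolve_left
      (mul_pos (pow_pos hp _) (by linarith)).ne'
    rw [eq_limit_of_relCost hd e2]
    exact avgAge_le_limit hp hp1 hq hq1 hd hs₀ le_rfl hμ h2
  · obtain ⟨K, x, y, hK, hx, hy⟩ := exists_on_ch2 hp hp1 hq hq1 hd hs' β
    have hv := value_f₃ hp hp1 hq hq1 hd hs hK hx hy
    rw [hβ] at hv
    have hP : 0 < 1 - p ^ (s - d) := by
      have := pow_lt_one₀ hp.le hp1 (show s - d ≠ 0 by omega)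
      linarith
    have hz := (mul_eq_zero.mp hv.symm).resolve_left
      (mul_pos hP (div_pos hp (by linarith))).ne'
    refine avgAge_nondecr_le hp hp1 hq hq1 hd hs₀ (hK.trans (mix_false_eq _ _).symm) hμ
      (Or.inl ⟨h1, hz.le⟩) hx.ge (Or.inr ⟨h2, ?_⟩)
    rw [mix_true_eq]
    exact hy.ge

theorem avgAge_le_f₄ (hp : 0 < p) (hp1 : p < 1) (hq : 0 < q) (hq1 : q < 1)
    (hd : 2 ≤ d) (hs₀ : s₀.Valid d) (hs : d ≤ s)
    (hμ : ∀ n, μ₁ n = Action.ch1 ∨ μ₁ n = Action.ch2)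
    (h1 : μ₁ 1 = Action.ch2) (h2 : μ₁ d = Action.ch2)
    (hβ : f₄ p q d s - β * g₄ p q d s = 0) :
    avgAge p q d s₀ (stationary (nondecr s) μ₁) ≤ ((β : ℝ) : EReal) := by
  rcases hs.eq_or_lt with rfl | hs'
  · rw [f₄_sub hp1 β hd le_rfl] at hβ
    have hg := geo_pos hp hp1 hq hq1 (k := d) (by omega)
    have hc : 0 < a p q d / b' p q d := by
      rw [a_eq, b'_eq]
      exact div_pos (mul_pos (by linarith) hg) (mul_pos (by linarith) hg)
    have e1 : (1 + a p q d / b' p q d) * relCost d β 0 d = 0 := by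
      simp only [Nat.sub_self, pow_zero, c₄] at hβ
      linear_combination hβ
    have e2 := (mul_eq_zero.mp e1).resolve_left (by linarith)
    rw [eq_limit_of_relCost hd e2]
    exact avgAge_le_limit hp hp1 hq hq1 hd hs₀ le_rfl hμ h2
  · obtain ⟨K, x, y, hK, hx, hy⟩ := exists_on_ch2 hp hp1 hq hq1 hd hs' β
    have hv := value_f₄ hp hp1 hq hq1 hd hs hK hx hy
    rw [hβ, ← mix_true_eq] at hv
    have hP : 0 < 1 - p ^ (s - d) := by
      have := pow_lt_one₀ hp.le hp1 (show s - d ≠ 0 by omega)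
      linarith
    have hz := (mul_eq_zero.mp hv.symm).resolve_left hP.ne'
    refine avgAge_nondecr_le hp hp1 hq hq1 hd hs₀ (hK.trans (mix_false_eq _ _).symm) hμ
      (Or.inr ⟨h1, hz.le⟩) hx.ge (Or.inr ⟨h2, ?_⟩)
    rw [mix_true_eq]
    exact hy.ge

theorem avgAge_le_barAge (hp : 0 < p) (hp1 : p < 1) (hq : 0 < q) (hq1 : q < 1)
    (hd : 2 ≤ d) (hs₀ : s₀.Valid d) :
    avgAge p q d s₀ (stationary (fun _ => Action.ch1) (fun _ => Action.ch1)) ≤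
      ((barAge p q : ℝ) : EReal) := by
  refine avgAge_off_ch1_le (x := tryCost p (barAge p q) d)
    (y := d - barAge p q + (1 - q) * tryCost p (barAge p q) (d + 1)) hp hp1 hq hq1 hd hs₀
    (fun _ => Or.inl rfl) (Or.inl ⟨rfl, ?_⟩) le_rfl (Or.inl ⟨rfl, le_rfl⟩)
  rw [barAge_sub hp1 hq1]
  simp

theorem g₀'_pos (hp : 0 < p) (hp1 : p < 1) (hq : 0 < q) (hq1 : q < 1) (hd : 2 ≤ d) :
    0 < g₀' p q d := by
  have hb' : 0 < b' p q d := by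
    rw [b'_eq]; exact mul_pos (by linarith) (geo_pos hp hp1 hq hq1 (by omega))
  have : 0 < 1 - p := by linarith
  unfold g₀'
  positivity

theorem avgAge_le_f₀' (hp : 0 < p) (hp1 : p < 1) (hq : 0 < q) (hq1 : q < 1)
    (hd : 2 ≤ d) (hs₀ : s₀.Valid d) :
    avgAge p q d s₀ (stationary (fun _ => Action.ch1) (fun _ => Action.ch2)) ≤
      ((f₀' p q d / g₀' p q d : ℝ) : EReal) := by
  have hg := g₀'_pos hp hp1 hq hq1 hd
  set β := f₀' p q d / g₀' p q d with hβ
  have hβ' : f₀' p q d - β * g₀' p q d = 0 := by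
    rw [hβ, div_mul_cancel₀ _ hg.ne', sub_self]
  have hb' : 0 < b' p q d := by
    rw [b'_eq]; exact mul_pos (by linarith) (geo_pos hp hp1 hq hq1 (by omega))
  have hab' : a' p q d = 1 - b' p q d := by rw [a'_eq, b'_eq]
  have hy : tryCost p β d + relCost d β 0 d / b' p q d = relCost d β (b' p q d * tryCost p β d +
      a' p q d * (tryCost p β d + relCost d β 0 d / b' p q d)) d := by
    rw [hab']
    simp only [relCost]
    field_simp
    ring
  have hv := value_f₀' hp hp1 hq hq1 hd rfl hy
  rw [hβ', ← mix_true_eq] at hv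
  refine avgAge_off_ch1_le hp hp1 hq hq1 hd hs₀ (fun _ => Or.inr rfl)
    (Or.inr ⟨rfl, hv.ge⟩) le_rfl (Or.inr ⟨rfl, ?_⟩)
  rw [mix_true_eq]
  exact hy.ge

end Policies

/-! ### Minimization over the threshold, roots and bisection -/

section Roots

theorem foundByBisection_of_strictAnti {h : ℝ → ℝ} (hh : StrictAnti h) {β : ℝ} (h0 : 0 ≤ β)
    (hβ : h β = 0) : FoundByBisection h β := by
  intro L hL n
  induction n with
  | zero => simp [bisect, h0, hL]
  | succ n ih =>
    obtain ⟨h1, h2, h3⟩ := ih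
    simp only [bisect]
    set m := ((bisect h L n).1 + (bisect h L n).2) / 2 with hm
    rw [pow_succ]
    split_ifs with hneg
    · refine ⟨h1, ?_, ?_⟩
      · rw [← hβ, hh.lt_iff_gt] at hneg
        exact hneg.le
      · simp only [hm]; field_simp at h3 ⊢; linarith
    · refine ⟨?_, h2, ?_⟩
      · rw [not_lt, ← hβ, hh.le_iff_ge] at hneg
        exact hneg
      · simp only [hm]; field_simp at h3 ⊢; linarith

/-- The minimum over `s ∈ S` of the decreasing affine functions `f s - β g s` has a unique root. -/
theorem exists_root_of_min {f g : ℕ → ℝ} {σ : ℝ → ℕ} {S : Set ℕ} (hσ : ∀ β, σ β ∈ S)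
    (hmin : ∀ β, ∀ s ∈ S, f (σ β) - β * g (σ β) ≤ f s - β * g s)
    (hf : ∀ s ∈ S, 0 ≤ f s) (hg : ∀ s ∈ S, 0 < g s) :
    ∃ β, IsTheRoot (fun β => f (σ β) - β * g (σ β)) β ∧
      FoundByBisection (fun β => f (σ β) - β * g (σ β)) β := by
  set h : ℝ → ℝ := fun β => f (σ β) - β * g (σ β) with hh
  have hanti : StrictAnti h := by
    intro β β' hlt
    have h1 := hmin β' (σ β) (hσ β)
    have h2 := mul_lt_mul_of_pos_right hlt (hg _ (hσ β))
    simp only [hh]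
    linarith
  -- A minimum of affine functions is concave, and finite concavity on the line gives continuity,
  -- although `σ` jumps.
  have hconc : ConcaveOn ℝ Set.univ h := by
    refine ⟨convex_univ, fun x _ y _ u v hu hv huv => ?_⟩
    simp only [hh, smul_eq_mul]
    set z := u * x + v * y
    have h1 := mul_le_mul_of_nonneg_left (hmin x (σ z) (hσ z)) hu
    have h2 := mul_le_mul_of_nonneg_left (hmin y (σ z) (hσ z)) hv
    have h3 : u * (f (σ z) - x * g (σ z)) + v * (f (σ z) - y * g (σ z)) =
        f (σ z) - z * g (σ z) := by
      linear_combination f (σ z) * huv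
    linarith
  have hcont : Continuous h := by
    rw [← continuousOn_univ]
    exact hconc.continuousOn isOpen_univ
  have h0 : 0 ≤ h 0 := by simpa [hh] using hf _ (hσ 0)
  -- The root of one affine function of the family, where their minimum is already nonpositive.
  set N := f (σ 0) / g (σ 0) with hN
  have hN0 : 0 ≤ N := div_nonneg (hf _ (hσ 0)) (hg _ (hσ 0)).le
  have hN' : h N ≤ 0 := by
    refine (hmin N (σ 0) (hσ 0)).trans ?_
    rw [hN, div_mul_cancel₀ _ (hg _ (hσ 0)).ne', sub_self]
  obtain ⟨β, hβ, hβ'⟩ := intermediate_value_Icc' hN0 hcont.continuousOn ⟨hN', h0⟩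
  exact ⟨β, ⟨hβ.1, hβ', fun x _ hx => hanti.injective (hx.trans hβ'.symm)⟩,
    foundByBisection_of_strictAnti hanti hβ.1 hβ'⟩

/-- Walk from `s` to `σ`: every step goes downhill, whichever side `s` lies on. -/
theorem le_of_unimodal {Ψ : ℕ → ℝ} {m σ s : ℕ} (hm : m ≤ s)
    (h1 : ∀ j, m ≤ j → j < σ → Ψ (j + 1) ≤ Ψ j)
    (h2 : ∀ j, σ ≤ j → j < s → Ψ j ≤ Ψ (j + 1)) : Ψ σ ≤ Ψ s := by
  rcases le_total s σ with h | h
  · have : ∀ n, s ≤ n → n ≤ σ → Ψ n ≤ Ψ s := by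
      intro n hn
      induction n, hn using Nat.le_induction with
      | base => intro _; exact le_rfl
      | succ n hn ih => intro hle; exact (h1 n (hm.trans hn) (by omega)).trans (ih (by omega))
    exact this σ h le_rfl
  · have : ∀ n, σ ≤ n → n ≤ s → Ψ σ ≤ Ψ n := by
      intro n hn
      induction n, hn using Nat.le_induction with
      | base => intro _; exact le_rfl
      | succ n hn ih => intro hle; exact (ih (by omega)).trans (h2 n hn (by omega))
    exact this s h le_rfl

variable {p β l o : ℝ} {d : ℕ}

theorem crossing_le_iff (hF : 0 < 1 - d * (1 - p)) (n : ℤ) :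
    crossing p d l o β ≤ n ↔ 0 ≤ (1 - d * (1 - p)) * n + (l - β * o) := by
  rw [crossing, Int.ceil_le, div_le_iff₀ hF]
  constructor <;> intro h <;> linarith

/-- The threshold of the one-step comparison minimizes over `s ≥ m`. -/
theorem crossing_min (hF : 0 < 1 - d * (1 - p)) {Ψ e : ℕ → ℝ} {m : ℕ} (he : ∀ s, 0 ≤ e s)
    (hΨ : ∀ s, m ≤ s → Ψ (s + 1) - Ψ s = e s * ((1 - d * (1 - p)) * s + (l - β * o)))
    {s : ℕ} (hs : m ≤ s) : Ψ (max (crossing p d l o β) m).toNat ≤ Ψ s := by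
  refine le_of_unimodal hs (fun j hj hlt => ?_) (fun j hj _ => ?_)
  · have h1 : ¬ crossing p d l o β ≤ (j : ℤ) := by omega
    rw [crossing_le_iff hF, not_le] at h1
    have h2 := hΨ j hj
    have h3 := mul_nonpos_of_nonneg_of_nonpos (he j) h1.le
    push_cast at h3
    linarith
  · have h1 : crossing p d l o β ≤ (j : ℤ) := by omega
    rw [crossing_le_iff hF] at h1
    have h2 := hΨ j (by omega)
    have h3 := mul_nonneg (he j) h1
    push_cast at h3
    linarith

/-- The threshold of the one-step comparison minimizes over `m ≤ s ≤ M`. -/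
theorem crossing_min_le (hF : 0 < 1 - d * (1 - p)) {Ψ e : ℕ → ℝ} {m M : ℕ} (hmM : m ≤ M)
    (he : ∀ s, 0 ≤ e s)
    (hΨ : ∀ s, m ≤ s → Ψ (s + 1) - Ψ s = e s * ((1 - d * (1 - p)) * s + (l - β * o)))
    {s : ℕ} (hs : m ≤ s) (hsM : s ≤ M) :
    Ψ (max (min (crossing p d l o β) M) m).toNat ≤ Ψ s := by
  refine le_of_unimodal hs (fun j hj hlt => ?_) (fun j hj _ => ?_)
  · have h1 : ¬ crossing p d l o β ≤ (j : ℤ) := by omega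
    rw [crossing_le_iff hF, not_le] at h1
    have h2 := hΨ j hj
    have h3 := mul_nonpos_of_nonneg_of_nonpos (he j) h1.le
    push_cast at h3
    linarith
  · have h1 : crossing p d l o β ≤ (j : ℤ) := by omega
    rw [crossing_le_iff hF] at h1
    have h2 := hΨ j (by omega)
    have h3 := mul_nonneg (he j) h1
    push_cast at h3
    linarith

end Roots

/-! ### Increments of the closed forms in the threshold. -/

section Increments

variable {p q : ℝ} {d : ℕ}

/-- This is the origin of `l₁`, `o₁` and of the slope `1 - d (1 - p)`: raising the threshold by one
changes the objective by a positive power of `p` times an affine function of `s`, whose zero is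
rounded up by `crossing`. The other three cases have the same shape. -/
theorem step_f₁ (hp : 0 < p) (hp1 : p < 1) (hd : 2 ≤ d) (β : ℝ) {s : ℕ} (hs : d + 1 ≤ s) :
    (f₁ p q d (s + 1) - β * g₁ p q d (s + 1)) - (f₁ p q d s - β * g₁ p q d s) =
      p ^ (s - 1) * ((1 - d * (1 - p)) * s + (l₁ p q d - β * o₁ p q d)) := by
  rw [f₁_sub hp1 β hd hs, f₁_sub hp1 β hd (by omega : d + 1 ≤ s + 1)]
  obtain ⟨k, rfl⟩ : ∃ k, s = d + 1 + k := ⟨s - (d + 1), by omega⟩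
  have hT := tryCost_step hp1 β ((d : ℝ) + 1 + k)
  simp only [c₁, l₁, o₁, relCost, show d + 1 + k - d = k + 1 by omega,
    show d + 1 + k + 1 - d = k + 2 by omega, show k + 1 - 1 = k by omega,
    show k + 2 - 1 = k + 1 by omega,
    show d + 1 + k + 1 - 1 = d + k + 1 by omega, show d + 1 + k - 1 = d + k by omega]
  rw [← Finset.Ico_add_one_right_eq_Icc 2 d,
    sum_Ico_mul_pow hp1 β (by omega : 1 ≤ 2) (by omega : 2 ≤ d + 1)]
  simp only [Nat.add_sub_cancel, show 2 - 1 = 1 by rfl, pow_one]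
  push_cast
  generalize tryCost p β 2 = T2
  generalize tryCost p β ((d : ℝ) + 1) = T3
  generalize p / (1 - q) = w
  generalize ∑ i ∈ Finset.Ico 2 (d + 1), p ^ (i - 1) = σ
  generalize tryCost p β ((d : ℝ) + 1 + k + 1) = T4 at hT ⊢
  rw [hT]
  have hpd : p ^ d ≠ 0 := pow_ne_zero _ hp.ne'
  field_simp
  ring

theorem step_f₂ (hp1 : p < 1) (hd : 2 ≤ d) (β : ℝ) {s : ℕ} (hs : 2 ≤ s) :
    (f₂ p q d (s + 1) - β * g₂ p q d (s + 1)) - (f₂ p q d s - β * g₂ p q d s) =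
      p ^ (s - 1) * ((1 - d * (1 - p)) * s + (l₂ p q d - β * o₂ p q d)) := by
  rw [f₂_sub hp1 β hd hs, f₂_sub hp1 β hd (by omega : 2 ≤ s + 1)]
  obtain ⟨k, rfl⟩ : ∃ k, s = 2 + k := ⟨s - 2, by omega⟩
  have hT := tryCost_step hp1 β ((2 : ℝ) + k)
  simp only [l₂, o₂, relCost, ← Finset.mul_sum, sum_Ico_two_mul, sum_Icc_two_mul,
    show 2 + k + 1 - 1 = k + 2 by omega, show 2 + k - 1 = k + 1 by omega]
  push_cast
  generalize tryCost p β 2 = T2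
  generalize p / (1 - q) = w
  generalize tryCost p β ((2 : ℝ) + k + 1) = T4 at hT ⊢
  rw [hT]
  generalize c₂ p q d = c
  ring

theorem step_f₃ (hp : 0 < p) (hp1 : p < 1) (hd : 2 ≤ d) (β : ℝ) {s : ℕ} (hs : d ≤ s) :
    (f₃ p q d (s + 1) - β * g₃ p q d (s + 1)) - (f₃ p q d s - β * g₃ p q d s) =
      p ^ (s - 1) * ((1 - d * (1 - p)) * s + (l₃ p q d - β * o₃ p q d)) := by
  rw [f₃_sub hp1 β hd hs, f₃_sub hp1 β hd (by omega : d ≤ s + 1)]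
  obtain ⟨e, rfl⟩ : ∃ e, d = e + 1 := ⟨d - 1, by omega⟩
  obtain ⟨k, rfl⟩ : ∃ k, s = e + 1 + k := ⟨s - (e + 1), by omega⟩
  have hT := tryCost_step hp1 β ((e : ℝ) + 1 + k)
  simp only [l₃, o₃, relCost, sum_Ico_two_mul, show e + 1 + k - (e + 1) = k by omega,
    show e + 1 + k + 1 - (e + 1) = k + 1 by omega,
    show e + 1 + k + 1 - 1 = e + k + 1 by omega, show e + 1 + k - 1 = e + k by omega]
  rw [sum_Ico_mul_pow hp1 β (by omega : 1 ≤ 2) (by omega : 2 ≤ e + 1)]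
  simp only [Nat.add_sub_cancel, show 2 - 1 = 1 by rfl, pow_one]
  push_cast
  generalize tryCost p β 2 = T2
  generalize tryCost p β ((e : ℝ) + 1) = T3
  generalize p / (1 - q) = w
  generalize ∑ i ∈ Finset.Ico 2 (e + 1), p ^ (i - 1) = σ
  generalize tryCost p β ((e : ℝ) + 1 + k + 1) = T4 at hT ⊢
  rw [hT]
  generalize a p q (e + 1) / b' p q (e + 1) = c
  have hpd : p ^ e ≠ 0 := pow_ne_zero _ hp.ne'
  field_simp
  ring

theorem step_f₄ (hp1 : p < 1) (hd : 2 ≤ d) (β : ℝ) {s : ℕ} (hs : d ≤ s) :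
    (f₄ p q d (s + 1) - β * g₄ p q d (s + 1)) - (f₄ p q d s - β * g₄ p q d s) =
      p ^ (s - d) * ((1 - d * (1 - p)) * s + (l₄ p q d - β * o₄ p q d)) := by
  rw [f₄_sub hp1 β hd hs, f₄_sub hp1 β hd (by omega : d ≤ s + 1)]
  obtain ⟨k, rfl⟩ : ∃ k, s = d + k := ⟨s - d, by omega⟩
  have hT := tryCost_step hp1 β ((d : ℝ) + k)
  simp only [l₄, o₄, c₄, relCost, sum_Ico_two_mul, sum_Icc_one, show d + k - d = k by omega,
    show d + k + 1 - d = k + 1 by omega]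
  push_cast
  generalize tryCost p β (d : ℝ) = T2
  generalize tryCost p β ((d : ℝ) + k + 1) = T4 at hT ⊢
  rw [hT]
  ring

end Increments

/-! ### Positivity of the cycle lengths and roots of the lower envelopes. -/

section RootsOfH

variable {p q : ℝ} {d : ℕ}

theorem coeff_pos (hp : 0 < p) (hp1 : p < 1) (hq : 0 < q) (hq1 : q < 1) (hd : 2 ≤ d) :
    0 < a p q d ∧ 0 < b p q d ∧ 0 < a' p q d ∧ 0 < b' p q d := by
  have h1 := on_off_coeff_lt_one hp hp1 hq hq1 (k := d) (by omega)
  have h2 := geo_pos hp hp1 hq hq1 (k := d) (by omega)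
  rw [a_eq, b_eq, a'_eq, b'_eq]
  exact ⟨mul_pos (by linarith) h2, by linarith [h1.2], by linarith [h1.1],
    mul_pos (by linarith) h2⟩

theorem g₁_pos (hp : 0 < p) (hp1 : p < 1) (hq : 0 < q) (hq1 : q < 1) (hd : 2 ≤ d) {s : ℕ}
    (hs : d + 1 ≤ s) : 0 < g₁ p q d s := by
  have hc := c₁_pos hp hp1 hq hq1 hd hs
  have hw : 0 < 1 - q := by linarith
  unfold g₁
  positivity

theorem g₂_pos (hp : 0 < p) (hp1 : p < 1) (hq : 0 < q) (hq1 : q < 1) (hd : 2 ≤ d) (s : ℕ) :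
    0 < g₂ p q d s := by
  obtain ⟨h1, h2, -, -⟩ := coeff_pos hp hp1 hq hq1 hd
  have hw : 0 < 1 - q := by linarith
  have hd' : (0 : ℝ) < d - 1 := by
    have : (2 : ℝ) ≤ d := by exact_mod_cast hd
    linarith
  unfold g₂ c₂
  positivity

theorem g₃_pos (hp : 0 < p) (hp1 : p < 1) (hq : 0 < q) (hq1 : q < 1) (hd : 2 ≤ d) (s : ℕ) :
    0 < g₃ p q d s := by
  obtain ⟨h1, -, -, h2⟩ := coeff_pos hp hp1 hq hq1 hd
  have hw : 0 < 1 - q := by linarith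
  have hP := (one_sub_pow_mem hp hp1 (s - d)).1
  have hd' : (0 : ℝ) < d - 1 := by
    have : (2 : ℝ) ≤ d := by exact_mod_cast hd
    linarith
  unfold g₃
  positivity

theorem c₄_nonneg (hp : 0 < p) (hp1 : p < 1) (hq : 0 < q) (hq1 : q < 1) (hd : 2 ≤ d) (s : ℕ) :
    0 ≤ c₄ p q d s := by
  obtain ⟨h1, -, h3, h2⟩ := coeff_pos hp hp1 hq hq1 hd
  have hP := (one_sub_pow_mem hp hp1 (s - d)).1
  have : a' p q d + (a p q d - a' p q d) * p ^ (s - d) =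
    a' p q d * (1 - p ^ (s - d)) + a p q d * p ^ (s - d) := by ring
  rw [c₄, this]
  positivity

theorem g₄_pos (hp : 0 < p) (hp1 : p < 1) (hq : 0 < q) (hq1 : q < 1) (hd : 2 ≤ d) (s : ℕ) :
    0 < g₄ p q d s := by
  have hc := c₄_nonneg hp hp1 hq hq1 hd s
  have hP := (one_sub_pow_mem hp hp1 (s - d)).1
  have hd' : (0 : ℝ) < d - 1 := by
    have : (2 : ℝ) ≤ d := by exact_mod_cast hd
    linarith
  unfold g₄
  positivity

theorem s₁_ge (p q : ℝ) (d : ℕ) (β : ℝ) : d + 1 ≤ s₁ p q d β := by unfold s₁; omega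
theorem s₂_ge (p q : ℝ) (d : ℕ) (β : ℝ) : 2 ≤ s₂ p q d β := by unfold s₂; omega
theorem s₂_le (p q : ℝ) {d : ℕ} (hd : 2 ≤ d) (β : ℝ) : s₂ p q d β ≤ d := by unfold s₂; omega
theorem s₃_ge (p q : ℝ) (d : ℕ) (β : ℝ) : d ≤ s₃ p q d β := by unfold s₃; omega
theorem s₄_ge (p q : ℝ) (d : ℕ) (β : ℝ) : d ≤ s₄ p q d β := by unfold s₄; omega

theorem F_pos_iff (hp1 : p < 1) : 0 < F p d ↔ 0 < 1 - d * (1 - p) := by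
  have : 0 < 1 - p := by linarith
  rw [F, sub_pos, lt_div_iff₀ this, sub_pos]

theorem h₁_le (hp : 0 < p) (hp1 : p < 1) (hd : 2 ≤ d) (hF : 0 < F p d) (β : ℝ) {s : ℕ}
    (hs : d + 1 ≤ s) : h₁ p q d β ≤ f₁ p q d s - β * g₁ p q d s := by
  rw [F_pos_iff hp1] at hF
  exact_mod_cast crossing_min hF (e := fun s => p ^ (s - 1)) (m := d + 1)
    (Ψ := fun s => f₁ p q d s - β * g₁ p q d s) (fun s => pow_nonneg hp.le _)
    (fun s hs => step_f₁ hp hp1 hd β hs) hs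

theorem h₂_le (hp : 0 < p) (hp1 : p < 1) (hd : 2 ≤ d) (hF : 0 < F p d) (β : ℝ) {s : ℕ}
    (hs : 2 ≤ s) (hsd : s ≤ d) : h₂ p q d β ≤ f₂ p q d s - β * g₂ p q d s := by
  rw [F_pos_iff hp1] at hF
  exact crossing_min_le hF (e := fun s => p ^ (s - 1)) (m := 2) hd
    (Ψ := fun s => f₂ p q d s - β * g₂ p q d s) (fun s => pow_nonneg hp.le _)
    (fun s hs => step_f₂ hp1 hd β hs) hs hsd

theorem h₃_le (hp : 0 < p) (hp1 : p < 1) (hd : 2 ≤ d) (hF : 0 < F p d) (β : ℝ) {s : ℕ}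
    (hs : d ≤ s) : h₃ p q d β ≤ f₃ p q d s - β * g₃ p q d s := by
  rw [F_pos_iff hp1] at hF
  exact crossing_min hF (e := fun s => p ^ (s - 1)) (m := d)
    (Ψ := fun s => f₃ p q d s - β * g₃ p q d s) (fun s => pow_nonneg hp.le _)
    (fun s hs => step_f₃ hp hp1 hd β hs) hs

theorem h₄_le (hp : 0 < p) (hp1 : p < 1) (hd : 2 ≤ d) (hF : 0 < F p d) (β : ℝ) {s : ℕ}
    (hs : d ≤ s) : h₄ p q d β ≤ f₄ p q d s - β * g₄ p q d s := by
  rw [F_pos_iff hp1] at hF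
  exact crossing_min hF (e := fun s => p ^ (s - d)) (m := d)
    (Ψ := fun s => f₄ p q d s - β * g₄ p q d s) (fun s => pow_nonneg hp.le _)
    (fun s hs => step_f₄ hp1 hd β hs) hs

theorem exists_root_h₁ (hp : 0 < p) (hp1 : p < 1) (hq : 0 < q) (hq1 : q < 1) (hd : 2 ≤ d)
    (hF : 0 < F p d) : ∃ β, IsTheRoot (h₁ p q d) β ∧ FoundByBisection (h₁ p q d) β := by
  refine exists_root_of_min (S := {s | d + 1 ≤ s}) (s₁_ge p q d)
    (fun β s hs => h₁_le hp hp1 hd hF β hs) (fun s hs => ?_)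
    (fun s hs => g₁_pos hp hp1 hq hq1 hd hs)
  have hc := c₁_pos hp hp1 hq hq1 hd hs
  have hw : 0 < 1 - q := by linarith
  unfold f₁
  positivity

theorem exists_root_h₂ (hp : 0 < p) (hp1 : p < 1) (hq : 0 < q) (hq1 : q < 1) (hd : 2 ≤ d)
    (hF : 0 < F p d) : ∃ β, IsTheRoot (h₂ p q d) β ∧ FoundByBisection (h₂ p q d) β := by
  refine exists_root_of_min (S := {s | 2 ≤ s ∧ s ≤ d})
    (fun β => ⟨s₂_ge p q d β, s₂_le p q hd β⟩)
    (fun β s hs => h₂_le hp hp1 hd hF β hs.1 hs.2) (fun s hs => ?_)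
    (fun s hs => g₂_pos hp hp1 hq hq1 hd s)
  obtain ⟨h1, h2, -, -⟩ := coeff_pos hp hp1 hq hq1 hd
  have hw : 0 < 1 - q := by linarith
  unfold f₂ c₂
  positivity

theorem exists_root_h₃ (hp : 0 < p) (hp1 : p < 1) (hq : 0 < q) (hq1 : q < 1) (hd : 2 ≤ d)
    (hF : 0 < F p d) : ∃ β, IsTheRoot (h₃ p q d) β ∧ FoundByBisection (h₃ p q d) β := by
  refine exists_root_of_min (S := {s | d ≤ s}) (s₃_ge p q d)
    (fun β s hs => h₃_le hp hp1 hd hF β hs) (fun s hs => ?_)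
    (fun s hs => g₃_pos hp hp1 hq hq1 hd s)
  obtain ⟨h1, -, -, h2⟩ := coeff_pos hp hp1 hq hq1 hd
  have hw : 0 < 1 - q := by linarith
  have hP := (one_sub_pow_mem hp hp1 (s - d)).1
  unfold f₃
  positivity

theorem exists_root_h₄ (hp : 0 < p) (hp1 : p < 1) (hq : 0 < q) (hq1 : q < 1) (hd : 2 ≤ d)
    (hF : 0 < F p d) : ∃ β, IsTheRoot (h₄ p q d) β ∧ FoundByBisection (h₄ p q d) β := by
  refine exists_root_of_min (S := {s | d ≤ s}) (s₄_ge p q d)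
    (fun β s hs => h₄_le hp hp1 hd hF β hs) (fun s hs => ?_)
    (fun s hs => g₄_pos hp hp1 hq hq1 hd s)
  have hc := c₄_nonneg hp hp1 hq hq1 hd s
  have hP := (one_sub_pow_mem hp hp1 (s - d)).1
  unfold f₄
  positivity

end RootsOfH

/-! ### Structure of the solution of the optimality equation: `F > 0` -/

section Positive

variable {p q β x y : ℝ} {d : ℕ}

theorem waitCost_diff (hp1 : p < 1) (K : ℝ) (k : ℕ) (n : ℝ) :
    waitCost p d β K (k + 1) n - waitCost p d β K k n =
      p ^ k * ((1 - d * (1 - p)) * (n + k) +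
        (p * d - (1 - p) * (d * (d - 1) / 2 - d * β + K) - β * 1)) := by
  have hT := tryCost_step hp1 β (n + k)
  simp only [waitCost, relCost]
  push_cast
  rw [← add_assoc]
  linear_combination p ^ k * hT

/-- By `waitCost_diff` the gain from one more attempt has the sign of an increasing affine function
of the current age `n + k` alone. So a single threshold serves all starting ages. It can be taken at
least `2`, the least age of interest in an OFF state. -/
theorem exists_offVal_threshold (hp : 0 < p) (hp1 : p < 1) (hF : 0 < F p d) (β K : ℝ) :
    ∃ s : ℕ, 2 ≤ s ∧ ∀ n : ℕ, 2 ≤ n → offVal p d β K n = waitCost p d β K (s - n) n := by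
  rw [F_pos_iff hp1] at hF
  set l := p * d - (1 - p) * (d * (d - 1) / 2 - d * β + K) with hl
  set X := crossing p d l 1 β with hX
  refine ⟨(max X 2).toNat, by omega, fun n hn => ?_⟩
  set s := (max X 2).toNat with hs
  refine le_antisymm (offVal_le hp hp1 _ _) (le_offVal fun k => ?_)
  refine le_of_unimodal (Ψ := fun k => waitCost p d β K k n) (Nat.zero_le k)
    (fun j _ hj => ?_) (fun j hj _ => ?_)
  · have h1 : ¬ X ≤ ((n + j : ℕ) : ℤ) := by omega
    rw [hX, crossing_le_iff hF, not_le] at h1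
    have h2 := waitCost_diff (d := d) (β := β) hp1 K j n
    rw [← hl] at h2
    have h3 := mul_nonpos_of_nonneg_of_nonpos (pow_nonneg hp.le j) h1.le
    push_cast at h3
    linarith
  · have h1 : X ≤ ((n + j : ℕ) : ℤ) := by omega
    rw [hX, crossing_le_iff hF] at h1
    have h2 := waitCost_diff (d := d) (β := β) hp1 K j n
    rw [← hl] at h2
    have h3 := mul_nonneg (pow_nonneg hp.le j) h1
    push_cast at h3
    linarith

/-- Weighting the two equations by the stationary distribution of Channel 1, proportional to `1 - q`
for OFF and `1 - p` for ON, cancels `x` and `y`. -/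
theorem eq_limit_of_ch2_cycle (hp : 0 < p) (hp1 : p < 1) (hq : 0 < q) (hq1 : q < 1) (hd : 2 ≤ d)
    (hx : x = relCost d β (mix p q x y d false) d)
    (hy : y = relCost d β (mix p q x y d true) d) : β = 3 / 2 * (d : ℝ) - 1 / 2 := by
  have hg := geo_pos hp hp1 hq hq1 (k := d) (by omega)
  refine eq_limit_of_relCost hd ?_
  simp only [mix, relCost, if_true, Bool.false_eq_true, if_false] at hx hy ⊢
  have h1 : (2 - p - q) * geo p q d * (d * d + d * (d - 1) / 2 - d * β + 0) = 0 := by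
    linear_combination -(1 - q) * geo p q d * hx - (1 - p) * geo p q d * hy
  exact (mul_eq_zero.mp h1).resolve_left (ne_of_gt (mul_pos (by linarith) hg))

/-- In the region `F > 0`, `G > 0` the optimality equation is solved by one of the listed
policies. -/
theorem optimality_cases_of_G_pos (hp : 0 < p) (hp1 : p < 1) (hq : 0 < q) (hq1 : q < 1)
    (hd : 2 ≤ d) (hF : 0 < F p d) (hG : 0 < G q d) (hβ : β < 3 / 2 * (d : ℝ) - 1 / 2)
    (hx : x = offVal p d β (mix p q x y d false) d) (hy : y = onVal p q d β x y d)
    (hz : onVal p q d β x y 1 = 0) :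
    (∃ s, d + 1 ≤ s ∧ f₁ p q d s - β * g₁ p q d s = 0) ∨
    (∃ s, 2 ≤ s ∧ s ≤ d ∧ f₂ p q d s - β * g₂ p q d s = 0) ∨
    (∃ s, d ≤ s ∧ f₃ p q d s - β * g₃ p q d s = 0) ∨
    (∃ s, d ≤ s ∧ f₄ p q d s - β * g₄ p q d s = 0) := by
  have hd' : (2 : ℝ) ≤ d := by exact_mod_cast hd
  obtain ⟨s, hs2, hs⟩ := exists_offVal_threshold hp hp1 hF β (mix p q x y d false)
  have hxs := hx
  rw [hs d hd] at hxs
  have hV2 := hs 2 le_rfl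
  have hVd := hs (d + 1) (by omega)
  push_cast at hV2 hVd
  have hK := mix_false_eq (p := p) (q := q) (d := d) x y
  have hslope := offVal_add_ge (d := d) (β := β) (K := mix p q x y d false) hp hp1
    (n := 2) (m := (d : ℝ) - 1) (c := d) (by linarith) (by unfold F at hF; linarith) le_rfl
  rw [show (2 : ℝ) + (d - 1) = d + 1 by ring] at hslope
  unfold onVal at hy hz
  rw [show (1 : ℝ) + 1 = 2 by norm_num] at hz
  rcases le_total (d - β + (1 - q) * offVal p d β (mix p q x y d false) (d + 1))
    (relCost d β (mix p q x y d true) d) with hC | hC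
  · rw [min_eq_right hC] at hy
    -- From age `1` to age `d` the ON cost of Channel 1 grows by at least `(d - 1)(1 + (1 - q) d)`,
    -- that of Channel 2 by `d (d - 1)`. As `G > 0`, preferring Channel 1 at age `d` implies
    -- preferring it at age `1`.
    have hA : 1 - β + (1 - q) * offVal p d β (mix p q x y d false) 2 ≤
        relCost d β (mix p q x y d true) 1 := by
      have e1 := mul_le_mul_of_nonneg_left hslope (by linarith : 0 ≤ 1 - q)
      have e2 : relCost d β (mix p q x y d true) d =
        relCost d β (mix p q x y d true) 1 + d * (d - 1) := by unfold relCost; ring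
      unfold G at hG
      have e3 : 0 ≤ ((d : ℝ) - 1) * (1 - d * q) := mul_nonneg (by linarith) hG.le
      linarith
    rw [min_eq_right hA, hV2] at hz
    rw [hVd] at hy
    rcases Nat.lt_or_ge d s with h | h
    · left
      refine ⟨s, h, ?_⟩
      rw [value_f₁ hp1 hq1 hd h hK hxs hy, hz, mul_zero]
    · right; left
      refine ⟨s, hs2, h, ?_⟩
      rw [show s - d = 0 by omega, waitCost_zero] at hxs
      rw [show s - (d + 1) = 0 by omega, waitCost_zero] at hy
      rw [value_f₂ hp hp1 hq hq1 hd hs2 hK hxs hy, hz, mul_zero]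
  · rw [min_eq_left hC] at hy
    rcases Nat.lt_or_ge d s with h | h
    · have hy' := hy
      rw [mix_true_eq] at hy'
      rcases le_total (1 - β + (1 - q) * offVal p d β (mix p q x y d false) 2)
        (relCost d β (mix p q x y d true) 1) with hA | hA
      · right; right; left
        rw [min_eq_right hA, hV2] at hz
        refine ⟨s, h.le, ?_⟩
        rw [value_f₃ hp hp1 hq hq1 hd h.le hK hxs hy', hz, mul_zero]
      · right; right; right
        rw [min_eq_left hA, mix_true_eq] at hz
        refine ⟨s, h.le, ?_⟩
        rw [value_f₄ hp hp1 hq hq1 hd h.le hK hxs hy', hz, mul_zero]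
    · rw [show s - d = 0 by omega, waitCost_zero] at hxs
      exact absurd (eq_limit_of_ch2_cycle hp hp1 hq hq1 hd hxs hy) hβ.ne

/-- Add `d` times `h1` to `h2`. The terms in `v` combine to `w v (1 + d ρ) ≤ w v N`, which `h0`
eliminates, leaving `(d + 2)(d - 1) / 2 < w d`. This is impossible for `d ≥ 2` and `w < 1`. -/
theorem not_on_ch2_inequality {d N v w ρ β : ℝ} (hd : 2 ≤ d) (hv : 0 ≤ v) (hw : 0 < w)
    (hw1 : w < 1) (hN : 1 + d * ρ ≤ N) (h0 : (d + 1) * β = d * (d + 3) / 2 + w * v * N)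
    (h1 : β - 1 < w * (d + ρ * v)) (h2 : β - 1 < w * (v - d * (d - 1))) : False := by
  have e1 : 0 ≤ w * v * ((d + 1) * (N - (1 + d * ρ))) := by
    have : 0 ≤ N - (1 + d * ρ) := by linarith
    positivity
  have e2 : (d + 1) * (β - 1) < (d + 1) * (w * (d + ρ * v)) :=
    mul_lt_mul_of_pos_left h1 (by linarith)
  have e3 : d * ((d + 1) * (β - 1)) < d * ((d + 1) * (w * (d + ρ * v))) :=
    mul_lt_mul_of_pos_left e2 (by linarith)
  have e4 : (d + 1) * (β - 1) < (d + 1) * (w * (v - d * (d - 1))) :=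
    mul_lt_mul_of_pos_left h2 (by linarith)
  have e5 : w * d ≤ (d + 2) * (d - 1) / 2 := by nlinarith
  have e6 : (d + 1) * (w * d) ≤ (d + 1) * ((d + 2) * (d - 1) / 2) :=
    mul_le_mul_of_nonneg_left e5 (by linarith)
  have h0' : d * ((d + 1) * β) = d * (d * (d + 3) / 2 + w * v * N) := by rw [h0]
  nlinarith

theorem mul_pow_le_geo_succ {p q : ℝ} (h0 : 0 ≤ p + q - 1) (h1 : p + q - 1 ≤ 1) (d : ℕ) :
    1 + d * (p + q - 1) ^ (d + 1) ≤ geo p q (d + 1) := by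
  rw [geo_succ]
  have : (d : ℝ) * (p + q - 1) ^ d ≤ geo p q d := by
    rw [geo]
    have := Finset.card_nsmul_le_sum (Finset.range d) (fun i => (p + q - 1) ^ i)
      ((p + q - 1) ^ d) (fun i hi => pow_le_pow_of_le_one h0 h1 (Finset.mem_range.mp hi).le)
    simpa using this
  have := mul_le_mul_of_nonneg_left this h0
  rw [pow_succ]
  linarith

/-- In the region `F > 0`, `G ≤ 0` the optimality equation is solved by one of the listed
policies. -/
theorem optimality_cases_of_G_nonpos (hp : 0 < p) (hp1 : p < 1) (hq : 0 < q) (hq1 : q < 1)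
    (hd : 2 ≤ d) (hF : 0 < F p d) (hG : G q d ≤ 0) (hβ1 : 1 ≤ β)
    (hβ : β < 3 / 2 * (d : ℝ) - 1 / 2)
    (hx : x = offVal p d β (mix p q x y d false) d) (hy : y = onVal p q d β x y d)
    (hz : onVal p q d β x y 1 = 0) :
    (∃ s, d + 1 ≤ s ∧ f₁ p q d s - β * g₁ p q d s = 0) ∨
    (∃ s, 2 ≤ s ∧ s ≤ d ∧ f₂ p q d s - β * g₂ p q d s = 0) ∨
    f₀ p q d - β * g₀ p q d = 0 := by
  have hd' : (2 : ℝ) ≤ d := by exact_mod_cast hd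
  have hF' := (F_pos_iff hp1).mp hF
  -- `G ≤ 0` gives `d q ≥ 1` and `F > 0` gives `d (1 - p) < 1`: Channel 1 is positively correlated.
  have hρ : 0 < p + q - 1 := by
    unfold G at hG
    have : 0 < (d : ℝ) * (p + q - 1) := by nlinarith
    exact pos_of_mul_pos_right this (by linarith)
  have hw : 0 < 1 - q := by linarith
  obtain ⟨s, hs2, hs⟩ := exists_offVal_threshold hp hp1 hF β (mix p q x y d false)
  have hxs := hx
  rw [hs d hd] at hxs
  have hV2 := hs 2 le_rfl
  have hVd := hs (d + 1) (by omega)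
  push_cast at hV2 hVd
  have hK := mix_false_eq (p := p) (q := q) (d := d) x y
  have hslope := offVal_add_ge (d := d) (β := β) (K := mix p q x y d false) hp hp1
    (n := 2) (m := (d : ℝ) - 1) (c := d) (by linarith) (by unfold F at hF; linarith) le_rfl
  rw [show (2 : ℝ) + (d - 1) = d + 1 by ring] at hslope
  have hxd := offVal_le_relCost (d := d) (β := β) (K := mix p q x y d false) hp hp1 d
  have hV2' := offVal_le_relCost (d := d) (β := β) (K := mix p q x y d false) hp hp1 2
  rw [← hx] at hxd
  unfold onVal at hy hz
  rw [show (1 : ℝ) + 1 = 2 by norm_num] at hz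
  have hz2 : 0 ≤ 1 - β + (1 - q) * offVal p d β (mix p q x y d false) 2 := by
    rw [← hz]; exact min_le_right _ _
  have hv2 : 0 ≤ offVal p d β (mix p q x y d false) 2 := by
    have : 0 ≤ (1 - q) * offVal p d β (mix p q x y d false) 2 := by linarith
    exact nonneg_of_mul_nonneg_right this hw
  have hv : 0 ≤ offVal p d β (mix p q x y d false) (d + 1) := by nlinarith
  have hgm := geo_mul p q d
  have hKdiff : mix p q x y d false - mix p q x y d true = (p + q - 1) ^ d * (x - y) := by
    simp only [mix, if_true, Bool.false_eq_true, if_false]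
    linear_combination (y - x) * hgm
  have hρd : (p + q - 1) ^ d < 1 := pow_lt_one₀ hρ.le (by linarith) (by omega)
  have hRdiff : ∀ n, relCost d β (mix p q x y d false) n - relCost d β (mix p q x y d true) n =
      (p + q - 1) ^ d * (x - y) := by
    intro n; rw [← hKdiff]; unfold relCost; ring
  rcases Nat.lt_or_ge d s with h | h
  · -- one more attempt on Channel 1 is made in the state `(d,0,0)`
    have hxstep : x = d - β + p * offVal p d β (mix p q x y d false) (d + 1) := by
      have hxs' := hxs
      rwa [show s - d = (s - (d + 1)) + 1 by omega, waitCost_succ hp1, ← hVd] at hxs'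
    -- If Channel 2 attained `y`, then `x ≤ y` because `ρ^d < 1`. But `x` is at least the ON cost of
    -- Channel 1, since `p ≥ 1 - q` and the continuation value is nonnegative. So Channel 1 attains
    -- `y` in any case.
    have hC : y = d - β + (1 - q) * offVal p d β (mix p q x y d false) (d + 1) := by
      rcases min_choice (relCost d β (mix p q x y d true) (d : ℝ))
        (d - β + (1 - q) * offVal p d β (mix p q x y d false) (d + 1)) with h' | h'
      · have hle : y ≤ d - β + (1 - q) * offVal p d β (mix p q x y d false) (d + 1) :=
          hy.le.trans (min_le_right _ _)
        rw [h'] at hy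
        have e1 := hRdiff d
        have e2 : x ≤ y := by
          by_contra hlt
          rw [not_le] at hlt
          nlinarith
        have e3 : 0 ≤ (p + q - 1) * offVal p d β (mix p q x y d false) (d + 1) :=
          mul_nonneg hρ.le hv
        refine le_antisymm hle ?_
        linarith
      · rw [h'] at hy; exact hy
    left
    refine ⟨s, h, ?_⟩
    rw [value_f₁ hp1 hq1 hd h hK hxs (by rw [← hVd]; exact hC), ← hV2]
    suffices hA : 1 - β + (1 - q) * offVal p d β (mix p q x y d false) 2 ≤ 0 by
      rw [le_antisymm hA hz2, mul_zero]
    -- It remains to exclude Channel 2 as the strict choice in `(1,1,0)` while `(d,0,0)` still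
    -- waits.
    by_contra hA
    rw [not_le] at hA
    have hz1 : relCost d β (mix p q x y d true) 1 = 0 := by
      rcases min_choice (relCost d β (mix p q x y d true) 1)
        (1 - β + (1 - q) * offVal p d β (mix p q x y d false) 2) with h' | h'
      · rw [h'] at hz; exact hz
      · rw [h'] at hz; linarith
    set v := offVal p d β (mix p q x y d false) (d + 1) with hvdef
    set u := offVal p d β (mix p q x y d false) 2 with hudef
    have hxy : x - y = (p + q - 1) * v := by linear_combination hxstep - hC
    refine not_on_ch2_inequality (d := (d : ℝ)) (N := geo p q (d + 1)) (v := v) (w := 1 - q)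
      (ρ := (p + q - 1) ^ (d + 1)) (β := β) hd' hv hw (by linarith)
      (mul_pow_le_geo_succ hρ.le (by linarith) d) ?_ ?_ ?_
    · rw [geo_succ]
      have e1 : mix p q x y d true = y + (1 - q) * geo p q d * ((p + q - 1) * v) := by
        rw [← hxy]; simp only [mix, if_true]; ring
      rw [relCost, e1, hC] at hz1
      linear_combination -hz1
    · have e1 : u ≤ d + (p + q - 1) ^ (d + 1) * v := by
        have e2 := hRdiff 1
        have e3 : relCost d β (mix p q x y d false) 2 =
          relCost d β (mix p q x y d false) 1 + d := by unfold relCost; ring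
        rw [hxy, hz1] at e2
        rw [pow_succ]
        linarith
      have := mul_le_mul_of_nonneg_left e1 hw.le
      linarith
    · have e1 : u ≤ v - d * (d - 1) := by linarith
      have := mul_le_mul_of_nonneg_left e1 hw.le
      linarith
  · rw [show s - d = 0 by omega, waitCost_zero] at hxs
    rw [show s - (d + 1) = 0 by omega, waitCost_zero] at hVd
    rcases min_choice (relCost d β (mix p q x y d true) (d : ℝ))
      (d - β + (1 - q) * offVal p d β (mix p q x y d false) (d + 1)) with h' | h' <;> rw [h'] at hy
    · exact absurd (eq_limit_of_ch2_cycle hp hp1 hq hq1 hd hxs hy) hβ.ne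
    · rw [hVd] at hy
      right
      rcases min_choice (relCost d β (mix p q x y d true) 1)
        (1 - β + (1 - q) * offVal p d β (mix p q x y d false) 2) with h' | h' <;> rw [h'] at hz
      · right
        rw [mix_true_eq] at hz
        rw [value_f₀ hp hp1 hq hq1 hd hK hxs hy, hz, mul_zero]
      · left
        rw [hV2] at hz
        refine ⟨s, hs2, h, ?_⟩
        rw [value_f₂ hp hp1 hq hq1 hd hs2 hK hxs hy, hz, mul_zero]

end Positive

/-! ### Structure of the solution of the optimality equation: `F ≤ 0` -/

section Nonpositive

/-- Closed form of `(1 - ρ) ∑ j, j (1 - ρ ^ (j + 1))`, which is nonnegative. -/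
theorem weighted_geo_nonneg {p q : ℝ} (hρ : |p + q - 1| < 1) (d : ℕ) :
    0 ≤ (2 - p - q) * (d * (d + 1) / 2 - 2 * d) + d - geo p q d +
      (1 - (p + q - 1) ^ d) * (1 - (d - 1) * (p + q - 1)) := by
  have key : (2 - p - q) * (d * (d + 1) / 2 - 2 * d) + d - geo p q d +
      (1 - (p + q - 1) ^ d) * (1 - (d - 1) * (p + q - 1)) =
      (2 - p - q) * ∑ j ∈ Finset.range d, (j : ℝ) * (1 - (p + q - 1) ^ (j + 1)) := by
    induction d with
    | zero => simp [geo]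
    | succ d ih =>
      have : geo p q (d + 1) = geo p q d + (p + q - 1) ^ d := by
        simp [geo, Finset.sum_range_succ]
      rw [Finset.sum_range_succ, this]
      push_cast
      linear_combination ih
  rw [key]
  refine mul_nonneg (by linarith [(abs_lt.mp hρ).2]) (Finset.sum_nonneg fun j _ => ?_)
  have : |(p + q - 1) ^ (j + 1)| ≤ 1 := by
    rw [abs_pow]; exact pow_le_one₀ (abs_nonneg _) hρ.le
  exact mul_nonneg (by positivity) (by linarith [(abs_le.mp this).2])

/-- A lower bound for `(1 - ρ) ∑ j ≤ d, (j - 1) ρ ^ j`. -/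
theorem weighted_geo_lower {p q : ℝ} (hρ : |p + q - 1| < 1) {d : ℕ} (hd : 2 ≤ d) :
    -((2 - p - q) * ((d + 2) / 2)) ≤
      (2 - p - q) * (d - 1) * (1 + geo p q d * (p + q - 1)) - (d - geo p q d * (p + q - 1)) := by
  have hd' : (2 : ℝ) ≤ d := by exact_mod_cast hd
  obtain ⟨hl, hu⟩ := abs_lt.mp hρ
  rcases le_or_gt 0 (p + q - 1) with h0 | h0
  · have key : ∀ n : ℕ, (2 - p - q) * ((n : ℝ) - 1) * (1 + geo p q n * (p + q - 1)) -
        (n - geo p q n * (p + q - 1)) =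
        (2 - p - q) * ∑ j ∈ Finset.range (n + 1), ((j : ℝ) - 1) * (p + q - 1) ^ j := by
      intro n
      induction n with
      | zero => simp [geo]
      | succ n ih =>
        have h1 : geo p q (n + 1) = geo p q n + (p + q - 1) ^ n := by
          simp [geo, Finset.sum_range_succ]
        have h2 := geo_mul p q n
        rw [Finset.sum_range_succ, h1]
        push_cast
        linear_combination ih + (p + q - 1) * h2
    -- For `ρ ≥ 0` only the term `j = 0` is negative, and it equals `-1`.
    rw [key d, Finset.sum_range_succ', ← mul_neg]
    refine mul_le_mul_of_nonneg_left ?_ (by linarith)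
    have : 0 ≤ ∑ j ∈ Finset.range d, (((j + 1 : ℕ) : ℝ) - 1) * (p + q - 1) ^ (j + 1) :=
      Finset.sum_nonneg fun j _ => mul_nonneg (by push_cast; linarith [j.cast_nonneg (α := ℝ)])
        (pow_nonneg h0 _)
    simp only [Nat.cast_zero, pow_zero]
    linarith
  · set u := -(p + q - 1) with hu'
    have h1 : (p + q - 1) ^ (d + 1) ≤ u := by
      have : |(p + q - 1) ^ (d + 1)| ≤ |p + q - 1| := by
        rw [abs_pow]; exact pow_le_of_le_one (abs_nonneg _) hρ.le (by omega)
      rw [abs_of_neg h0] at this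
      exact (le_abs_self _).trans this
    have h2 := geo_mul p q d
    set T := geo p q d * (p + q - 1) with hT
    have h3 : (1 + u) * (1 + T) = 1 - (p + q - 1) ^ (d + 1) := by
      rw [hT, pow_succ, hu']; linear_combination (p + q - 1) * h2
    have h4 : 2 - p - q = 1 + u := by rw [hu']; ring
    rw [h4]
    have hu0 : 0 < u := by linarith
    have h5 : 1 - u ≤ (1 + u) * (1 + T) := by linarith
    -- after multiplication by `1 + u` everything is a polynomial in `u`
    have h6 : 0 ≤ (1 + u) * ((1 + u) * (d - 1) * (1 + T) - (d - T) + (1 + u) * ((d + 2) / 2)) := by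
      have e1 : (1 - u) * ((1 + u) * (d - 1) + 1) ≤
          (1 + u) * (1 + T) * ((1 + u) * (d - 1) + 1) :=
        mul_le_mul_of_nonneg_right h5 (by nlinarith)
      have e2 : 0 ≤ (1 + u) * ((d - 2) / 2 * (1 - u) + u) := by
        have : 0 ≤ (d - 2) / 2 * (1 - u) := mul_nonneg (by linarith) (by linarith)
        exact mul_nonneg (by linarith) (by linarith)
      nlinarith
    have := nonneg_of_mul_nonneg_right h6 (by linarith)
    linarith

variable {p q β x y : ℝ} {d : ℕ}

theorem geo_le (hρ : |p + q - 1| < 1) (d : ℕ) : geo p q d ≤ d := by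
  rw [geo]
  have := Finset.sum_le_card_nsmul (Finset.range d) (fun i => (p + q - 1) ^ i) 1 (fun i _ => by
    refine (le_abs_self _).trans ?_
    rw [abs_pow]; exact pow_le_one₀ (abs_nonneg _) hρ.le)
  simpa using this

theorem barAge_mul (hp1 : p < 1) (hq1 : q < 1) :
    (2 - p - q) * barAge p q = (2 - p - q) + (1 - q) * (1 / (1 - p)) := by
  have hr : 1 - p ≠ 0 := by linarith
  have hσ : 2 - q - p ≠ 0 := by linarith
  unfold barAge
  rw [show 2 - p - q = 2 - q - p by ring]
  field_simp
  ring

theorem F_nonpos_iff (hp1 : p < 1) : F p d ≤ 0 ↔ 1 ≤ d * (1 - p) := by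
  have : 0 < 1 - p := by linarith
  rw [F, sub_nonpos, div_le_iff₀ this]

theorem barAge_le_limit (hp1 : p < 1) (hq : 0 < q) (hq1 : q < 1) (hd : 2 ≤ d)
    (hF : F p d ≤ 0) : barAge p q ≤ 3 / 2 * (d : ℝ) - 1 / 2 := by
  have hd' : (2 : ℝ) ≤ d := by exact_mod_cast hd
  have hm := barAge_mul hp1 hq1
  have hF' := (F_nonpos_iff hp1).mp hF
  have hB : 1 / (1 - p) ≤ d := by unfold F at hF; linarith
  have hσ : 0 < 2 - p - q := by linarith
  have h1 : (1 - q) * (1 / (1 - p)) ≤ (1 - q) * d := mul_le_mul_of_nonneg_left hB (by linarith)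
  have h2 : (1 - q) * d ≤ (2 - p - q) * (3 / 2 * (d - 1)) := by
    -- For `d ≥ 3` one has `3 (d - 1) / 2 ≥ d`. This fails at `d = 2`, where `1 - p ≥ 1 / 2`
    -- supplies the difference.
    rcases hd.eq_or_lt with h | h
    · have : (d : ℝ) = 2 := by exact_mod_cast h.symm
      rw [this] at hF' ⊢
      linarith
    · have : (3 : ℝ) ≤ d := by exact_mod_cast h
      nlinarith
  have h3 : (2 - p - q) * barAge p q ≤ (2 - p - q) * (3 / 2 * (d : ℝ) - 1 / 2) := by
    rw [hm]; linarith
  exact le_of_mul_le_mul_left h3 hσ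

theorem le_barAge_of_nonneg (hp1 : p < 1) (hq1 : q < 1)
    (h : 0 ≤ 1 - β + (1 - q) * tryCost p β 2) : β ≤ barAge p q := by
  rw [barAge_sub hp1 hq1] at h
  have := nonneg_of_mul_nonneg_left h (div_pos (by linarith : 0 < 2 - q - p) (by linarith))
  linarith

/-- Use `hmain` with `m` the smaller of its two bounds and multiply by `2 - p - q`, so that `hbar`
becomes explicit. If `1 + (1 - q) B ≤ d`, the result contradicts `weighted_geo_nonneg`; otherwise `2
- p - q ≥ 1` and an elementary estimate suffices. -/
theorem not_off_ch2_inequality (hp : 0 < p) (hp1 : p < 1) (hq : 0 < q) (hq1 : q < 1)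
    (hd : 2 ≤ d) {B : ℝ} (hrB : (1 - p) * B = 1) (hB : B ≤ d) (hF' : 1 ≤ d * (1 - p))
    (hbar : β ≤ barAge p q)
    (hmain : ∀ m : ℝ, m ≤ d → m ≤ 1 + (1 - q) * B →
      d * (d + 3) / 2 + (1 - p) * geo p q d * ((d - 1) * m) + (d - 2) * B - geo p q d * (d - 2)
        - geo p q d * (1 + B) < β * (d - geo p q d)) : False := by
  have hd' : (2 : ℝ) ≤ d := by exact_mod_cast hd
  have hr : 0 < 1 - p := by linarith
  have hbarm := barAge_mul hp1 hq1
  rw [show 1 / (1 - p) = B by field_simp; linarith] at hbarm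
  have hρ := abs_eig_lt_one hp hp1 hq hq1
  have hgm := geo_mul p q d
  have hg0 := geo_pos hp hp1 hq hq1 (k := d) (by omega)
  have hgd := geo_le hρ d
  set t := geo p q d with ht
  have hσ : 0 < 2 - p - q := by linarith
  have hup : (2 - p - q) * (β * (d - t)) ≤ (d - t) * ((2 - p - q) * (1 + B) - 1) := by
    have e1 : (2 - p - q) * β ≤ (2 - p - q) * (1 + B) - 1 := by
      have := mul_le_mul_of_nonneg_left hbar hσ.le
      rw [hbarm] at this
      linarith
    have := mul_le_mul_of_nonneg_left e1 (by linarith : 0 ≤ (d : ℝ) - t)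
    linarith
  have hσB : (2 - p - q) * B ≤ (2 - p - q) * d := mul_le_mul_of_nonneg_left hB hσ.le
  rcases le_total (1 + (1 - q) * B) d with hH | hH
  · have e1 := mul_lt_mul_of_pos_left (hmain _ hH le_rfl) hσ
    have e2 := weighted_geo_nonneg hρ d
    rw [← hgm, ← ht] at e2
    have e3 : (1 - p) * t * ((d - 1) * (1 + (1 - q) * B)) = t * (d - 1) * (2 - p - q) := by
      linear_combination t * (d - 1) * (1 - q) * hrB
    rw [e3] at e1
    linarith
  · have e1 := mul_lt_mul_of_pos_left (hmain _ le_rfl hH) hσ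
    have e2 : t * (d - 1) ≤ (1 - p) * t * ((d - 1) * d) := by
      have := mul_le_mul_of_nonneg_left hF' (mul_nonneg hg0.le (by linarith : 0 ≤ (d : ℝ) - 1))
      linarith
    have e3 : 1 ≤ 2 - p - q := by
      have := mul_le_mul_of_nonneg_left hH hr.le
      have : (1 - p) * (1 + (1 - q) * B) = 2 - p - q := by linear_combination (1 - q) * hrB
      linarith
    have e4 := mul_le_mul_of_nonneg_left e2 hσ.le
    have e5 : 0 ≤ (2 - p - q) * (((d : ℝ) - 1) * (d - 2)) :=
      mul_nonneg hσ.le (mul_nonneg (by linarith) (by linarith))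
    have e6 : 0 ≤ t * (2 - p - q - 1) := mul_nonneg hg0.le (by linarith)
    linarith

/-- If `F ≤ 0`, Channel 1 is used in all OFF states. -/
theorem offVal_eq_tryCost (hp : 0 < p) (hp1 : p < 1) (hq : 0 < q) (hq1 : q < 1)
    (hd : 2 ≤ d) (hF : F p d ≤ 0)
    (hx : x = offVal p d β (mix p q x y d false) d) (hy : y = onVal p q d β x y d)
    (hz : onVal p q d β x y 1 = 0) {n : ℝ} (hn : 2 ≤ n) :
    offVal p d β (mix p q x y d false) n = tryCost p β n := by
  have hd' : (2 : ℝ) ≤ d := by exact_mod_cast hd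
  have hr : 0 < 1 - p := by linarith
  have hw : 0 < 1 - q := by linarith
  have hF' := (F_nonpos_iff hp1).mp hF
  have hB : 1 / (1 - p) ≤ d := by unfold F at hF; linarith
  set K := mix p q x y d false with hK
  set B := 1 / (1 - p) with hBdef
  have hrB : (1 - p) * B = 1 := by rw [hBdef]; field_simp
  have hB0 : 0 < B := by positivity
  have hT : ∀ m k : ℝ, tryCost p β (m + k) = tryCost p β m + k * B := by
    intro m k; rw [hBdef]; unfold tryCost; ring
  have hR : ∀ m k : ℝ, relCost d β K (m + k) = relCost d β K m + k * d := by
    intro m k; unfold relCost; ring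
  refine le_antisymm (offVal_le_tryCost hp hp1 n) ?_
  -- Comparison at age `2` is enough: with `F ≤ 0` the cost of Channel 2 has the larger slope in the
  -- age.
  suffices he : tryCost p β 2 ≤ relCost d β K 2 by
    refine le_offVal fun k => ?_
    have e1 : tryCost p β (n + k) ≤ relCost d β K (n + k) := by
      have h1 := hT 2 (n + k - 2)
      have h2 := hR 2 (n + k - 2)
      rw [show (2 : ℝ) + (n + k - 2) = n + k by ring] at h1 h2
      rw [h1, h2]
      have : 0 ≤ n + (k : ℝ) - 2 := by
        have : (0 : ℝ) ≤ k := by positivity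
        linarith
      nlinarith
    have := mul_nonneg (pow_nonneg hp.le k) (sub_nonneg.mpr e1)
    unfold waitCost
    linarith
  by_contra hlt
  rw [not_le] at hlt
  -- If Channel 2 is better than trying for ever at age `2`, it also beats every finite number of
  -- attempts, since delaying it costs `d - B ≥ 0` per step.
  have hU : offVal p d β K 2 = relCost d β K 2 := by
    refine le_antisymm (offVal_le_relCost hp hp1 2) (le_offVal fun k => ?_)
    obtain ⟨h1, h2⟩ := one_sub_pow_mem hp hp1 k
    have h3 : 0 ≤ p ^ k * (k * (d - B)) := by
      have : 0 ≤ (d : ℝ) - B := by linarith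
      positivity
    unfold waitCost
    rw [hT, hR]
    nlinarith
  set U := offVal p d β K 2 with hUdef
  have hx' : U + (d - 2) * B ≤ x := by
    have := offVal_add_ge (d := d) (β := β) (K := K) hp hp1 (n := 2) (m := (d : ℝ) - 2)
      (c := B) (by linarith) le_rfl hB
    rw [show (2 : ℝ) + (d - 2) = d by ring] at this
    rw [hx]; exact this
  have hVd : U + (d - 1) * B ≤ offVal p d β K (d + 1) := by
    have := offVal_add_ge (d := d) (β := β) (K := K) hp hp1 (n := 2) (m := (d : ℝ) - 1)
      (c := B) (by linarith) le_rfl hB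
    rwa [show (2 : ℝ) + (d - 1) = d + 1 by ring] at this
  have hz1 : 0 ≤ relCost d β (mix p q x y d true) 1 := by
    rw [← hz]; exact min_le_left _ _
  have hz2 : 0 ≤ 1 - β + (1 - q) * U := by
    rw [← hz]; unfold onVal
    rw [show (1 : ℝ) + 1 = 2 by norm_num]
    exact min_le_right _ _
  have hbar : β ≤ barAge p q := by
    refine le_barAge_of_nonneg hp1 hq1 (hz2.trans ?_)
    have := mul_le_mul_of_nonneg_left (offVal_le_tryCost (d := d) (β := β) (K := K) hp hp1 2) hw.le
    linarith
  have hg0 := geo_pos hp hp1 hq hq1 (k := d) (by omega)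
  have hg1 := (on_off_coeff_lt_one hp hp1 hq hq1 (k := d) (by omega)).2
  set t := geo p q d with ht
  have hKeq : K = (1 - (1 - p) * t) * x + (1 - p) * t * y := by
    rw [hK]; simp only [mix, Bool.false_eq_true, if_false]; ring
  have hUeq : U = 2 * d + d * (d - 1) / 2 - d * β + K := by
    rw [hU]; unfold relCost; ring
  have hUlt : (1 - p) * t * U < t * (1 + B - β) := by
    have e1 : U < (1 + B - β) * B := by
      rw [hU]; refine hlt.trans_le (le_of_eq ?_)
      rw [hBdef]; unfold tryCost; ring
    have e2 : (1 - p) * U < 1 + B - β := by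
      have e3 : (1 - p) * ((1 + B - β) * B) = 1 + B - β := by
        linear_combination (1 + B - β) * hrB
      rw [← e3]
      exact mul_lt_mul_of_pos_left e1 hr
    have := mul_lt_mul_of_pos_left e2 hg0
    linarith
  -- a lower bound for the value of the state `(d,1,0)`
  have hy' : ∀ m : ℝ, m ≤ d → m ≤ 1 + (1 - q) * B → (d - 1) * m ≤ y := by
    intro m h1 h2
    rw [hy]
    refine le_min ?_ ?_
    · have e1 : relCost d β (mix p q x y d true) d =
        relCost d β (mix p q x y d true) 1 + d * (d - 1) := by unfold relCost; ring
      have e2 : ((d : ℝ) - 1) * m ≤ (d - 1) * d := mul_le_mul_of_nonneg_left h1 (by linarith)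
      linarith
    · have e1 := mul_le_mul_of_nonneg_left hVd hw.le
      have e2 : ((d : ℝ) - 1) * m ≤ (d - 1) * (1 + (1 - q) * B) :=
        mul_le_mul_of_nonneg_left h2 (by linarith)
      linarith
  have hmain : ∀ m : ℝ, m ≤ d → m ≤ 1 + (1 - q) * B →
      d * (d + 3) / 2 + (1 - p) * t * ((d - 1) * m) + (d - 2) * B - t * (d - 2) - t * (1 + B) <
        β * (d - t) := by
    intro m h1 h2
    have e1 := mul_le_mul_of_nonneg_left (hy' m h1 h2) (mul_pos hr hg0).le
    have e2 := mul_le_mul_of_nonneg_left hx' (by linarith : 0 ≤ 1 - (1 - p) * t)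
    have e3 : (1 - p) * t * ((d - 2) * B) = t * (d - 2) := by
      linear_combination t * (d - 2) * hrB
    rw [hKeq] at hUeq
    linarith
  exact not_off_ch2_inequality hp hp1 hq hq1 hd hrB hB hF' hbar hmain

/-- In the region `F ≤ 0`, `H > 0` the optimality equation is solved by one of the listed
policies. -/
theorem optimality_cases_of_H_pos (hp : 0 < p) (hp1 : p < 1) (hq : 0 < q) (hq1 : q < 1)
    (hd : 2 ≤ d) (hF : F p d ≤ 0) (hH : 0 < H p q d)
    (hx : x = offVal p d β (mix p q x y d false) d) (hy : y = onVal p q d β x y d)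
    (hz : onVal p q d β x y 1 = 0) :
    β = barAge p q ∨ f₀' p q d - β * g₀' p q d = 0 := by
  have hd' : (2 : ℝ) ≤ d := by exact_mod_cast hd
  have hV := fun {n : ℝ} hn => offVal_eq_tryCost hp hp1 hq hq1 hd hF hx hy hz (n := n) hn
  rw [hV hd'] at hx
  unfold onVal at hy hz
  rw [hV (by linarith)] at hy hz
  rw [show (1 : ℝ) + 1 = 2 by norm_num] at hz
  rcases le_total (relCost d β (mix p q x y d true) 1)
    (1 - β + (1 - q) * tryCost p β 2) with h | h
  · right
    rw [min_eq_left h] at hz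
    have hT : tryCost p β (d + 1) = tryCost p β 2 + (d - 1) * (1 / (1 - p)) := by
      unfold tryCost; ring
    have hRd : relCost d β (mix p q x y d true) d =
      relCost d β (mix p q x y d true) 1 + d * (d - 1) := by unfold relCost; ring
    -- `H > 0` compares the growth of the two ON costs from age `1` to age `d`: choosing Channel 2
    -- at age `1` implies choosing it at age `d`.
    have hle : relCost d β (mix p q x y d true) d ≤ d - β + (1 - q) * tryCost p β (d + 1) := by
      have : (d - 1 : ℝ) * H p q d = (d - 1) * (1 + (1 - q) * (1 / (1 - p))) - d * (d - 1) := by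
        unfold H; ring
      have : 0 ≤ (d - 1 : ℝ) * H p q d := mul_nonneg (by linarith) hH.le
      rw [hRd, hT]
      linarith
    rw [min_eq_left hle, mix_true_eq] at hy
    rw [mix_true_eq] at hz
    rw [value_f₀' hp hp1 hq hq1 hd hx hy, hz]
  · left
    rw [min_eq_right h, barAge_sub hp1 hq1] at hz
    have := (mul_eq_zero.mp hz).resolve_right
      (div_pos (by linarith : 0 < 2 - q - p) (by linarith)).ne'
    linarith

/-- In the region `F ≤ 0`, `H ≤ 0` the optimality equation is solved by always using
Channel 1. -/
theorem barAge_le_of_H_nonpos (hp : 0 < p) (hp1 : p < 1) (hq : 0 < q) (hq1 : q < 1)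
    (hd : 2 ≤ d) (hF : F p d ≤ 0) (hH : H p q d ≤ 0)
    (hx : x = offVal p d β (mix p q x y d false) d) (hy : y = onVal p q d β x y d)
    (hz : onVal p q d β x y 1 = 0) : barAge p q ≤ β := by
  have hd' : (2 : ℝ) ≤ d := by exact_mod_cast hd
  have hV := fun {n : ℝ} hn => offVal_eq_tryCost hp hp1 hq hq1 hd hF hx hy hz (n := n) hn
  rw [hV hd'] at hx
  unfold onVal at hy hz
  rw [hV (by linarith)] at hy hz
  rw [show (1 : ℝ) + 1 = 2 by norm_num] at hz
  have hz2 : 0 ≤ 1 - β + (1 - q) * tryCost p β 2 := by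
    rw [← hz]; exact min_le_right _ _
  have hz1 : 0 ≤ relCost d β (mix p q x y d true) 1 := by
    rw [← hz]; exact min_le_left _ _
  by_contra hlt
  rw [not_le] at hlt
  -- If `β < barAge`, Channel 1 is strictly costly in `(1,1,0)`, so Channel 2 must attain the
  -- minimum there.
  have hz1' : relCost d β (mix p q x y d true) 1 = 0 := by
    rcases min_choice (relCost d β (mix p q x y d true) 1)
      (1 - β + (1 - q) * tryCost p β 2) with h | h <;> rw [h] at hz
    · exact hz
    · rw [barAge_sub hp1 hq1] at hz
      have := (mul_eq_zero.mp hz).resolve_right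
        (div_pos (by linarith : 0 < 2 - q - p) (by linarith)).ne'
      linarith
  have hr : 0 < 1 - p := by linarith
  have hw : 0 < 1 - q := by linarith
  set B := 1 / (1 - p) with hBdef
  have hrB : (1 - p) * B = 1 := by rw [hBdef]; field_simp
  have hB0 : 0 < B := by positivity
  have hHW : (1 - q) * B ≤ d - 1 := by
    have : H p q d = (1 - q) * B - d + 1 := by rw [hBdef]; unfold H; ring
    linarith
  have hT : tryCost p β (d + 1) = tryCost p β 2 + (d - 1) * B := by
    rw [hBdef]; unfold tryCost; ring
  have hxB : x = B * (d - 1 + B - β) := by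
    rw [hx, hBdef]; unfold tryCost; ring
  have hylow : (d - 1) * (1 + (1 - q) * B) ≤ y := by
    rw [hy]
    refine le_min ?_ ?_
    · have hRd : relCost d β (mix p q x y d true) d =
        relCost d β (mix p q x y d true) 1 + d * (d - 1) := by unfold relCost; ring
      have : ((d : ℝ) - 1) * (1 + (1 - q) * B) ≤ (d - 1) * d :=
        mul_le_mul_of_nonneg_left (by linarith) (by linarith)
      linarith
    · rw [hT]; linarith
  have hρ := abs_eig_lt_one hp hp1 hq hq1
  have hg0 := geo_pos hp hp1 hq hq1 (k := d) (by omega)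
  have hg1 := (on_off_coeff_lt_one hp hp1 hq hq1 (k := d) (by omega)).1
  have hlow := weighted_geo_lower hρ hd
  have hbarm := barAge_mul hp1 hq1
  rw [← hBdef] at hbarm
  have hσ : 0 < 2 - p - q := by linarith
  set t := geo p q d with ht
  have hz3 : d * β = d + d * (d - 1) / 2 + (1 - (1 - q) * t) * y + (1 - q) * t * x := by
    simp only [relCost, mix, if_true] at hz1'
    rw [← ht] at hz1'
    linear_combination -hz1'
  have h1 : d + d * (d - 1) / 2 + (1 - (1 - q) * t) * ((d - 1) * (1 + (1 - q) * B)) +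
      (1 - q) * t * (B * (d - 1 + B)) ≤ (d + (1 - q) * t * B) * β := by
    have := mul_le_mul_of_nonneg_left hylow (by linarith : 0 ≤ 1 - (1 - q) * t)
    rw [hxB] at hz3
    linarith
  have h2 : (d + (1 - q) * t * B) * ((2 - p - q) * β) <
      (d + (1 - q) * t * B) * ((2 - p - q) + (1 - q) * B) := by
    have e1 := mul_lt_mul_of_pos_left hlt hσ
    rw [hbarm] at e1
    exact mul_lt_mul_of_pos_left e1 (by positivity)
  have h3 := mul_le_mul_of_nonneg_left h1 hσ.le
  set W := (1 - q) * B with hW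
  have hW0 : 0 < W := by positivity
  have h4 := mul_le_mul_of_nonneg_left hlow hW0.le
  have h5 : W * ((2 - p - q) * (((d : ℝ) + 2) / 2)) ≤
      (d - 1) * ((2 - p - q) * ((d + 2) / 2)) :=
    mul_le_mul_of_nonneg_right hHW (mul_nonneg hσ.le (by linarith))
  have hσB : (2 - p - q) * B = W + 1 := by rw [hW]; linear_combination hrB
  have htB : (1 - q) * t * B = t * W := by rw [hW]; ring
  -- The excess of the lower estimate `h3` over the upper estimate `h2`. By `weighted_geo_lower` it
  -- is at least `(2 - p - q)(d + 2)/2` times `d - 1 - W`, which is nonnegative because `H ≤ 0`.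
  have h6 : (2 - p - q) * (d + d * (d - 1) / 2 + (1 - (1 - q) * t) * ((d - 1) * (1 + W)) +
      (1 - q) * t * (B * (d - 1 + B))) - (d + (1 - q) * t * B) * ((2 - p - q) + W) =
      (2 - p - q) * ((d + 2) * (d - 1) / 2) + W * ((2 - p - q) * (d - 1) * (1 + t * (p + q - 1)) -
        (d - t * (p + q - 1))) := by
    have : W = (2 - p - q) * B - 1 := by linarith
    have hr' : 1 - p = (2 - p - q) - (1 - q) := by ring
    have hwt : (1 - q) * t * B = t * ((2 - p - q) * B - 1) := by rw [htB, this]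
    rw [this]
    linear_combination ((2 - p - q) * (d - 1 + B) - ((2 - p - q) + ((2 - p - q) * B - 1)) -
      (2 - p - q) * (d - 1) * (2 - p - q)) * hwt
  linarith

end Nonpositive

/-! ### Optimal values and optimal policies in the four regions -/

section Assembly

variable {p q : ℝ} {d : ℕ} {s₀ : State}

theorem optAge_le {π : Policy} (hπ : Admissible π) {v : EReal} (h : avgAge p q d s₀ π ≤ v) :
    optAge p q d s₀ ≤ v :=
  (iInf₂_le π hπ).trans h

theorem isOptimal_of_le {π : Policy} (hπ : Admissible π) {v : EReal}
    (h : avgAge p q d s₀ π ≤ v) (hv : optAge p q d s₀ = v) : IsOptimal p q d s₀ π :=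
  ⟨hπ, le_antisymm (h.trans hv.ge) (iInf₂_le π hπ)⟩

theorem le_coe_min {v : EReal} {a b : ℝ} (ha : v ≤ (a : EReal)) (hb : v ≤ (b : EReal)) :
    v ≤ ((min a b : ℝ) : EReal) := by
  rcases min_choice a b with h | h <;> rw [h] <;> assumption

/-- `f - β g` decreases in `β`. Applied where the envelope vanishes, this places its root at or
below the root belonging to the threshold found in the optimality equation. -/
theorem le_of_root {f g β β' : ℝ} (hg : 0 < g) (h : 0 ≤ f - β * g) (h' : f - β' * g = 0) :
    β ≤ β' := by
  by_contra hlt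
  rw [not_le] at hlt
  nlinarith

theorem nondecr_cases (s n : ℕ) : nondecr s n = Action.ch1 ∨ nondecr s n = Action.ch2 := by
  unfold nondecr; split_ifs <;> simp

theorem nonincr_cases (s n : ℕ) : nonincr s n = Action.ch1 ∨ nonincr s n = Action.ch2 := by
  unfold nonincr; split_ifs <;> simp

theorem nondecr_of_lt {s n : ℕ} (h : n < s) : nondecr s n = Action.ch1 := by
  simp [nondecr, h]

theorem nondecr_of_le {s n : ℕ} (h : s ≤ n) : nondecr s n = Action.ch2 := by
  simp [nondecr, h]

theorem nonincr_of_lt {s n : ℕ} (h : n < s) : nonincr s n = Action.ch2 := by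
  simp [nonincr, h]

theorem nonincr_of_le {s n : ℕ} (h : s ≤ n) : nonincr s n = Action.ch1 := by
  simp [nonincr, h]

theorem g₀_pos (hp : 0 < p) (hp1 : p < 1) (hq : 0 < q) (hq1 : q < 1) (hd : 2 ≤ d) :
    0 < g₀ p q d := by
  obtain ⟨h1, h2, h3, h4⟩ := coeff_pos hp hp1 hq hq1 hd
  have : 0 < 1 - q := by linarith
  unfold g₀
  positivity

theorem sub_div_mul_self {f g : ℝ} (hg : 0 < g) : f - f / g * g = 0 := by
  rw [div_mul_cancel₀ _ hg.ne', sub_self]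

theorem optimal_B₁ (hp : 0 < p) (hp1 : p < 1) (hq : 0 < q) (hq1 : q < 1) (hd : 2 ≤ d)
    (hs₀ : s₀.Valid d) (hF : F p d ≤ 0) (hH : H p q d ≤ 0) :
    IsOptimal p q d s₀ (stationary (fun _ => Action.ch1) (fun _ => Action.ch1)) ∧
      optAge p q d s₀ = ((barAge p q : ℝ) : EReal) := by
  obtain ⟨β, x, y, -, -, hopt, hsol⟩ := exists_optimality_solution hp hp1 hq hq1 hd
  have hbar := avgAge_le_barAge hp hp1 hq hq1 hd hs₀
  have hadm := admissible_stationary (fun _ => Action.ch1) (fun _ => Action.ch1)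
  have hle : barAge p q ≤ β := by
    rcases lt_or_ge β (3 / 2 * (d : ℝ) - 1 / 2) with h | h
    · obtain ⟨hx, hy, hz⟩ := hsol h
      exact barAge_le_of_H_nonpos hp hp1 hq hq1 hd hF hH hx hy hz
    · exact (barAge_le_limit hp1 hq hq1 hd hF).trans h
  have heq : optAge p q d s₀ = ((barAge p q : ℝ) : EReal) :=
    le_antisymm (optAge_le hadm hbar) ((EReal.coe_le_coe_iff.mpr hle).trans (hopt s₀ hs₀))
  exact ⟨isOptimal_of_le hadm hbar heq, heq⟩

theorem optimal_B₄ (hp : 0 < p) (hp1 : p < 1) (hq : 0 < q) (hq1 : q < 1) (hd : 2 ≤ d)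
    (hs₀ : s₀.Valid d) (hF : F p d ≤ 0) (hH : 0 < H p q d) :
    optAge p q d s₀ = ((min (barAge p q) (f₀' p q d / g₀' p q d) : ℝ) : EReal) ∧
      (optAge p q d s₀ = ((barAge p q : ℝ) : EReal) →
        IsOptimal p q d s₀ (stationary (fun _ => Action.ch1) (fun _ => Action.ch1))) ∧
      (optAge p q d s₀ = ((f₀' p q d / g₀' p q d : ℝ) : EReal) →
        IsOptimal p q d s₀ (stationary (fun _ => Action.ch1) (fun _ => Action.ch2))) := by
  obtain ⟨β, x, y, -, -, hopt, hsol⟩ := exists_optimality_solution hp hp1 hq hq1 hd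
  have hbar := avgAge_le_barAge hp hp1 hq hq1 hd hs₀
  have hf₀' := avgAge_le_f₀' hp hp1 hq hq1 hd hs₀
  have hle : min (barAge p q) (f₀' p q d / g₀' p q d) ≤ β := by
    rcases lt_or_ge β (3 / 2 * (d : ℝ) - 1 / 2) with h | h
    · obtain ⟨hx, hy, hz⟩ := hsol h
      rcases optimality_cases_of_H_pos hp hp1 hq hq1 hd hF hH hx hy hz with h' | h'
      · exact (min_le_left _ _).trans h'.ge
      · have hg := g₀'_pos hp hp1 hq hq1 hd
        exact (min_le_right _ _).trans (le_of_root hg (sub_div_mul_self hg).ge h')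
    · exact (min_le_left _ _).trans ((barAge_le_limit hp1 hq hq1 hd hF).trans h)
  refine ⟨le_antisymm (le_coe_min ?_ ?_) ((EReal.coe_le_coe_iff.mpr hle).trans (hopt s₀ hs₀)),
    isOptimal_of_le (admissible_stationary _ _) hbar,
    isOptimal_of_le (admissible_stationary _ _) hf₀'⟩
  · exact optAge_le (admissible_stationary _ _) hbar
  · exact optAge_le (admissible_stationary _ _) hf₀'

theorem optimal_B₂ (hp : 0 < p) (hp1 : p < 1) (hq : 0 < q) (hq1 : q < 1) (hd : 2 ≤ d)
    (hs₀ : s₀.Valid d) (hF : 0 < F p d) (hG : G q d ≤ 0) :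
    ∃ β₁ β₂ : ℝ,
      (IsTheRoot (h₁ p q d) β₁ ∧ FoundByBisection (h₁ p q d) β₁) ∧
      (IsTheRoot (h₂ p q d) β₂ ∧ FoundByBisection (h₂ p q d) β₂) ∧
      optAge p q d s₀ =
        ((min β₁ (min β₂ (min (f₀ p q d / g₀ p q d) (3 / 2 * (d : ℝ) - 1 / 2))) : ℝ) : EReal) ∧
      (optAge p q d s₀ = ((β₁ : ℝ) : EReal) →
        IsOptimal p q d s₀ (stationary (nondecr (s₁ p q d β₁)) (nonincr 1))) ∧
      (optAge p q d s₀ = ((β₂ : ℝ) : EReal) →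
        IsOptimal p q d s₀ (stationary (nondecr (s₂ p q d β₂)) (nonincr 1))) ∧
      (optAge p q d s₀ = ((f₀ p q d / g₀ p q d : ℝ) : EReal) →
        ∀ thr : ℕ, 2 ≤ thr → thr ≤ d →
          IsOptimal p q d s₀ (stationary (nondecr 1) (nonincr thr))) ∧
      (optAge p q d s₀ = ((3 / 2 * (d : ℝ) - 1 / 2 : ℝ) : EReal) →
        ∀ thr : ℕ, d + 1 ≤ thr →
          IsOptimal p q d s₀ (stationary (nondecr 1) (nonincr thr))) := by
  obtain ⟨β₁, hβ₁, hb₁⟩ := exists_root_h₁ hp hp1 hq hq1 hd hF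
  obtain ⟨β₂, hβ₂, hb₂⟩ := exists_root_h₂ hp hp1 hq hq1 hd hF
  obtain ⟨β, x, y, hβ1, -, hopt, hsol⟩ := exists_optimality_solution hp hp1 hq hq1 hd
  have hg := g₀_pos hp hp1 hq hq1 hd
  have a₁ := avgAge_le_f₁ hp hp1 hq hq1 hd hs₀ (s₁_ge p q d β₁) (nonincr_cases 1)
    (nonincr_of_le le_rfl) (nonincr_of_le (by omega)) hβ₁.2.1
  have a₂ := avgAge_le_f₂ hp hp1 hq hq1 hd hs₀ (s₂_ge p q d β₂) (s₂_le p q hd β₂)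
    (nonincr_cases 1) (nonincr_of_le le_rfl) (nonincr_of_le (by omega)) hβ₂.2.1
  have a₃ : ∀ thr : ℕ, 2 ≤ thr → thr ≤ d →
      avgAge p q d s₀ (stationary (nondecr 1) (nonincr thr)) ≤
        ((f₀ p q d / g₀ p q d : ℝ) : EReal) := fun thr h1 h2 =>
    avgAge_le_f₀ hp hp1 hq hq1 hd hs₀ (by omega) (nonincr_cases thr)
      (nonincr_of_lt (by omega)) (nonincr_of_le h2) (sub_div_mul_self hg)
  have a₄ : ∀ thr : ℕ, d + 1 ≤ thr →
      avgAge p q d s₀ (stationary (nondecr 1) (nonincr thr)) ≤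
        ((3 / 2 * (d : ℝ) - 1 / 2 : ℝ) : EReal) := fun thr h1 =>
    avgAge_le_limit hp hp1 hq hq1 hd hs₀ (by omega) (nonincr_cases thr) (nonincr_of_lt h1)
  have hle : min β₁ (min β₂ (min (f₀ p q d / g₀ p q d) (3 / 2 * (d : ℝ) - 1 / 2))) ≤ β := by
    rcases lt_or_ge β (3 / 2 * (d : ℝ) - 1 / 2) with h | h
    · obtain ⟨hx, hy, hz⟩ := hsol h
      rcases optimality_cases_of_G_nonpos hp hp1 hq hq1 hd hF hG hβ1 h hx hy hz with
        ⟨s, hs, h'⟩ | ⟨s, hs, hs', h'⟩ | h'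
      · have := le_of_root (g₁_pos hp hp1 hq hq1 hd hs)
          (hβ₁.2.1.ge.trans (h₁_le hp hp1 hd hF β₁ hs)) h'
        simp [this]
      · have := le_of_root (g₂_pos hp hp1 hq hq1 hd s)
          (hβ₂.2.1.ge.trans (h₂_le hp hp1 hd hF β₂ hs hs')) h'
        simp [this]
      · have := le_of_root hg (sub_div_mul_self hg).ge h'
        simp [this]
    · exact (min_le_right _ _).trans ((min_le_right _ _).trans ((min_le_right _ _).trans h))
  refine ⟨β₁, β₂, ⟨hβ₁, hb₁⟩, ⟨hβ₂, hb₂⟩,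
    le_antisymm (le_coe_min ?_ (le_coe_min ?_ (le_coe_min ?_ ?_)))
      ((EReal.coe_le_coe_iff.mpr hle).trans (hopt s₀ hs₀)),
    isOptimal_of_le (admissible_stationary _ _) a₁,
    isOptimal_of_le (admissible_stationary _ _) a₂,
    fun hv thr h1 h2 => isOptimal_of_le (admissible_stationary _ _) (a₃ thr h1 h2) hv,
    fun hv thr h1 => isOptimal_of_le (admissible_stationary _ _) (a₄ thr h1) hv⟩
  · exact optAge_le (admissible_stationary _ _) a₁
  · exact optAge_le (admissible_stationary _ _) a₂
  · exact optAge_le (admissible_stationary _ _) (a₃ 2 le_rfl hd)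
  · exact optAge_le (admissible_stationary _ _) (a₄ (d + 1) le_rfl)

theorem optimal_B₃ (hp : 0 < p) (hp1 : p < 1) (hq : 0 < q) (hq1 : q < 1) (hd : 2 ≤ d)
    (hs₀ : s₀.Valid d) (hF : 0 < F p d) (hG : 0 < G q d) :
    ∃ β₁ β₂ β₃ β₄ : ℝ,
      (IsTheRoot (h₁ p q d) β₁ ∧ FoundByBisection (h₁ p q d) β₁) ∧
      (IsTheRoot (h₂ p q d) β₂ ∧ FoundByBisection (h₂ p q d) β₂) ∧
      (IsTheRoot (h₃ p q d) β₃ ∧ FoundByBisection (h₃ p q d) β₃) ∧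
      (IsTheRoot (h₄ p q d) β₄ ∧ FoundByBisection (h₄ p q d) β₄) ∧
      optAge p q d s₀ =
        ((min β₁ (min β₂ (min β₃ (min β₄ (3 / 2 * (d : ℝ) - 1 / 2)))) : ℝ) : EReal) ∧
      (optAge p q d s₀ = ((β₁ : ℝ) : EReal) →
        ∀ thr : ℕ, d + 1 ≤ thr →
          IsOptimal p q d s₀ (stationary (nondecr (s₁ p q d β₁)) (nondecr thr))) ∧
      (optAge p q d s₀ = ((β₂ : ℝ) : EReal) →
        ∀ thr : ℕ, d + 1 ≤ thr →
          IsOptimal p q d s₀ (stationary (nondecr (s₂ p q d β₂)) (nondecr thr))) ∧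
      (optAge p q d s₀ = ((β₃ : ℝ) : EReal) →
        ∀ thr : ℕ, 2 ≤ thr → thr ≤ d →
          IsOptimal p q d s₀ (stationary (nondecr (s₃ p q d β₃)) (nondecr thr))) ∧
      (optAge p q d s₀ = ((β₄ : ℝ) : EReal) →
        IsOptimal p q d s₀ (stationary (nondecr (s₄ p q d β₄)) (nondecr 1))) ∧
      (optAge p q d s₀ = ((3 / 2 * (d : ℝ) - 1 / 2 : ℝ) : EReal) →
        ∀ thr : ℕ, 1 ≤ thr → thr ≤ d →
          IsOptimal p q d s₀ (stationary (nondecr 1) (nondecr thr))) := by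
  obtain ⟨β₁, hβ₁, hb₁⟩ := exists_root_h₁ hp hp1 hq hq1 hd hF
  obtain ⟨β₂, hβ₂, hb₂⟩ := exists_root_h₂ hp hp1 hq hq1 hd hF
  obtain ⟨β₃, hβ₃, hb₃⟩ := exists_root_h₃ hp hp1 hq hq1 hd hF
  obtain ⟨β₄, hβ₄, hb₄⟩ := exists_root_h₄ hp hp1 hq hq1 hd hF
  obtain ⟨β, x, y, -, -, hopt, hsol⟩ := exists_optimality_solution hp hp1 hq hq1 hd
  have a₁ : ∀ thr : ℕ, d + 1 ≤ thr →
      avgAge p q d s₀ (stationary (nondecr (s₁ p q d β₁)) (nondecr thr)) ≤ (β₁ : EReal) :=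
    fun thr h => avgAge_le_f₁ hp hp1 hq hq1 hd hs₀ (s₁_ge p q d β₁) (nondecr_cases thr)
      (nondecr_of_lt (by omega)) (nondecr_of_lt h) hβ₁.2.1
  have a₂ : ∀ thr : ℕ, d + 1 ≤ thr →
      avgAge p q d s₀ (stationary (nondecr (s₂ p q d β₂)) (nondecr thr)) ≤ (β₂ : EReal) :=
    fun thr h => avgAge_le_f₂ hp hp1 hq hq1 hd hs₀ (s₂_ge p q d β₂) (s₂_le p q hd β₂)
      (nondecr_cases thr) (nondecr_of_lt (by omega)) (nondecr_of_lt h) hβ₂.2.1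
  have a₃ : ∀ thr : ℕ, 2 ≤ thr → thr ≤ d →
      avgAge p q d s₀ (stationary (nondecr (s₃ p q d β₃)) (nondecr thr)) ≤ (β₃ : EReal) :=
    fun thr h1 h2 => avgAge_le_f₃ hp hp1 hq hq1 hd hs₀ (s₃_ge p q d β₃) (nondecr_cases thr)
      (nondecr_of_lt (by omega)) (nondecr_of_le h2) hβ₃.2.1
  have a₄ : avgAge p q d s₀ (stationary (nondecr (s₄ p q d β₄)) (nondecr 1)) ≤ (β₄ : EReal) :=
    avgAge_le_f₄ hp hp1 hq hq1 hd hs₀ (s₄_ge p q d β₄) (nondecr_cases 1)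
      (nondecr_of_le le_rfl) (nondecr_of_le (by omega)) hβ₄.2.1
  have a₅ : ∀ thr : ℕ, 1 ≤ thr → thr ≤ d →
      avgAge p q d s₀ (stationary (nondecr 1) (nondecr thr)) ≤
        ((3 / 2 * (d : ℝ) - 1 / 2 : ℝ) : EReal) := fun thr _ h2 =>
    avgAge_le_limit hp hp1 hq hq1 hd hs₀ (by omega) (nondecr_cases thr) (nondecr_of_le h2)
  have hle : min β₁ (min β₂ (min β₃ (min β₄ (3 / 2 * (d : ℝ) - 1 / 2)))) ≤ β := by
    rcases lt_or_ge β (3 / 2 * (d : ℝ) - 1 / 2) with h | h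
    · obtain ⟨hx, hy, hz⟩ := hsol h
      rcases optimality_cases_of_G_pos hp hp1 hq hq1 hd hF hG h hx hy hz with
        ⟨s, hs, h'⟩ | ⟨s, hs, hs', h'⟩ | ⟨s, hs, h'⟩ | ⟨s, hs, h'⟩
      · have := le_of_root (g₁_pos hp hp1 hq hq1 hd hs)
          (hβ₁.2.1.ge.trans (h₁_le hp hp1 hd hF β₁ hs)) h'
        simp [this]
      · have := le_of_root (g₂_pos hp hp1 hq hq1 hd s)
          (hβ₂.2.1.ge.trans (h₂_le hp hp1 hd hF β₂ hs hs')) h'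
        simp [this]
      · have := le_of_root (g₃_pos hp hp1 hq hq1 hd s)
          (hβ₃.2.1.ge.trans (h₃_le hp hp1 hd hF β₃ hs)) h'
        simp [this]
      · have := le_of_root (g₄_pos hp hp1 hq hq1 hd s)
          (hβ₄.2.1.ge.trans (h₄_le hp hp1 hd hF β₄ hs)) h'
        simp [this]
    · exact (min_le_right _ _).trans ((min_le_right _ _).trans ((min_le_right _ _).trans
        ((min_le_right _ _).trans h)))
  refine ⟨β₁, β₂, β₃, β₄, ⟨hβ₁, hb₁⟩, ⟨hβ₂, hb₂⟩, ⟨hβ₃, hb₃⟩, ⟨hβ₄, hb₄⟩,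
    le_antisymm (le_coe_min ?_ (le_coe_min ?_ (le_coe_min ?_ (le_coe_min ?_ ?_))))
      ((EReal.coe_le_coe_iff.mpr hle).trans (hopt s₀ hs₀)),
    fun hv thr h => isOptimal_of_le (admissible_stationary _ _) (a₁ thr h) hv,
    fun hv thr h => isOptimal_of_le (admissible_stationary _ _) (a₂ thr h) hv,
    fun hv thr h1 h2 => isOptimal_of_le (admissible_stationary _ _) (a₃ thr h1 h2) hv,
    isOptimal_of_le (admissible_stationary _ _) a₄,
    fun hv thr h1 h2 => isOptimal_of_le (admissible_stationary _ _) (a₅ thr h1 h2) hv⟩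
  · exact optAge_le (admissible_stationary _ _) (a₁ (d + 1) le_rfl)
  · exact optAge_le (admissible_stationary _ _) (a₂ (d + 1) le_rfl)
  · exact optAge_le (admissible_stationary _ _) (a₃ 2 le_rfl hd)
  · exact optAge_le (admissible_stationary _ _) a₄
  · exact optAge_le (admissible_stationary _ _) (a₅ 1 le_rfl (by omega))

end Assembly

end

end HybridAoI

theorem theorem2 (p q : ℝ) (d : ℕ) (hp : 0 < p) (hp1 : p < 1) (hq : 0 < q) (hq1 : q < 1)
    (hd : 2 ≤ d) (s₀ : State) (hs₀ : s₀.Valid d) :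
    ((p, q, d) ∈ B₁ →
      IsOptimal p q d s₀ (stationary (fun _ => Action.ch1) (fun _ => Action.ch1)) ∧
      optAge p q d s₀ = ((barAge p q : ℝ) : EReal)) ∧
    ((p, q, d) ∈ B₂ →
      ∃ β₁ β₂ : ℝ,
        (IsTheRoot (h₁ p q d) β₁ ∧ FoundByBisection (h₁ p q d) β₁) ∧
        (IsTheRoot (h₂ p q d) β₂ ∧ FoundByBisection (h₂ p q d) β₂) ∧
        optAge p q d s₀ =
          ((min β₁ (min β₂ (min (f₀ p q d / g₀ p q d) (3 / 2 * (d : ℝ) - 1 / 2))) : ℝ) : EReal) ∧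
        (optAge p q d s₀ = ((β₁ : ℝ) : EReal) →
          IsOptimal p q d s₀ (stationary (nondecr (s₁ p q d β₁)) (nonincr 1))) ∧
        (optAge p q d s₀ = ((β₂ : ℝ) : EReal) →
          IsOptimal p q d s₀ (stationary (nondecr (s₂ p q d β₂)) (nonincr 1))) ∧
        (optAge p q d s₀ = ((f₀ p q d / g₀ p q d : ℝ) : EReal) →
          ∀ thr : ℕ, 2 ≤ thr → thr ≤ d →
            IsOptimal p q d s₀ (stationary (nondecr 1) (nonincr thr))) ∧
        (optAge p q d s₀ = ((3 / 2 * (d : ℝ) - 1 / 2 : ℝ) : EReal) →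
          ∀ thr : ℕ, d + 1 ≤ thr →
            IsOptimal p q d s₀ (stationary (nondecr 1) (nonincr thr)))) ∧
    ((p, q, d) ∈ B₃ →
      ∃ β₁ β₂ β₃ β₄ : ℝ,
        (IsTheRoot (h₁ p q d) β₁ ∧ FoundByBisection (h₁ p q d) β₁) ∧
        (IsTheRoot (h₂ p q d) β₂ ∧ FoundByBisection (h₂ p q d) β₂) ∧
        (IsTheRoot (h₃ p q d) β₃ ∧ FoundByBisection (h₃ p q d) β₃) ∧
        (IsTheRoot (h₄ p q d) β₄ ∧ FoundByBisection (h₄ p q d) β₄) ∧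
        optAge p q d s₀ =
          ((min β₁ (min β₂ (min β₃ (min β₄ (3 / 2 * (d : ℝ) - 1 / 2)))) : ℝ) : EReal) ∧
        (optAge p q d s₀ = ((β₁ : ℝ) : EReal) →
          ∀ thr : ℕ, d + 1 ≤ thr →
            IsOptimal p q d s₀ (stationary (nondecr (s₁ p q d β₁)) (nondecr thr))) ∧
        (optAge p q d s₀ = ((β₂ : ℝ) : EReal) →
          ∀ thr : ℕ, d + 1 ≤ thr →
            IsOptimal p q d s₀ (stationary (nondecr (s₂ p q d β₂)) (nondecr thr))) ∧
        (optAge p q d s₀ = ((β₃ : ℝ) : EReal) →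
          ∀ thr : ℕ, 2 ≤ thr → thr ≤ d →
            IsOptimal p q d s₀ (stationary (nondecr (s₃ p q d β₃)) (nondecr thr))) ∧
        (optAge p q d s₀ = ((β₄ : ℝ) : EReal) →
          IsOptimal p q d s₀ (stationary (nondecr (s₄ p q d β₄)) (nondecr 1))) ∧
        (optAge p q d s₀ = ((3 / 2 * (d : ℝ) - 1 / 2 : ℝ) : EReal) →
          ∀ thr : ℕ, 1 ≤ thr → thr ≤ d →
            IsOptimal p q d s₀ (stationary (nondecr 1) (nondecr thr)))) ∧
    ((p, q, d) ∈ B₄ →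
      optAge p q d s₀ = ((min (barAge p q) (f₀' p q d / g₀' p q d) : ℝ) : EReal) ∧
      (optAge p q d s₀ = ((barAge p q : ℝ) : EReal) →
        IsOptimal p q d s₀ (stationary (fun _ => Action.ch1) (fun _ => Action.ch1))) ∧
      (optAge p q d s₀ = ((f₀' p q d / g₀' p q d : ℝ) : EReal) →
        IsOptimal p q d s₀ (stationary (fun _ => Action.ch1) (fun _ => Action.ch2)))) := by
  refine ⟨fun h => ?_, fun h => ?_, fun h => ?_, fun h => ?_⟩
  · exact optimal_B₁ hp hp1 hq hq1 hd hs₀ h.1 h.2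
  · exact optimal_B₂ hp hp1 hq hq1 hd hs₀ h.1 h.2
  · exact optimal_B₃ hp hp1 hq hq1 hd hs₀ h.1 h.2
  · exact optimal_B₄ hp hp1 hq hq1 hd hs₀ h.1 h.2
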